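/- **Proposition 3.2.** Let $0<\alpha\le 1$. For $\phi\in L^2(\mathbb{R}^2)$ (complex-valued) and $t\in\mathbb{R}$ let $U_\alpha(t)\phi\in L^2(\mathbb{R}^2)$ be given by $$\widehat{U_\alpha(t)\phi}(\xi,\eta)=e^{-it(|\xi|^\alpha\xi+\operatorname{sgn}(\xi)\eta^2)}\,\widehat{\phi}(\xi,\eta),$$ where $\widehat f(\xi,\eta)=(2\pi)^{-1}\int_{\mathbb{R}^2}e^{-i(x\xi+y\eta)}f(x,y)\,dx\,dy$, extended to $L^2(\mathbb{R}^2)$ and to tempered distributions, and for $s\in(-\tfrac12,0]$ and $f\in L^2(\mathbb{R}^2)$ let $D_x^sf$ be the tempered distribution with $\widehat{D_x^sf}(\xi,\eta)=|\xi|^s\widehat f(\xi,\eta)$. Let $(q,p)$ be an admissible pair, that is, $2\le q,p\le\infty$, $q>2$ and $$\frac1q+\frac1p=\frac12 .$$ Then there is a constant $C$, depending only on $\alpha$, $q$ and $p$, such that for every $\phi\in L^2(\mathbb{R}^2)$ the distribution $D_x^{(\alpha-1)/(2q)}U_\alpha(t)\phi$ is a function of $(x,y)$ for almost every $t\in\mathbb{R}$,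 these functions can be chosen jointly measurable in $(t,x,y)$, and for every $T>0$ $$\big\|D_x^{\frac{1}{2q}(\alpha-1)}U_\alpha(t)\phi\big\|_{L^q_TL^p_{xy}}\le C\,\|\phi\|_{L^2(\mathbb{R}^2)},$$ where $\|u\|_{L^q_TL^p_{xy}}=\Big(\int_0^T\|u(t,\cdot)\|_{L^p(\mathbb{R}^2)}^q\,dt\Big)^{1/q}$, with the essential supremum over $t\in[0,T]$ if $q=\infty$ (and $1/\infty=0$). -/

import Mathlib

open MeasureTheory
open scoped FourierTransform SchwartzMap ENNReal NNReal

noncomputable section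

namespace FracBO

/-- The plane `ℝ²` of the variables `(x, y)`, with Euclidean norm and Lebesgue measure:
`x` is the coordinate `0` and `y` is the coordinate `1`. -/
abbrev Plane : Type := EuclideanSpace ℝ (Fin 2)

/-- Complex-valued `L²(ℝ²)`. -/
abbrev L2 : Type := Lp (α := Plane) ℂ 2 (volume : Measure Plane)

/-- The Fourier transform `(2π)⁻¹ ∫ e^{-i(xξ + yη)} f(x, y) dx dy` has the dual variable
`(ξ, η)`; Mathlib's `𝓕 f k = ∫ e^{-2πi (x k₀ + y k₁)} f(x, y) dx dy` has the dual variable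
`k = (ξ, η) / (2π)`. This is the angular frequency `ξ = 2π k₀` dual to `x`. -/
def freqX (k : Plane) : ℝ := 2 * Real.pi * k 0

/-- The angular frequency `η = 2π k₁` dual to `y`. -/
def freqY (k : Plane) : ℝ := 2 * Real.pi * k 1

/-- The dispersion function `|ξ|^α ξ + sgn(ξ) η²` of the linear equation
`u_t + D_x^α u_x + H u_yy = 0`, where `H` is the Hilbert transform in `x`. -/
def dispersion (α ξ η : ℝ) : ℝ := |ξ| ^ α * ξ + Real.sign ξ * η ^ 2

/-- The symbol `e^{-it(|ξ|^α ξ + sgn(ξ) η²)}` of `U_α(t)`, as a function of Mathlib's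
frequency variable. -/
def groupSymbol (α t : ℝ) (k : Plane) : ℂ :=
  Complex.exp (-(Complex.I * ((t * dispersion α (freqX k) (freqY k) : ℝ) : ℂ)))

lemma norm_groupSymbol (α t : ℝ) (k : Plane) : ‖groupSymbol α t k‖ = 1 := by
  rw [groupSymbol, ← mul_neg, ← Complex.ofReal_neg, mul_comm, Complex.norm_exp_ofReal_mul_I]

lemma measurable_sign : Measurable Real.sign := by
  have h : Real.sign = fun r : ℝ => if r < 0 then (-1 : ℝ) else if 0 < r then 1 else 0 := by
    funext r
    rfl
  rw [h]
  exact Measurable.ite measurableSet_Iio measurable_const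
    (Measurable.ite measurableSet_Ioi measurable_const measurable_const)

lemma measurable_groupSymbol (α t : ℝ) : Measurable (groupSymbol α t) := by
  have hX : Measurable freqX := by unfold freqX; fun_prop
  have hY : Measurable freqY := by unfold freqY; fun_prop
  have hs : Measurable fun k => Real.sign (freqX k) := measurable_sign.comp hX
  have hp : Measurable fun k => |freqX k| ^ α :=
    (continuous_abs.measurable.comp hX).pow_const α
  unfold groupSymbol dispersion
  fun_prop

lemma memLp_groupSymbol_mul (α t : ℝ) (g : L2) :
    MemLp (fun k => groupSymbol α t k * g k) 2 (volume : Measure Plane) := by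
  refine (Lp.memLp g).of_le
    ((measurable_groupSymbol α t).aestronglyMeasurable.mul (Lp.aestronglyMeasurable g)) ?_
  filter_upwards with k
  rw [norm_mul, norm_groupSymbol, one_mul]

/-- The group `U_α(t)` on `L²(ℝ²)`:
`(U_α(t) φ)^(ξ, η) = e^{-it(|ξ|^α ξ + sgn(ξ) η²)} φ^(ξ, η)`,
with the Fourier transform on `L²`. -/
def U (α t : ℝ) (φ : L2) : L2 :=
  𝓕⁻ (MemLp.toLp (fun k => groupSymbol α t k * (𝓕 φ : L2) k)
    (memLp_groupSymbol_mul α t (𝓕 φ)))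

/-- `IsDx s f v` means `v = D_x^s f`, i.e. `v^(ξ, η) = |ξ|^s f^(ξ, η)` in the sense of tempered
distributions, for `f ∈ L²(ℝ²)` and a function `v`: for every Schwartz function `ψ`,
`⟨v^, ψ⟩ = ⟨v, ψ^⟩ = ∫ v ψ^` equals `⟨|ξ|^s f^, ψ⟩ = ∫ |ξ|^s f^ ψ`, both integrals being
absolutely convergent. -/
def IsDx (s : ℝ) (f : L2) (v : Plane → ℂ) : Prop :=
  ∀ ψ : 𝓢(Plane, ℂ),
    Integrable (fun z : Plane => v z * (𝓕 ψ) z) ∧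
    Integrable (fun k : Plane =>
      ((|freqX k| ^ s : ℝ) : ℂ) * (𝓕 f : L2) k * ψ k) ∧
    ∫ z : Plane, v z * (𝓕 ψ) z =
      ∫ k : Plane, ((|freqX k| ^ s : ℝ) : ℂ) * (𝓕 f : L2) k * ψ k

/-- The mixed norm `‖u‖_{L^q_T L^p_{xy}}` of `u(t, (x, y))` over `[0, T] × ℝ²`, with values in
`[0, ∞]`, and with essential suprema when an exponent is `∞`. -/
def mixedNorm (T : ℝ) (q p : ℝ≥0∞) (u : ℝ → Plane → ℂ) : ℝ≥0∞ :=
  eLpNorm (fun t : ℝ => eLpNorm (u t) p volume) q (volume.restrict (Set.Icc 0 T))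

/-- Admissible pairs `(q, p)`: `2 ≤ q, p ≤ ∞`, `q > 2` and `1/q + 1/p = 1/2`
(with `1/∞ = 0`). -/
structure IsAdmissible (q p : ℝ≥0∞) : Prop where
  two_lt : 2 < q
  two_le : 2 ≤ p
  add_eq : q⁻¹ + p⁻¹ = 2⁻¹

end FracBO

end

/-! The argument is $TT^*$, with the smoothing gain supplied by complex interpolation. For a fixed
sign of ξ, the kernel of $D_x^{(\alpha-1)/2}U_\alpha(t)$ is a product of two one-dimensional
oscillatory integrals. The one in η has a quadratic phase and size $|t|^{-1/2}$. In the one in ξ,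
the substitution $\xi=\nu^{2/(1+\alpha)}$ makes the time part of the phase quadratic, and its
Jacobian absorbs exactly the weight $|\xi|^{(\alpha-1)/2}$. Integration by parts away from the
critical point gives $|t|^{-1/2}$ again, with only a linear loss in γ when the weight is raised to
the power 1 + iγ. So the weighted kernel is $O((1+|\gamma|)/|t|)$ (`exists_norm_kernel_le`).

When the weight is raised to an imaginary power it is unimodular, and Plancherel gives an $L^2$
bound. For 2 < q < ∞, the three lines theorem at θ = 2/q bounds
$D_x^{\theta(\alpha-1)/2}U_\alpha(t)$ from $L^{p'}$ to $L^p$ by $C|t|^{-\theta}$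
(`exists_norm_boxForm_le`). The Hardy–Littlewood–Sobolev inequality in time
(`exists_lintegral_lintegral_mul_abs_rpow_le`) then bounds $TT^*$. Each factor of $TT^*$ carries
half of the weight, which is $|\xi|^{(\alpha-1)/(2q)}$. Testing the dual estimate on its extremiser
(`lintegral_rpow_le_of_dual`) yields the mixed norm. For q = ∞ one has p = 2, and Plancherel alone
suffices.

All this is done with frequencies cut off sharply to `freqBox n`, where the weight is bounded and
the integrals converge absolutely. The oscillatory bounds do not depend on the endpoints of
integration, so the constants do not depend on n (`exists_eLpNorm_boxEvolution_le`). A rapidly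
converging subsequence of truncations has a jointly measurable limit
(`exists_limit_of_eLpNorm_sub_le`). Pairing with Schwartz functions identifies it with the
fractional derivative (`isDx_of_tendsto`). -/

noncomputable section

namespace FracBO

/-! ### A weighted oscillatory integral -/

/-- Weighted AM–GM in two regimes. For ν₀ ≤ ν it is applied to ν₀ and ν. For ν < ν₀ the geometric
mean, which is at least ν, is factored out and the inequality is applied to ν/ν₀ and 1. Up to a
factor 2t the right-hand side is the derivative of the phase below, and ν₀ is its zero. -/
lemma mul_min_le_abs_rpow_mul_rpow_sub {κ ν ν₀ : ℝ} (hκ : 0 < κ) (hκ1 : κ ≤ 1) (hν : 0 < ν)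
    (hν₀ : 0 ≤ ν₀) :
    κ / 2 * min ν |ν - ν₀| ≤ |ν₀ ^ κ * ν ^ (1 - κ) - ν| := by
  rcases le_or_gt ν₀ ν with h | h
  · have h1 := Real.geom_mean_le_arith_mean2_weighted hκ.le (sub_nonneg.2 hκ1) hν₀ hν.le
      (by ring)
    have h2 : κ / 2 * min ν |ν - ν₀| ≤ κ / 2 * (ν - ν₀) := by
      gcongr
      exact (min_le_right _ _).trans (abs_of_nonneg (by linarith)).le
    have h3 : κ * (ν - ν₀) ≤ |ν₀ ^ κ * ν ^ (1 - κ) - ν| := by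
      rw [abs_sub_comm]
      exact le_trans (by linarith) (le_abs_self _)
    nlinarith
  · have hν₀' : 0 < ν₀ := hν.trans h
    set P := ν₀ ^ κ * ν ^ (1 - κ) with hP
    have hs : P * (ν / ν₀) ^ κ = ν := by
      rw [hP, Real.div_rpow hν.le hν₀]
      have : ν₀ ^ κ ≠ 0 := (Real.rpow_pos_of_pos hν₀' _).ne'
      field_simp
      rw [← Real.rpow_add hν]
      simp
    have hs1 : (ν / ν₀) ^ κ ≤ κ * (ν / ν₀) + (1 - κ) := by
      have := Real.geom_mean_le_arith_mean2_weighted hκ.le (sub_nonneg.2 hκ1)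
        (div_nonneg hν.le hν₀) zero_le_one (by ring)
      simpa using this
    have hP0 : 0 < P := mul_pos (Real.rpow_pos_of_pos hν₀' _) (Real.rpow_pos_of_pos hν _)
    have hs2 : ν / ν₀ < 1 := (div_lt_one hν₀').2 h
    have hPν : ν ≤ P := by
      calc ν = P * (ν / ν₀) ^ κ := hs.symm
        _ ≤ P * 1 := by gcongr; nlinarith
        _ = P := mul_one _
    have h1 : P * (κ * (1 - ν / ν₀)) ≤ P - ν := by
      have := mul_le_mul_of_nonneg_left hs1 hP0.le
      rw [hs] at this
      linarith
    have h2 : ν * (κ * (1 - ν / ν₀)) ≤ P - ν :=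
      le_trans (mul_le_mul_of_nonneg_right hPν (by nlinarith)) h1
    -- One of ν/ν₀ and 1 - ν/ν₀ is at least 1/2, according to whether ν₀ ≤ 2ν; this is where the
    -- factor 1/2 is lost.
    have h3 : min ν |ν - ν₀| / 2 ≤ ν * (1 - ν / ν₀) := by
      have e : ν * (1 - ν / ν₀) = ν * (ν₀ - ν) / ν₀ := by field_simp
      rw [e, le_div_iff₀ hν₀']
      rcases le_total ν₀ (2 * ν) with h4 | h4
      · have : min ν |ν - ν₀| ≤ ν₀ - ν :=
          (min_le_right _ _).trans (by rw [abs_sub_comm, abs_of_nonneg (by linarith)])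
        nlinarith
      · have : min ν |ν - ν₀| ≤ ν := min_le_left _ _
        nlinarith
    calc κ / 2 * min ν |ν - ν₀| = κ * (min ν |ν - ν₀| / 2) := by ring
      _ ≤ κ * (ν * (1 - ν / ν₀)) := by gcongr
      _ = ν * (κ * (1 - ν / ν₀)) := by ring
      _ ≤ P - ν := h2
      _ ≤ |P - ν| := le_abs_self _

/-- For x ≥ 0 the derivative is $2t(\nu_0^{2-\beta}\nu^{\beta-1}-\nu)$, with ν₀ its zero. For x ≤ 0
its two terms have the same sign and the centre 0 works. -/
lemma exists_center_le_abs_phase_deriv {β x t : ℝ} (hβ1 : 1 ≤ β) (hβ2 : β < 2) (ht : 0 < t) :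
    ∃ ν₀ : ℝ, ∀ ν : ℝ, 0 < ν →
      (2 - β) * t * min ν |ν - ν₀| ≤ |x * (β * ν ^ (β - 1)) - t * (2 * ν)| := by
  have hκ : 0 < 2 - β := by linarith
  rcases le_total 0 x with hx | hx
  · refine ⟨(β * x / (2 * t)) ^ (1 / (2 - β)), fun ν hν => ?_⟩
    have hb : 0 ≤ β * x / (2 * t) := by positivity
    have h := mul_min_le_abs_rpow_mul_rpow_sub (ν₀ := (β * x / (2 * t)) ^ (1 / (2 - β)))
      hκ (by linarith) hν (by positivity)
    rw [← Real.rpow_mul hb, one_div_mul_cancel hκ.ne', Real.rpow_one] at h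
    have e : x * (β * ν ^ (β - 1)) - t * (2 * ν)
        = 2 * t * (β * x / (2 * t) * ν ^ (1 - (2 - β)) - ν) := by
      rw [show 1 - (2 - β) = β - 1 by ring]
      field_simp
    rw [e, abs_mul, abs_of_pos (by positivity : 0 < 2 * t)]
    nlinarith
  · refine ⟨0, fun ν hν => ?_⟩
    have h1 : x * (β * ν ^ (β - 1)) ≤ 0 :=
      mul_nonpos_of_nonpos_of_nonneg hx (mul_nonneg (by linarith) (Real.rpow_nonneg hν.le _))
    refine le_trans ?_ (neg_le_abs _)
    have h2 : min ν |ν - 0| ≤ ν := min_le_left _ _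
    have h3 : (2 - β) * t * min ν |ν - 0| ≤ (2 - β) * t * ν := by gcongr
    nlinarith [mul_pos ht hν]

lemma norm_cexp_I_mul_ofReal (y : ℝ) : ‖Complex.exp (Complex.I * (y : ℂ))‖ = 1 := by
  rw [mul_comm, Complex.norm_exp_ofReal_mul_I]

/-- Integration by parts away from the critical points of the phase. -/
lemma norm_integral_oscillatory_le_of_separated {β x t γ c d δ ν₀ : ℝ} (hβ1 : 1 ≤ β)
    (hβ2 : β < 2) (ht : 0 < t) (hδ : 0 < δ) (hc : δ ≤ c) (hcd : c ≤ d)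
    (hsep : d ≤ ν₀ - δ ∨ ν₀ + δ ≤ c)
    (hlow : ∀ ν : ℝ, 0 < ν →
      (2 - β) * t * min ν |ν - ν₀| ≤ |x * (β * ν ^ (β - 1)) - t * (2 * ν)|) :
    ‖∫ ν in c..d, Complex.exp (Complex.I * ((x * ν ^ β - t * ν ^ 2 + γ * Real.log ν : ℝ) : ℂ))‖
      ≤ 8 * (1 + |γ|) / ((2 - β) * t * δ) := by
  have hκ : 0 < 2 - β := by linarith
  -- The logarithm is left out of `p`: the factor $\nu^{i\gamma}$ counts as amplitude. The lower
  -- bound on |p| is then free of γ, and γ enters only linearly, through the remainder.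
  set p : ℝ → ℝ := fun ν => x * (β * ν ^ (β - 1)) - t * (2 * ν) with hp
  set p' : ℝ → ℝ := fun ν => x * (β * ((β - 1) * ν ^ (β - 1 - 1))) - t * 2 with hp'
  set Θ : ℝ → ℝ := fun ν => x * ν ^ β - t * ν ^ 2 + γ * Real.log ν with hΘ
  have hpos : ∀ ν ∈ Set.uIcc c d, 0 < ν ∧ δ ≤ ν ∧ δ ≤ |ν - ν₀| := by
    intro ν hν
    rw [Set.uIcc_of_le hcd] at hν
    refine ⟨by linarith [hν.1], by linarith [hν.1], ?_⟩
    rcases hsep with h | h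
    · rw [abs_sub_comm]
      exact le_trans (by linarith [hν.2]) (le_abs_self _)
    · exact le_trans (by linarith [hν.1]) (le_abs_self _)
  have hlow' : ∀ ν ∈ Set.uIcc c d, (2 - β) * t * δ ≤ |p ν| := fun ν hν =>
    le_trans (by gcongr; exact le_min (hpos ν hν).2.1 (hpos ν hν).2.2) (hlow ν (hpos ν hν).1)
  have hpne : ∀ ν ∈ Set.uIcc c d, p ν ≠ 0 := fun ν hν =>
    abs_pos.1 (lt_of_lt_of_le (by positivity) (hlow' ν hν))
  have hdp : ∀ ν ∈ Set.uIcc c d, HasDerivAt p (p' ν) ν := by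
    intro ν hν
    have h0 := (hpos ν hν).1
    have h1 := ((Real.hasDerivAt_rpow_const (p := β - 1) (Or.inl h0.ne')).const_mul β).const_mul x
    have h2 := ((hasDerivAt_id ν).const_mul 2).const_mul t
    refine HasDerivAt.congr_deriv (h1.sub h2) ?_
    simp [hp']
  have hdΘ : ∀ ν ∈ Set.uIcc c d, HasDerivAt Θ (p ν + γ * ν⁻¹) ν := by
    intro ν hν
    have h0 := (hpos ν hν).1
    have h1 := (Real.hasDerivAt_rpow_const (p := β) (Or.inl h0.ne')).const_mul x
    have h2 := (hasDerivAt_pow 2 ν).const_mul t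
    refine HasDerivAt.congr_deriv ((h1.sub h2).add ((Real.hasDerivAt_log h0.ne').const_mul γ)) ?_
    simp [hp]
  set E : ℝ → ℂ := fun ν => Complex.exp (Complex.I * (Θ ν : ℂ)) with hE
  -- F' = E + R, where R gathers the derivatives of $\nu^{i\gamma}$ and of 1/p.
  set F : ℝ → ℂ := fun ν => E ν / (Complex.I * (p ν : ℂ)) with hF
  set R : ℝ → ℂ := fun ν => E ν * (((γ * ν⁻¹ / p ν : ℝ) : ℂ)
    + Complex.I * ((p' ν / p ν ^ 2 : ℝ) : ℂ)) with hR
  have hdE : ∀ ν ∈ Set.uIcc c d,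
      HasDerivAt E (E ν * (Complex.I * ((p ν + γ * ν⁻¹ : ℝ) : ℂ))) ν := fun ν hν =>
    ((hdΘ ν hν).ofReal_comp.const_mul Complex.I).cexp
  have hdF : ∀ ν ∈ Set.uIcc c d, HasDerivAt F (E ν + R ν) ν := by
    intro ν hν
    have hne : (p ν : ℂ) ≠ 0 := by exact_mod_cast hpne ν hν
    have hne' : Complex.I * (p ν : ℂ) ≠ 0 := mul_ne_zero Complex.I_ne_zero hne
    have := (hdE ν hν).div ((hdp ν hν).ofReal_comp.const_mul Complex.I) hne'
    refine HasDerivAt.congr_deriv this ?_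
    simp only [hR]
    push_cast
    have hI : Complex.I ^ 2 = -1 := Complex.I_sq
    rw [div_eq_iff (pow_ne_zero 2 hne')]
    have hν0 : (ν : ℂ) ≠ 0 := by exact_mod_cast (hpos ν hν).1.ne'
    field_simp
    ring_nf
    simp [hI]
    ring
  have hcE : ContinuousOn E (Set.uIcc c d) := fun ν hν => (hdE ν hν).continuousAt.continuousWithinAt
  have hcp : ContinuousOn p (Set.uIcc c d) := fun ν hν => (hdp ν hν).continuousAt.continuousWithinAt
  have hcp' : ContinuousOn p' (Set.uIcc c d) := by
    apply ContinuousOn.sub _ continuousOn_const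
    refine continuousOn_const.mul (continuousOn_const.mul (continuousOn_const.mul ?_))
    exact continuousOn_id.rpow_const fun ν hν => Or.inl (hpos ν hν).1.ne'
  have hcinv : ContinuousOn (fun ν : ℝ => ν⁻¹) (Set.uIcc c d) :=
    continuousOn_inv₀.mono fun ν hν => (hpos ν hν).1.ne'
  have hcR : ContinuousOn R (Set.uIcc c d) := by
    refine hcE.mul (ContinuousOn.add ?_ (continuousOn_const.mul ?_))
    · exact Complex.continuous_ofReal.comp_continuousOn
        ((continuousOn_const.mul hcinv).div hcp hpne)
    · exact Complex.continuous_ofReal.comp_continuousOn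
        (hcp'.div (hcp.pow 2) fun ν hν => pow_ne_zero 2 (hpne ν hν))
  have hint : (∫ ν in c..d, E ν) = F d - F c - ∫ ν in c..d, R ν := by
    rw [← intervalIntegral.integral_eq_sub_of_hasDerivAt hdF
      (hcE.add hcR).intervalIntegrable, intervalIntegral.integral_add hcE.intervalIntegrable
      hcR.intervalIntegrable]
    ring
  have hnE : ∀ ν, ‖E ν‖ = 1 := fun ν => norm_cexp_I_mul_ofReal _
  have hnF : ∀ ν ∈ Set.uIcc c d, ‖F ν‖ ≤ 1 / ((2 - β) * t * δ) := by
    intro ν hν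
    rw [hF, norm_div, hnE, norm_mul, Complex.norm_I, one_mul, Complex.norm_real, Real.norm_eq_abs]
    exact one_div_le_one_div_of_le (by positivity) (hlow' ν hν)
  -- The bracket dominates the inverse square of min(ν, |ν - ν₀|) and has an elementary primitive.
  -- The 3 is 1 + 2, from the two terms of p'.
  set g : ℝ → ℝ := fun ν => (|γ| + 3) / ((2 - β) * t) * (1 / ν ^ 2 + 1 / (ν - ν₀) ^ 2) with hg
  have hsub : ∀ ν ∈ Set.uIcc c d, ν - ν₀ ≠ 0 := fun ν hν =>
    abs_pos.1 (hδ.trans_le (hpos ν hν).2.2)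
  have hnR : ∀ ν ∈ Set.uIcc c d, ‖R ν‖ ≤ g ν := by
    intro ν hν
    obtain ⟨h0, h1, h2⟩ := hpos ν hν
    set m := min ν |ν - ν₀| with hm
    have hm0 : 0 < m := lt_min h0 (by linarith)
    have hmν : m ≤ ν := min_le_left _ _
    have hpm : (2 - β) * t * m ≤ |p ν| := hlow ν h0
    have hpp : 0 < |p ν| := abs_pos.2 (hpne ν hν)
    have hk : 0 < (2 - β) * t * m ^ 2 := by positivity
    have hA : 1 / (ν * |p ν|) ≤ 1 / ((2 - β) * t * m ^ 2) := by
      apply one_div_le_one_div_of_le hk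
      calc (2 - β) * t * m ^ 2 = m * ((2 - β) * t * m) := by ring
        _ ≤ ν * |p ν| := by gcongr
    have hB : 1 / |p ν| ^ 2 ≤ 1 / ((2 - β) * t * m) ^ 2 := by gcongr
    -- Eliminating $x\nu^{\beta-1}$ between p and p' controls p' by p itself, so no bound on x is
    -- needed.
    have hp'eq : p' ν = (β - 1) * p ν / ν - 2 * t * (2 - β) := by
      have : ν ^ (β - 1) = ν ^ (β - 1 - 1) * ν := by
        rw [← Real.rpow_add_one h0.ne']; congr 1; ring
      simp only [hp', hp, this]
      field_simp
      ring
    have hp'le : |p' ν| / |p ν| ^ 2 ≤ 3 / ((2 - β) * t * m ^ 2) := by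
      have h3 : |p' ν| ≤ |p ν| / ν + 2 * t * (2 - β) := by
        rw [hp'eq]
        refine (abs_sub _ _).trans ?_
        rw [abs_of_pos (by positivity : 0 < 2 * t * (2 - β)), abs_div, abs_mul, abs_of_pos h0,
          abs_of_nonneg (by linarith : 0 ≤ β - 1)]
        have : (β - 1) * |p ν| ≤ |p ν| := by nlinarith
        gcongr
      calc |p' ν| / |p ν| ^ 2 ≤ (|p ν| / ν + 2 * t * (2 - β)) / |p ν| ^ 2 := by gcongr
        _ = 1 / (ν * |p ν|) + 2 * t * (2 - β) * (1 / |p ν| ^ 2) := by field_simp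
        _ ≤ 1 / ((2 - β) * t * m ^ 2) + 2 * t * (2 - β) * (1 / ((2 - β) * t * m) ^ 2) := by
          gcongr
        _ = 3 / ((2 - β) * t * m ^ 2) := by field_simp; ring
    have hm2 : 1 / m ^ 2 ≤ 1 / ν ^ 2 + 1 / (ν - ν₀) ^ 2 := by
      rcases min_choice ν |ν - ν₀| with h | h
      · rw [hm, h]; have : 0 ≤ 1 / (ν - ν₀) ^ 2 := by positivity
        linarith
      · rw [hm, h, sq_abs]; have : 0 ≤ 1 / ν ^ 2 := by positivity
        linarith
    calc ‖R ν‖ = ‖((γ * ν⁻¹ / p ν : ℝ) : ℂ) + Complex.I * ((p' ν / p ν ^ 2 : ℝ) : ℂ)‖ := by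
          rw [hR, norm_mul, hnE, one_mul]
      _ ≤ |γ * ν⁻¹ / p ν| + |p' ν / p ν ^ 2| := by
          refine (norm_add_le _ _).trans ?_
          rw [norm_mul, Complex.norm_I, one_mul, Complex.norm_real, Complex.norm_real,
            Real.norm_eq_abs, Real.norm_eq_abs]
      _ = |γ| * (1 / (ν * |p ν|)) + |p' ν| / |p ν| ^ 2 := by
          rw [abs_div, abs_div, abs_mul, abs_inv, abs_of_pos h0, abs_pow]
          field_simp
      _ ≤ |γ| * (1 / ((2 - β) * t * m ^ 2)) + 3 / ((2 - β) * t * m ^ 2) := by gcongr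
      _ = (|γ| + 3) / ((2 - β) * t) * (1 / m ^ 2) := by field_simp
      _ ≤ g ν := mul_le_mul_of_nonneg_left hm2 (by positivity)
  have hcg : ContinuousOn (fun ν : ℝ => 1 / ν ^ 2 + 1 / (ν - ν₀) ^ 2) (Set.uIcc c d) := by
    refine ContinuousOn.add ?_ ?_
    · exact continuousOn_const.div (continuousOn_id.pow 2)
        fun ν hν => pow_ne_zero 2 (hpos ν hν).1.ne'
    · exact continuousOn_const.div ((continuousOn_id.sub continuousOn_const).pow 2)
        fun ν hν => pow_ne_zero 2 (hsub ν hν)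
  have hgint : (∫ ν in c..d, (1 / ν ^ 2 + 1 / (ν - ν₀) ^ 2)) ≤ 2 / δ := by
    have hd : ∀ ν ∈ Set.uIcc c d, HasDerivAt (fun ν : ℝ => -ν⁻¹ - (ν - ν₀)⁻¹)
        (1 / ν ^ 2 + 1 / (ν - ν₀) ^ 2) ν := by
      intro ν hν
      have h1 := (hasDerivAt_inv (hpos ν hν).1.ne').neg
      have h2 := ((hasDerivAt_id ν).sub_const ν₀).inv (hsub ν hν)
      refine HasDerivAt.congr_deriv (h1.sub h2) ?_
      simp only [id]
      ring
    rw [intervalIntegral.integral_eq_sub_of_hasDerivAt hd hcg.intervalIntegrable]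
    have hc1 : c⁻¹ ≤ δ⁻¹ := inv_anti₀ hδ hc
    have hd1 : 0 < d⁻¹ := inv_pos.2 (by linarith)
    have h3 : (c - ν₀)⁻¹ - (d - ν₀)⁻¹ ≤ δ⁻¹ := by
      rcases hsep with h | h
      · have h4 : (ν₀ - d)⁻¹ ≤ δ⁻¹ := inv_anti₀ hδ (by linarith)
        have h5 : 0 < (ν₀ - c)⁻¹ := inv_pos.2 (by linarith)
        rw [← neg_sub ν₀ c, ← neg_sub ν₀ d, inv_neg, inv_neg]
        linarith
      · have h4 : (c - ν₀)⁻¹ ≤ δ⁻¹ := inv_anti₀ hδ (by linarith)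
        have h5 : 0 < (d - ν₀)⁻¹ := inv_pos.2 (by linarith)
        linarith
    rw [div_eq_mul_inv]
    linarith
  have hRint : ‖∫ ν in c..d, R ν‖ ≤ (|γ| + 3) / ((2 - β) * t) * (2 / δ) := by
    calc ‖∫ ν in c..d, R ν‖ ≤ ∫ ν in c..d, g ν := by
          refine intervalIntegral.norm_integral_le_of_norm_le hcd ?_
            (continuousOn_const.mul hcg).intervalIntegrable
          refine Filter.Eventually.of_forall fun ν hν => hnR ν ?_
          rw [Set.uIcc_of_le hcd]
          exact Set.Ioc_subset_Icc_self hν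
      _ = (|γ| + 3) / ((2 - β) * t) * ∫ ν in c..d, (1 / ν ^ 2 + 1 / (ν - ν₀) ^ 2) := by
          rw [← intervalIntegral.integral_const_mul]
      _ ≤ _ := by gcongr
  calc ‖∫ ν in c..d, E ν‖ ≤ ‖F d‖ + ‖F c‖ + ‖∫ ν in c..d, R ν‖ := by
        rw [hint]
        exact (norm_sub_le _ _).trans (by gcongr; exact norm_sub_le _ _)
    _ ≤ 1 / ((2 - β) * t * δ) + 1 / ((2 - β) * t * δ) + (|γ| + 3) / ((2 - β) * t) * (2 / δ) := by
        gcongr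
        · exact hnF d Set.right_mem_uIcc
        · exact hnF c Set.left_mem_uIcc
    _ = (8 + 2 * |γ|) / ((2 - β) * t * δ) := by field_simp; ring
    _ ≤ 8 * (1 + |γ|) / ((2 - β) * t * δ) := by
        gcongr
        linarith [abs_nonneg γ]

/-- Points within δ of 0 or of ν₀ fill a set of length at most 3δ and are estimated trivially. Each
of the two remaining pieces is O(1/(tδ)) by integration by parts. The choice $\delta=t^{-1/2}$
balances the two contributions. -/
lemma norm_integral_oscillatory_le_of_pos {β x t γ a b : ℝ} (hβ1 : 1 ≤ β) (hβ2 : β < 2)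
    (ht : 0 < t) (ha : 0 < a) (hab : a ≤ b) :
    ‖∫ ν in a..b, Complex.exp (Complex.I * ((x * ν ^ β - t * ν ^ 2 + γ * Real.log ν : ℝ) : ℂ))‖
      ≤ (3 + 16 / (2 - β)) * (1 + |γ|) / √t := by
  obtain ⟨ν₀, hlow⟩ := exists_center_le_abs_phase_deriv (x := x) hβ1 hβ2 ht
  have hκ : 0 < 2 - β := by linarith
  have hst : 0 < √t := Real.sqrt_pos.2 ht
  set δ : ℝ := (√t)⁻¹ with hδdef
  have hδ : 0 < δ := inv_pos.2 hst
  set f : ℝ → ℂ := fun ν =>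
    Complex.exp (Complex.I * ((x * ν ^ β - t * ν ^ 2 + γ * Real.log ν : ℝ) : ℂ)) with hf
  have hn : ∀ ν, ‖f ν‖ = 1 := fun ν => norm_cexp_I_mul_ofReal _
  have hcont : ContinuousOn f (Set.Ioi 0) := by
    have h1 : ContinuousOn (fun ν : ℝ => x * ν ^ β - t * ν ^ 2 + γ * Real.log ν) (Set.Ioi 0) := by
      refine ContinuousOn.add (ContinuousOn.sub ?_ (by fun_prop)) ?_
      · exact continuousOn_const.mul
          (continuousOn_id.rpow_const fun ν hν => Or.inl (ne_of_gt hν))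
      · exact continuousOn_const.mul (Real.continuousOn_log.mono fun ν hν => ne_of_gt hν)
    exact Complex.continuous_exp.comp_continuousOn
      (continuousOn_const.mul (Complex.continuous_ofReal.comp_continuousOn h1))
  have hii : ∀ c d, a ≤ c → a ≤ d → IntervalIntegrable f volume c d := fun c d hc hd =>
    (hcont.mono fun ν hν => lt_of_lt_of_le ha ((le_min hc hd).trans hν.1)).intervalIntegrable
  -- Clamping the cut points to [a, b] gives one decomposition into four pieces, some possibly
  -- empty, for every position of a and b.
  set cl : ℝ → ℝ := fun y => max a (min b y) with hcl
  have hcla : ∀ y, a ≤ cl y := fun y => le_max_left _ _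
  have hclb : ∀ y, cl y ≤ b := fun y => max_le hab (min_le_left _ _)
  have hclm : ∀ {y z}, y ≤ z → cl y ≤ cl z := fun h => max_le_max le_rfl (min_le_min le_rfl h)
  have hclsub : ∀ {y z : ℝ}, y ≤ z → cl z - cl y ≤ z - y := by
    intro y z h
    simp only [hcl]
    rcases le_total b y with h1 | h1 <;> rcases le_total b z with h2 | h2 <;>
      rcases le_total a y with h3 | h3 <;> rcases le_total a z with h4 | h4 <;>
      simp [h1, h2, h3, h4, hab] <;> linarith
  set q2 := max δ (ν₀ - δ) with hq2
  set q3 := max δ (ν₀ + δ) with hq3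
  have hq12 : δ ≤ q2 := le_max_left _ _
  have hq23 : q2 ≤ q3 := max_le_max le_rfl (by linarith)
  have hq23' : q3 - q2 ≤ 2 * δ := by
    have h1 : q3 ≤ q2 + 2 * δ :=
      max_le (by linarith) (by linarith [le_max_right δ (ν₀ - δ)])
    linarith
  have triv : ∀ c d, c ≤ d → ‖∫ ν in c..d, f ν‖ ≤ d - c := by
    intro c d hcd
    have := intervalIntegral.norm_integral_le_of_norm_le_const (a := c) (b := d) (f := f)
      (C := 1) fun ν _ => (hn ν).le
    rwa [one_mul, abs_of_nonneg (by linarith)] at this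
  have e1 : ‖∫ ν in a..cl δ, f ν‖ ≤ δ := by
    refine (triv _ _ (hcla _)).trans ?_
    rcases le_total a (min b δ) with h | h
    · have : cl δ ≤ δ := by simp only [hcl]; rw [max_eq_right h]; exact min_le_right _ _
      linarith
    · have : cl δ = a := max_eq_left h
      linarith
  have e2 : ‖∫ ν in cl q2..cl q3, f ν‖ ≤ 2 * δ :=
    (triv _ _ (hclm hq23)).trans ((hclsub hq23).trans hq23')
  have hB : 0 ≤ 8 * (1 + |γ|) / ((2 - β) * t * δ) := by positivity
  have good : ∀ c d, a ≤ c → c ≤ d → (c < d → δ ≤ c ∧ (d ≤ ν₀ - δ ∨ ν₀ + δ ≤ c)) →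
      ‖∫ ν in c..d, f ν‖ ≤ 8 * (1 + |γ|) / ((2 - β) * t * δ) := by
    intro c d hac hcd h
    rcases hcd.eq_or_lt with rfl | hlt
    · simpa using hB
    · exact norm_integral_oscillatory_le_of_separated hβ1 hβ2 ht hδ (h hlt).1 hcd (h hlt).2 hlow
  have hclge : ∀ {y}, cl y < b → y ≤ cl y := by
    intro y h
    have h1 : min b y < b := lt_of_le_of_lt (le_max_right _ _) h
    have h2 : min b y = y := by
      rcases min_choice b y with h3 | h3
      · rw [h3] at h1; exact absurd h1 (lt_irrefl _)
      · exact h3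
    calc y = min b y := h2.symm
      _ ≤ cl y := le_max_right _ _
  have hclle : ∀ {y}, a < cl y → cl y ≤ y := by
    intro y h
    rcases max_choice a (min b y) with h3 | h3
    · simp only [hcl] at h; rw [h3] at h; exact absurd h (lt_irrefl _)
    · simp only [hcl]; rw [h3]; exact min_le_right _ _
  have e3 : ‖∫ ν in cl δ..cl q2, f ν‖ ≤ 8 * (1 + |γ|) / ((2 - β) * t * δ) := by
    refine good _ _ (hcla _) (hclm hq12) fun hlt => ?_
    have h1 : δ ≤ cl δ := hclge (hlt.trans_le (hclb _))
    have h2 : cl q2 ≤ q2 := hclle ((hcla _).trans_lt hlt)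
    refine ⟨h1, Or.inl ?_⟩
    rcases max_choice δ (ν₀ - δ) with h3 | h3
    · exact absurd (h1.trans_lt (hlt.trans_le h2)) (by rw [hq2, h3]; exact lt_irrefl _)
    · exact h2.trans h3.le
  have e4 : ‖∫ ν in cl q3..b, f ν‖ ≤ 8 * (1 + |γ|) / ((2 - β) * t * δ) := by
    refine good _ _ (hcla _) (hclb _) fun hlt => ?_
    have h1 := hclge hlt
    exact ⟨(le_max_left _ _).trans h1, Or.inr ((le_max_right _ _).trans h1)⟩
  have hsum : (∫ ν in a..b, f ν) = (∫ ν in a..cl δ, f ν) + (∫ ν in cl δ..cl q2, f ν)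
      + (∫ ν in cl q2..cl q3, f ν) + ∫ ν in cl q3..b, f ν := by
    rw [intervalIntegral.integral_add_adjacent_intervals (hii _ _ le_rfl (hcla _))
        (hii _ _ (hcla _) (hcla _)),
      intervalIntegral.integral_add_adjacent_intervals (hii _ _ le_rfl (hcla _))
        (hii _ _ (hcla _) (hcla _)),
      intervalIntegral.integral_add_adjacent_intervals (hii _ _ le_rfl (hcla _))
        (hii _ _ (hcla _) hab)]
  have htδ : t * δ = √t := by
    rw [hδdef]; field_simp; exact (Real.sq_sqrt ht.le).symm
  calc ‖∫ ν in a..b, f ν‖ ≤ δ + 8 * (1 + |γ|) / ((2 - β) * t * δ) + 2 * δ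
        + 8 * (1 + |γ|) / ((2 - β) * t * δ) := by
        rw [hsum]
        refine (norm_add_le _ _).trans (add_le_add ((norm_add_le _ _).trans
          (add_le_add ((norm_add_le _ _).trans (add_le_add e1 e3)) e2)) e4)
    _ = (3 + 16 / (2 - β) * (1 + |γ|)) / √t := by
        rw [mul_assoc (2 - β) t δ, htδ, hδdef]; field_simp; ring
    _ ≤ (3 + 16 / (2 - β)) * (1 + |γ|) / √t := by
        gcongr
        nlinarith [abs_nonneg γ]

/-- Complex conjugation reverses the signs of x, t and γ, which reduces t < 0 to t > 0. -/
lemma norm_integral_oscillatory_le {β x t γ a b : ℝ} (hβ1 : 1 ≤ β) (hβ2 : β < 2)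
    (ht : t ≠ 0) (ha : 0 < a) (hab : a ≤ b) :
    ‖∫ ν in a..b, Complex.exp (Complex.I * ((x * ν ^ β - t * ν ^ 2 + γ * Real.log ν : ℝ) : ℂ))‖
      ≤ (3 + 16 / (2 - β)) * (1 + |γ|) / √|t| := by
  rcases ht.lt_or_gt with h | h
  · have h1 := norm_integral_oscillatory_le_of_pos (x := -x) (γ := -γ) hβ1 hβ2 (neg_pos.2 h) ha hab
    rw [abs_neg] at h1
    rw [abs_of_neg h]
    convert h1 using 1
    rw [intervalIntegral.integral_of_le hab, intervalIntegral.integral_of_le hab,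
      ← Complex.norm_conj, ← integral_conj]
    congr 2
    funext ν
    rw [← Complex.exp_conj, map_mul, Complex.conj_I, Complex.conj_ofReal, neg_mul, ← mul_neg,
      ← Complex.ofReal_neg]
    congr 3
    ring
  · rw [abs_of_pos h]
    exact norm_integral_oscillatory_le_of_pos hβ1 hβ2 h ha hab

/-- The weighted van der Corput estimate behind the dispersive bound. -/
lemma exists_norm_integral_weighted_oscillatory_le {α : ℝ} (hα0 : 0 < α) (hα1 : α ≤ 1) :
    ∃ C : ℝ, 0 ≤ C ∧ ∀ x t γ a b : ℝ, t ≠ 0 → 0 < a → a ≤ b →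
      ‖∫ k in a..b, Complex.exp ((1 + γ * Complex.I) * (((α - 1) / 2 * Real.log k : ℝ) : ℂ)) *
        Complex.exp (Complex.I * ((x * k - t * k ^ (1 + α) : ℝ) : ℂ))‖
      ≤ C * (1 + |γ|) / √|t| := by
  -- Since β(1 + α) = 2, the substitution $k=\nu^\beta$ turns $tk^{1+\alpha}$ into $t\nu^2$. Since
  -- β(α - 1)/2 = -(β - 1), the Jacobian $\beta\nu^{\beta-1}$ cancels the modulus of the weight up
  -- to the constant β. The imaginary power survives as the phase -γ(β - 1) log ν, whose coefficient
  -- is at most |γ| in modulus.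
  set β : ℝ := 2 / (1 + α) with hβ
  have hα' : 0 < 1 + α := by linarith
  have hβ1 : 1 ≤ β := by rw [hβ, le_div_iff₀ hα']; linarith
  have hβ2 : β < 2 := by rw [hβ, div_lt_iff₀ hα']; linarith
  have hβ0 : 0 < β := by linarith
  have hκ : 0 < 2 - β := by linarith
  have hβα : β * (1 + α) = 2 := by rw [hβ]; field_simp
  refine ⟨β * (3 + 16 / (2 - β)), by positivity, fun x t γ a b ht ha hab => ?_⟩
  set g : ℝ → ℂ := fun k =>
    Complex.exp ((1 + γ * Complex.I) * (((α - 1) / 2 * Real.log k : ℝ) : ℂ)) *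
        Complex.exp (Complex.I * ((x * k - t * k ^ (1 + α) : ℝ) : ℂ)) with hg
  set a' : ℝ := a ^ β⁻¹ with ha'
  set b' : ℝ := b ^ β⁻¹ with hb'
  have ha'0 : 0 < a' := Real.rpow_pos_of_pos ha _
  have hab' : a' ≤ b' := Real.rpow_le_rpow ha.le hab (inv_nonneg.2 hβ0.le)
  have hpos : ∀ ν ∈ Set.uIcc a' b', 0 < ν := fun ν hν => by
    rw [Set.uIcc_of_le hab'] at hν
    exact ha'0.trans_le hν.1
  have hcg : ContinuousOn g (Set.Ioi 0) := by
    refine ContinuousOn.mul ?_ ?_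
    · refine Complex.continuous_exp.comp_continuousOn (continuousOn_const.mul
        (Complex.continuous_ofReal.comp_continuousOn (continuousOn_const.mul
          (Real.continuousOn_log.mono fun ν hν => ne_of_gt hν))))
    · refine Complex.continuous_exp.comp_continuousOn (continuousOn_const.mul
        (Complex.continuous_ofReal.comp_continuousOn (ContinuousOn.sub (by fun_prop)
          (continuousOn_const.mul
            (continuousOn_id.rpow_const fun ν hν => Or.inl (ne_of_gt hν))))))
  have hsub := intervalIntegral.integral_deriv_smul_comp' (a := a') (b := b')
    (f := fun ν => ν ^ β) (f' := fun ν => β * ν ^ (β - 1)) (g := g)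
    (fun ν hν => Real.hasDerivAt_rpow_const (Or.inl (hpos ν hν).ne'))
    (continuousOn_const.mul (continuousOn_id.rpow_const fun ν hν => Or.inl (hpos ν hν).ne'))
    (hcg.mono (by rintro _ ⟨ν, hν, rfl⟩; exact Real.rpow_pos_of_pos (hpos ν hν) _))
  have hfa : a' ^ β = a := Real.rpow_inv_rpow ha.le hβ0.ne'
  have hfb : b' ^ β = b := Real.rpow_inv_rpow (ha.le.trans hab) hβ0.ne'
  simp only [hfa, hfb] at hsub
  rw [← hsub]
  have hpt : ∀ ν ∈ Set.uIcc a' b', (β * ν ^ (β - 1)) • (g ∘ fun ν => ν ^ β) ν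
      = (β : ℂ) * Complex.exp (Complex.I *
        ((x * ν ^ β - t * ν ^ 2 + (-γ * (β - 1)) * Real.log ν : ℝ) : ℂ)) := by
    intro ν hν
    have h0 := hpos ν hν
    have h1 : (ν ^ β) ^ (1 + α) = ν ^ 2 := by
      rw [← Real.rpow_mul h0.le, hβα]; exact Real.rpow_two ν
    have h2 : (α - 1) / 2 * Real.log (ν ^ β) = -((β - 1) * Real.log ν) := by
      rw [Real.log_rpow h0]
      have : (α - 1) / 2 * β = -(β - 1) := by linarith
      rw [← mul_assoc, this]; ring
    have h3 : ν ^ (β - 1) = Real.exp ((β - 1) * Real.log ν) := by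
      rw [Real.rpow_def_of_pos h0, mul_comm]
    simp only [Function.comp, hg, h1, h2, h3, Complex.real_smul]
    rw [Complex.ofReal_mul, mul_assoc, Complex.ofReal_exp, ← Complex.exp_add, ← Complex.exp_add]
    congr 2
    push_cast
    ring
  rw [intervalIntegral.integral_congr hpt, intervalIntegral.integral_const_mul, norm_mul,
    Complex.norm_real, Real.norm_eq_abs, abs_of_pos hβ0]
  have hmain := norm_integral_oscillatory_le (x := x) (γ := -γ * (β - 1)) hβ1 hβ2 ht ha'0 hab'
  refine (mul_le_mul_of_nonneg_left hmain hβ0.le).trans ?_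
  have hγ : |-γ * (β - 1)| ≤ |γ| := by
    rw [abs_mul, abs_neg, abs_of_nonneg (by linarith : 0 ≤ β - 1)]
    nlinarith [abs_nonneg γ]
  rw [← mul_div_assoc, ← mul_assoc]
  gcongr

/-! ### The truncated dispersive kernel -/

/-- The symmetric frequency band `(n+1)⁻¹ ≤ |x| ≤ n + 1`. -/
def freqBand (n : ℕ) : Set ℝ := {x | |x| ∈ Set.Icc ((n + 1 : ℝ)⁻¹) (n + 1)}

/-- The product of two frequency bands. -/
def freqBox (n : ℕ) : Set Plane := {k | k 0 ∈ freqBand n ∧ k 1 ∈ freqBand n}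

lemma freqBand_lower_pos (n : ℕ) : (0 : ℝ) < (n + 1 : ℝ)⁻¹ := by positivity

lemma freqBand_lower_le_upper (n : ℕ) : (n + 1 : ℝ)⁻¹ ≤ n + 1 := by
  have h : (1 : ℝ) ≤ n + 1 := by linarith [n.cast_nonneg (α := ℝ)]
  exact (inv_le_one_of_one_le₀ h).trans h

lemma freqBand_eq (n : ℕ) : freqBand n =
    Set.Icc ((n + 1 : ℝ)⁻¹) (n + 1) ∪ Set.Icc (-(n + 1 : ℝ)) (-(n + 1 : ℝ)⁻¹) := by
  ext x
  have h0 := freqBand_lower_pos n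
  simp only [freqBand, Set.mem_ofPred_eq, Set.mem_Icc, Set.mem_union]
  rcases le_total 0 x with h | h
  · rw [abs_of_nonneg h]
    constructor
    · exact Or.inl
    · rintro (h1 | h1)
      · exact h1
      · linarith [h1.2]
  · rw [abs_of_nonpos h]
    constructor
    · intro h1; right; constructor <;> linarith [h1.1, h1.2]
    · rintro (h1 | h1)
      · linarith [h1.1]
      · constructor <;> linarith [h1.1, h1.2]

lemma measurableSet_freqBand (n : ℕ) : MeasurableSet (freqBand n) := by
  rw [freqBand_eq]; exact measurableSet_Icc.union measurableSet_Icc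

lemma measurableSet_freqBox (n : ℕ) : MeasurableSet (freqBox n) := by
  have h0 : Measurable fun k : Plane => k 0 := by fun_prop
  have h1 : Measurable fun k : Plane => k 1 := by fun_prop
  exact (h0 (measurableSet_freqBand n)).inter (h1 (measurableSet_freqBand n))

/-- The measurable identification of the plane with `ℝ × ℝ`. -/
def planeEquiv : Plane ≃ᵐ ℝ × ℝ :=
  (MeasurableEquiv.toLp 2 (Fin 2 → ℝ)).symm.trans MeasurableEquiv.finTwoArrow

lemma measurePreserving_planeEquiv :
    MeasurePreserving planeEquiv volume ((volume : Measure ℝ).prod volume) :=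
  (volume_preserving_finTwoArrow ℝ).comp
    (EuclideanSpace.volume_preserving_symm_measurableEquiv_toLp (Fin 2))

lemma planeEquiv_apply (k : Plane) : planeEquiv k = (k 0, k 1) := rfl

lemma freqBox_eq_preimage (n : ℕ) : freqBox n = planeEquiv ⁻¹' (freqBand n ×ˢ freqBand n) := rfl

lemma volume_freqBand_lt_top (n : ℕ) : volume (freqBand n) < ∞ := by
  rw [freqBand_eq]
  exact measure_union_lt_top measure_Icc_lt_top measure_Icc_lt_top

lemma volume_freqBox_lt_top (n : ℕ) : volume (freqBox n) < ∞ := by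
  rw [freqBox_eq_preimage, measurePreserving_planeEquiv.measure_preimage
    ((measurableSet_freqBand n).prod (measurableSet_freqBand n)).nullMeasurableSet,
    Measure.prod_prod]
  exact ENNReal.mul_lt_top (volume_freqBand_lt_top n) (volume_freqBand_lt_top n)

lemma setIntegral_freqBand_eq {n : ℕ} {f : ℝ → ℂ} (hf : IntegrableOn f (freqBand n)) :
    ∫ x in freqBand n, f x = (∫ x in ((n + 1 : ℝ)⁻¹)..(n + 1), f x)
      + ∫ x in ((n + 1 : ℝ)⁻¹)..(n + 1), f (-x) := by
  have h0 := freqBand_lower_pos n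
  have hle := freqBand_lower_le_upper n
  rw [freqBand_eq] at hf ⊢
  rw [setIntegral_union _ measurableSet_Icc (hf.mono_set Set.subset_union_left)
    (hf.mono_set Set.subset_union_right), intervalIntegral.integral_comp_neg,
    integral_Icc_eq_integral_Ioc, integral_Icc_eq_integral_Ioc,
    intervalIntegral.integral_of_le hle, intervalIntegral.integral_of_le (neg_le_neg hle)]
  rw [Set.disjoint_left]
  intro x hx hx'
  linarith [hx.1, hx'.2]

lemma two_pi_mul_abs_rpow {κ α : ℝ} (hκ : 0 < κ) :
    |2 * Real.pi * κ| ^ α * (2 * Real.pi * κ) = (2 * Real.pi) ^ (1 + α) * κ ^ (1 + α) := by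
  have h : 0 < 2 * Real.pi := Real.two_pi_pos
  rw [abs_of_pos (mul_pos h hκ), ← Real.rpow_add_one (mul_pos h hκ).ne',
    ← Real.mul_rpow h.le hκ.le, add_comm α 1]

lemma one_le_two_pi : (1 : ℝ) ≤ 2 * Real.pi := by linarith [Real.pi_gt_three]

/-- The weight `|ξ|^{z(α-1)/2}`. -/
def weight (α : ℝ) (z : ℂ) (k : Plane) : ℂ :=
  Complex.exp (z * (((α - 1) / 2 * Real.log |freqX k| : ℝ) : ℂ))

lemma measurable_freqX : Measurable freqX := by unfold freqX; fun_prop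

lemma measurable_freqY : Measurable freqY := by unfold freqY; fun_prop

lemma measurable_weight (α : ℝ) (z : ℂ) : Measurable (weight α z) := by
  have h : Measurable fun k : Plane => Real.log |freqX k| :=
    Real.measurable_log.comp (continuous_abs.measurable.comp measurable_freqX)
  unfold weight
  fun_prop

lemma abs_freqX_mem {n : ℕ} {k : Plane} (hk : k ∈ freqBox n) :
    (n + 1 : ℝ)⁻¹ ≤ |freqX k| ∧ |freqX k| ≤ 2 * Real.pi * (n + 1) := by
  have h1 : |freqX k| = 2 * Real.pi * |k 0| := by
    rw [freqX, abs_mul, abs_of_pos Real.two_pi_pos]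
  have h2 := hk.1
  simp only [freqBand, Set.mem_ofPred_eq, Set.mem_Icc] at h2
  have h3 := one_le_two_pi
  rw [h1]
  refine ⟨h2.1.trans ?_, by gcongr; exact h2.2⟩
  nlinarith [abs_nonneg (k 0)]

lemma norm_weight (α : ℝ) (z : ℂ) (k : Plane) :
    ‖weight α z k‖ = Real.exp (z.re * ((α - 1) / 2 * Real.log |freqX k|)) := by
  rw [weight, Complex.norm_exp, Complex.re_mul_ofReal]

lemma exists_abs_log_freqX_le (n : ℕ) :
    ∃ L : ℝ, ∀ k ∈ freqBox n, |Real.log (|freqX k|)| ≤ L := by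
  refine ⟨max |Real.log ((n + 1 : ℝ)⁻¹)| |Real.log (2 * Real.pi * (n + 1))|, fun k hk => ?_⟩
  obtain ⟨h1, h2⟩ := abs_freqX_mem hk
  have h0 := freqBand_lower_pos n
  exact abs_le_max_abs_abs (Real.log_le_log h0 h1) (Real.log_le_log (h0.trans_le h1) h2)

lemma exists_norm_weight_le (α : ℝ) (z : ℂ) (n : ℕ) :
    ∃ B : ℝ, ∀ k ∈ freqBox n, ‖weight α z k‖ ≤ B := by
  obtain ⟨L, hL⟩ := exists_abs_log_freqX_le n
  refine ⟨Real.exp (|z.re * ((α - 1) / 2)| * L), fun k hk => ?_⟩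
  rw [norm_weight, Real.exp_le_exp, ← mul_assoc]
  refine (le_abs_self _).trans ?_
  rw [abs_mul]
  gcongr
  exact hL k hk

/-- The oscillating factor `e^{-2πi w·k}`. -/
def planeWave (w k : Plane) : ℂ :=
  Complex.exp (Complex.I * ((-(2 * Real.pi * (w 0 * k 0 + w 1 * k 1)) : ℝ) : ℂ))

lemma norm_planeWave (w k : Plane) : ‖planeWave w k‖ = 1 := norm_cexp_I_mul_ofReal _

lemma measurable_planeWave (w : Plane) : Measurable (planeWave w) := by
  unfold planeWave; fun_prop

lemma groupSymbol_eq (α t : ℝ) (k : Plane) : groupSymbol α t k =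
    Complex.exp (Complex.I * ((-(t * dispersion α (freqX k) (freqY k)) : ℝ) : ℂ)) := by
  rw [groupSymbol]; push_cast; ring_nf

lemma integrableOn_of_norm_le_const {X : Type*} [MeasurableSpace X] {μ : Measure X} {s : Set X}
    {f : X → ℂ} {B : ℝ} (hs : μ s < ∞) (hsm : MeasurableSet s) (hf : Measurable f)
    (hB : ∀ x ∈ s, ‖f x‖ ≤ B) : IntegrableOn f s μ :=
  Measure.integrableOn_of_bounded hs.ne hf.aestronglyMeasurable
    ((ae_restrict_iff' hsm).2 (Filter.Eventually.of_forall hB))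

/-- On a half plane of fixed sign of ξ the integrand is a function of `k 0` times a function of `k
1`, and each one-dimensional integral is $O(|t|^{-1/2})$. The η-integral is the case α = 1, γ = 0 of
the same weighted estimate. Neither bound depends on the endpoints or on the linear part of the
phase, hence the uniformity in n and w. -/
lemma exists_norm_kernel_le {α : ℝ} (hα0 : 0 < α) (hα1 : α ≤ 1) :
    ∃ C : ℝ, 0 ≤ C ∧ ∀ (n : ℕ) (t γ : ℝ) (w : Plane), t ≠ 0 →
      ‖∫ k in freqBox n, weight α (1 + γ * Complex.I) k * groupSymbol α t k * planeWave w k‖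
        ≤ C * (1 + |γ|) / |t| := by
  obtain ⟨C₁, hC₁, h1⟩ := exists_norm_integral_weighted_oscillatory_le hα0 hα1
  obtain ⟨C₂, hC₂, h2⟩ := exists_norm_integral_weighted_oscillatory_le one_pos le_rfl
  -- The 4 counts the sign choices for ξ and η.
  refine ⟨4 * C₁ * C₂, by positivity, fun n t γ w ht => ?_⟩
  set a : ℝ := (n + 1 : ℝ)⁻¹ with ha
  set b : ℝ := (n + 1 : ℝ) with hb
  have ha0 : 0 < a := freqBand_lower_pos n
  have hab : a ≤ b := freqBand_lower_le_upper n
  set A : ℝ → ℂ := fun x =>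
    Complex.exp ((1 + γ * Complex.I) * (((α - 1) / 2 * Real.log |2 * Real.pi * x| : ℝ) : ℂ)) *
    Complex.exp (Complex.I *
      ((-(2 * Real.pi * w 0 * x) - t * (|2 * Real.pi * x| ^ α * (2 * Real.pi * x)) : ℝ) : ℂ))
    with hA
  set B : ℝ → ℝ → ℂ := fun σ y =>
    Complex.exp (Complex.I *
      ((-(2 * Real.pi * w 1 * y) - t * (σ * (2 * Real.pi * y) ^ 2) : ℝ) : ℂ)) with hB
  have hAm : Measurable A := by
    have h3 : Measurable fun x : ℝ => Real.log |2 * Real.pi * x| := by fun_prop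
    have h4 : Measurable fun x : ℝ => |2 * Real.pi * x| ^ α := by fun_prop
    simp only [hA]
    fun_prop
  have hBm : ∀ σ, Measurable (B σ) := by intro σ; simp only [hB]; fun_prop
  have hsplit : ∀ k : Plane, k 0 ≠ 0 →
      weight α (1 + γ * Complex.I) k * groupSymbol α t k * planeWave w k
        = A (k 0) * B (Real.sign (k 0)) (k 1) := by
    intro k hk
    have hs : Real.sign (freqX k) = Real.sign (k 0) := by
      rw [freqX]
      rcases hk.lt_or_gt with h | h
      · rw [Real.sign_of_neg h, Real.sign_of_neg (mul_neg_of_pos_of_neg Real.two_pi_pos h)]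
      · rw [Real.sign_of_pos h, Real.sign_of_pos (mul_pos Real.two_pi_pos h)]
    simp only [weight, groupSymbol_eq, planeWave, hA, hB, dispersion, hs]
    simp only [freqX, freqY, mul_assoc, ← Complex.exp_add]
    congr 1
    push_cast
    ring
  have hB1 : ∀ σ ∈ ({1, -1} : Set ℝ), ‖∫ y in freqBand n, B σ y‖ ≤ 2 * C₂ / √|t| := by
    intro σ hσ
    have hσ' : |σ| = 1 := by rcases hσ with rfl | rfl <;> simp
    have hσ0 : σ ≠ 0 := by rintro rfl; simp at hσ'
    have hint : IntegrableOn (B σ) (freqBand n) :=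
      integrableOn_of_norm_le_const (B := 1) (volume_freqBand_lt_top n) (measurableSet_freqBand n)
        (hBm σ) fun x _ => (norm_cexp_I_mul_ofReal _).le
    have key : ∀ τ ∈ ({1, -1} : Set ℝ), ‖∫ y in a..b, B σ (τ * y)‖ ≤ C₂ / √|t| := by
      intro τ hτ
      have hτ2 : τ ^ 2 = 1 := by rcases hτ with rfl | rfl <;> norm_num
      have h3 := h2 (-(2 * Real.pi * w 1 * τ)) (t * σ * (2 * Real.pi) ^ 2) 0 a b
        (mul_ne_zero (mul_ne_zero ht hσ0) (by positivity)) ha0 hab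
      have h4 : (∫ y in a..b, B σ (τ * y)) = ∫ k in a..b,
          Complex.exp ((1 + (0:ℝ) * Complex.I) * (((1 - 1) / 2 * Real.log k : ℝ) : ℂ)) *
          Complex.exp (Complex.I * ((-(2 * Real.pi * w 1 * τ) * k
            - t * σ * (2 * Real.pi) ^ 2 * k ^ (1 + 1 : ℝ) : ℝ) : ℂ)) := by
        refine intervalIntegral.integral_congr fun y _ => ?_
        have e : y ^ (1 + 1 : ℝ) = y ^ 2 := by rw [one_add_one_eq_two]; exact Real.rpow_two y
        simp only [hB, e]
        rw [sub_self, zero_div, zero_mul, Complex.ofReal_zero, mul_zero, Complex.exp_zero, one_mul]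
        congr 3
        linear_combination (-(t * σ * (2 * Real.pi) ^ 2 * y ^ 2)) * hτ2
      rw [h4]
      refine h3.trans ?_
      rw [abs_zero, add_zero, mul_one, abs_mul, abs_mul, hσ', mul_one]
      gcongr
      have : (1 : ℝ) ≤ |(2 * Real.pi) ^ 2| := by
        rw [abs_of_nonneg (by positivity)]; exact one_le_pow₀ one_le_two_pi
      nlinarith [abs_nonneg t]
    rw [setIntegral_freqBand_eq hint]
    have h5 := key 1 (by simp)
    have h6 := key (-1) (by simp)
    simp only [one_mul, neg_mul] at h5 h6
    refine (norm_add_le _ _).trans ((add_le_add h5 h6).trans (le_of_eq ?_))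
    ring
  have hA1 : ∀ σ ∈ ({1, -1} : Set ℝ),
      ‖∫ x in a..b, A (σ * x)‖ ≤ C₁ * (1 + |γ|) / √|t| := by
    intro σ hσ
    have hσ' : |σ| = 1 := by rcases hσ with rfl | rfl <;> simp
    have hσ0 : σ ≠ 0 := by rintro rfl; simp at hσ'
    have hp : 0 < (2 * Real.pi) ^ (1 + α) := Real.rpow_pos_of_pos Real.two_pi_pos _
    have h3 := h1 (-(2 * Real.pi * w 0 * σ)) (t * σ * (2 * Real.pi) ^ (1 + α)) γ a b
      (mul_ne_zero (mul_ne_zero ht hσ0) hp.ne') ha0 hab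
    -- Passing from ξ to `k 0` = ξ/(2π) in the weight costs this constant, of modulus
    -- $(2\pi)^{(\alpha-1)/2}\le 1$ because α ≤ 1.
    set c : ℂ := Complex.exp ((1 + γ * Complex.I) * (((α - 1) / 2 * Real.log (2 * Real.pi) : ℝ) : ℂ))
      with hc
    have hcn : ‖c‖ ≤ 1 := by
      rw [hc, Complex.norm_exp, Complex.re_mul_ofReal, Real.exp_le_one_iff]
      have := Real.log_nonneg one_le_two_pi
      simp only [Complex.add_re, Complex.one_re, Complex.mul_re, Complex.ofReal_re, Complex.I_re,
        Complex.ofReal_im, Complex.I_im]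
      nlinarith
    have h4 : (∫ x in a..b, A (σ * x)) = ∫ k in a..b, c * (
        Complex.exp ((1 + γ * Complex.I) * (((α - 1) / 2 * Real.log k : ℝ) : ℂ)) *
        Complex.exp (Complex.I * ((-(2 * Real.pi * w 0 * σ) * k
          - t * σ * (2 * Real.pi) ^ (1 + α) * k ^ (1 + α) : ℝ) : ℂ))) := by
      refine intervalIntegral.integral_congr fun x hx => ?_
      rw [Set.uIcc_of_le hab] at hx
      have hx0 : 0 < x := ha0.trans_le hx.1
      have e0 : |2 * Real.pi * (σ * x)| = |2 * Real.pi * x| := by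
        rw [abs_mul, abs_mul σ, hσ', one_mul, ← abs_mul]
      have e1 : |2 * Real.pi * (σ * x)| ^ α * (2 * Real.pi * (σ * x))
          = σ * ((2 * Real.pi) ^ (1 + α) * x ^ (1 + α)) := by
        rw [← two_pi_mul_abs_rpow hx0, e0]; ring
      have e2 : Real.log |2 * Real.pi * (σ * x)| = Real.log (2 * Real.pi) + Real.log x := by
        rw [e0, abs_of_pos (mul_pos Real.two_pi_pos hx0),
          Real.log_mul Real.two_pi_pos.ne' hx0.ne']
      simp only [hA, e1, e2, hc, ← Complex.exp_add]
      congr 1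
      push_cast
      ring
    rw [h4, intervalIntegral.integral_const_mul, norm_mul]
    refine (mul_le_of_le_one_left (norm_nonneg _) hcn).trans (h3.trans ?_)
    rw [abs_mul, abs_mul, hσ', mul_one]
    gcongr
    have : (1 : ℝ) ≤ |(2 * Real.pi) ^ (1 + α)| := by
      rw [abs_of_pos hp]; exact Real.one_le_rpow one_le_two_pi (by linarith)
    nlinarith [abs_nonneg t]
  set P : Set ℝ := Set.Icc a b with hP
  set N : Set ℝ := Set.Icc (-b) (-a) with hN
  set F : Plane → ℂ := fun k =>
    weight α (1 + γ * Complex.I) k * groupSymbol α t k * planeWave w k with hF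
  have hFm : Measurable F :=
    ((measurable_weight _ _).mul (measurable_groupSymbol α t)).mul (measurable_planeWave w)
  have hFint : IntegrableOn F (freqBox n) := by
    obtain ⟨D, hD⟩ := exists_norm_weight_le α (1 + γ * Complex.I) n
    refine integrableOn_of_norm_le_const (B := D) (volume_freqBox_lt_top n)
      (measurableSet_freqBox n) hFm fun k hk => ?_
    rw [hF, norm_mul, norm_mul, norm_groupSymbol, norm_planeWave, mul_one, mul_one]
    exact hD k hk
  have hbox : freqBox n = planeEquiv ⁻¹' (P ×ˢ freqBand n) ∪ planeEquiv ⁻¹' (N ×ˢ freqBand n) := by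
    rw [freqBox_eq_preimage, ← Set.preimage_union, ← Set.union_prod]
    conv_lhs => rw [freqBand_eq n]
    rw [freqBand_eq n]
  have hpiece : ∀ (σ : ℝ) (S : Set ℝ), MeasurableSet S → (∀ x ∈ S, x ≠ 0 ∧ Real.sign x = σ) →
      (∫ k in planeEquiv ⁻¹' (S ×ˢ freqBand n), F k)
        = (∫ x in S, A x) * ∫ y in freqBand n, B σ y := by
    intro σ S hS hσ
    have hSm : MeasurableSet (S ×ˢ freqBand n) := hS.prod (measurableSet_freqBand n)
    rw [← setIntegral_prod_mul, ← measurePreserving_planeEquiv.setIntegral_preimage_emb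
      planeEquiv.measurableEmbedding]
    refine setIntegral_congr_fun (planeEquiv.measurable hSm) fun k hk => ?_
    obtain ⟨h3, h4⟩ := hσ (k 0) hk.1
    simp only [hF, planeEquiv_apply]
    rw [hsplit k h3, h4]
  have hPp : ∀ x ∈ P, x ≠ 0 ∧ Real.sign x = 1 := fun x hx =>
    have h : 0 < x := ha0.trans_le hx.1
    ⟨h.ne', Real.sign_of_pos h⟩
  have hNp : ∀ x ∈ N, x ≠ 0 ∧ Real.sign x = -1 := fun x hx =>
    have h : x < 0 := by linarith [hx.2]
    ⟨h.ne, Real.sign_of_neg h⟩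
  have hdisj : Disjoint (planeEquiv ⁻¹' (P ×ˢ freqBand n)) (planeEquiv ⁻¹' (N ×ˢ freqBand n)) := by
    rw [Set.disjoint_left]
    intro k hk hk'
    have h3 : a ≤ k 0 := hk.1.1
    have h4 : k 0 ≤ -a := hk'.1.2
    linarith
  have hNm : MeasurableSet (planeEquiv ⁻¹' (N ×ˢ freqBand n)) :=
    planeEquiv.measurable (measurableSet_Icc.prod (measurableSet_freqBand n))
  rw [hbox] at hFint ⊢
  rw [setIntegral_union hdisj hNm (hFint.mono_set Set.subset_union_left)
    (hFint.mono_set Set.subset_union_right), hpiece 1 P measurableSet_Icc hPp,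
    hpiece (-1) N measurableSet_Icc hNp]
  have hAP : ‖∫ x in P, A x‖ ≤ C₁ * (1 + |γ|) / √|t| := by
    have := hA1 1 (by simp)
    simp only [one_mul] at this
    rwa [hP, integral_Icc_eq_integral_Ioc, ← intervalIntegral.integral_of_le hab]
  have hAN : ‖∫ x in N, A x‖ ≤ C₁ * (1 + |γ|) / √|t| := by
    have := hA1 (-1) (by simp)
    simp only [neg_mul, one_mul] at this
    rwa [hN, integral_Icc_eq_integral_Ioc, ← intervalIntegral.integral_of_le (neg_le_neg hab),
      ← intervalIntegral.integral_comp_neg]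
  have hst : √|t| * √|t| = |t| := Real.mul_self_sqrt (abs_nonneg t)
  have hst0 : 0 < √|t| := Real.sqrt_pos.2 (abs_pos.2 ht)
  calc _ ≤ C₁ * (1 + |γ|) / √|t| * (2 * C₂ / √|t|) + C₁ * (1 + |γ|) / √|t| * (2 * C₂ / √|t|) := by
        refine (norm_add_le _ _).trans (add_le_add ?_ ?_)
        · rw [norm_mul]
          exact mul_le_mul hAP (hB1 1 (by simp)) (norm_nonneg _) (by positivity)
        · rw [norm_mul]
          exact mul_le_mul hAN (hB1 (-1) (by simp)) (norm_nonneg _) (by positivity)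
    _ = 4 * C₁ * C₂ * (1 + |γ|) / (√|t| * √|t|) := by field_simp; ring
    _ = 4 * C₁ * C₂ * (1 + |γ|) / |t| := by rw [hst]

/-! ### The classical Fourier transform on `L¹ ∩ L²` -/

lemma planeWave_comm (w k : Plane) : planeWave w k = planeWave k w := by
  simp only [planeWave, mul_comm]

lemma planeWave_add_left (v w k : Plane) : planeWave (v + w) k = planeWave v k * planeWave w k := by
  simp only [planeWave, ← Complex.exp_add]
  congr 1
  simp only [PiLp.add_apply]
  push_cast
  ring

lemma planeWave_neg_left (w k : Plane) :
    planeWave (-w) k = (starRingEnd ℂ) (planeWave w k) := by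
  simp only [planeWave, ← Complex.exp_conj, map_mul, Complex.conj_I, Complex.conj_ofReal,
    PiLp.neg_apply]
  congr 1
  push_cast
  ring

lemma fourier_eq_integral_planeWave (f : Plane → ℂ) (k : Plane) :
    𝓕 f k = ∫ x, planeWave x k * f x := by
  rw [Real.fourier_eq']
  refine integral_congr_ae (Filter.Eventually.of_forall fun x => ?_)
  simp only [planeWave, smul_eq_mul]
  congr 2
  rw [mul_comm, EuclideanSpace.inner_eq_star_dotProduct]
  simp [dotProduct, Fin.sum_univ_two]
  ring

lemma fourierInv_eq_integral_planeWave (f : Plane → ℂ) (z : Plane) :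
    𝓕⁻ f z = ∫ k, planeWave (-z) k * f k := by
  rw [Real.fourierInv_eq_fourier_neg, fourier_eq_integral_planeWave]
  simp only [planeWave_comm (-z)]

lemma norm_fourier_le (f : Plane → ℂ) (k : Plane) : ‖𝓕 f k‖ ≤ ∫ x, ‖f x‖ := by
  rw [fourier_eq_integral_planeWave]
  refine (norm_integral_le_integral_norm _).trans (le_of_eq ?_)
  simp only [norm_mul, norm_planeWave, one_mul]

lemma continuous_fourier {f : Plane → ℂ} (hf : Integrable f) : Continuous (𝓕 f) :=
  VectorFourier.fourierIntegral_continuous Real.continuous_fourierChar continuous_inner hf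

lemma integral_fourier_mul {f g : Plane → ℂ} (hf : Integrable f) (hg : Integrable g) :
    ∫ x, 𝓕 f x * g x = ∫ x, f x * 𝓕 g x := by
  simpa using! VectorFourier.integral_fourierIntegral_smul_eq_flip (L := innerₗ Plane)
      Real.continuous_fourierChar continuous_inner hf hg

/-- Both sides are locally integrable and have the same integrals against smooth compactly supported
functions: such a function is Schwartz, the $L^2$ transform agrees with the distributional one, and
the multiplication formula handles the integral transform. -/
lemma fourier_toLp_ae_eq {f : Plane → ℂ} (hf : Integrable f) (hf2 : MemLp f 2) :
    (𝓕 (hf2.toLp f) : L2) =ᵐ[volume] 𝓕 f := by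
  refine ae_eq_of_integral_contDiff_smul_eq
    ((Lp.memLp (𝓕 (hf2.toLp f) : L2)).locallyIntegrable (by norm_num))
    (continuous_fourier hf).locallyIntegrable fun g hg hgc => ?_
  have hg₁ : HasCompactSupport (Complex.ofRealCLM ∘ g) := hgc.comp_left rfl
  have hg₂ : ContDiff ℝ (⊤ : ℕ∞) (Complex.ofRealCLM ∘ g) := by fun_prop
  set ψ : 𝓢(Plane, ℂ) := hg₁.toSchwartzMap hg₂ with hψ
  have hψa : ∀ x, ψ x = (g x : ℂ) := fun x => rfl
  have h1 := congrArg (fun T => T ψ) (Lp.fourier_toTemperedDistribution_eq (hf2.toLp f))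
  have h2 : (∫ x, (𝓕 ψ) x • (hf2.toLp f) x) = ∫ x, ψ x • (𝓕 (hf2.toLp f) : L2) x := by
    simpa [Lp.toTemperedDistribution_apply] using h1
  have h3 : (∫ x, (𝓕 ψ) x • (hf2.toLp f) x) = ∫ x, 𝓕 (ψ : Plane → ℂ) x * f x := by
    refine integral_congr_ae ?_
    filter_upwards [hf2.coeFn_toLp] with x hx
    rw [hx, smul_eq_mul, SchwartzMap.fourier_coe]
  rw [h3, integral_fourier_mul ψ.integrable hf] at h2
  calc (∫ x, g x • (𝓕 (hf2.toLp f) : L2) x) = ∫ x, ψ x • (𝓕 (hf2.toLp f) : L2) x := by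
        simp only [hψa, smul_eq_mul, Complex.real_smul]
    _ = ∫ x, ψ x * 𝓕 f x := h2.symm
    _ = ∫ x, g x • 𝓕 f x := by simp only [hψa, Complex.real_smul]

/-- Plancherel's theorem for the classical Fourier transform on `L¹ ∩ L²`. -/
lemma eLpNorm_fourier_eq {f : Plane → ℂ} (hf : Integrable f) (hf2 : MemLp f 2) :
    eLpNorm (𝓕 f) 2 volume = eLpNorm f 2 volume := by
  have h1 : ‖(𝓕 (hf2.toLp f) : L2)‖ₑ = ‖hf2.toLp f‖ₑ := by
    rw [← ofReal_norm, ← ofReal_norm, Lp.norm_fourier_eq]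
  rw [Lp.enorm_def, Lp.enorm_def, eLpNorm_congr_ae (fourier_toLp_ae_eq hf hf2),
    eLpNorm_congr_ae hf2.coeFn_toLp] at h1
  exact h1

lemma memLp_fourier {f : Plane → ℂ} (hf : Integrable f) (hf2 : MemLp f 2) :
    MemLp (𝓕 f) 2 :=
  ⟨(continuous_fourier hf).aestronglyMeasurable, by
    rw [eLpNorm_fourier_eq hf hf2]; exact hf2.2⟩

lemma eLpNorm_fourierInv_eq {f : Plane → ℂ} (hf : Integrable f) (hf2 : MemLp f 2) :
    eLpNorm (𝓕⁻ f) 2 volume = eLpNorm f 2 volume := by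
  rw [← eLpNorm_fourier_eq hf hf2]
  have h : 𝓕⁻ f = 𝓕 f ∘ fun x => -x := by
    funext z; exact Real.fourierInv_eq_fourier_neg f z
  rw [h]
  exact eLpNorm_comp_measurePreserving (continuous_fourier hf).aestronglyMeasurable
    (Measure.measurePreserving_neg volume)

/-! ### Complex interpolation -/

lemma norm_mul_cexp_mul_ofReal_le {a z : ℂ} {b L R : ℝ} (hb : |b| ≤ L) (hz : |z.re| ≤ R) :
    ‖a * Complex.exp (z * (b : ℂ))‖ ≤ ‖a‖ * Real.exp (R * L) := by
  rw [norm_mul, Complex.norm_exp, Complex.re_mul_ofReal]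
  refine mul_le_mul_of_nonneg_left (Real.exp_le_exp.2 ((le_abs_self _).trans ?_)) (norm_nonneg _)
  rw [abs_mul]
  exact mul_le_mul hz hb (abs_nonneg _) ((abs_nonneg _).trans hz)

lemma aestronglyMeasurable_mul_cexp {X : Type*} [MeasurableSpace X] {μ : Measure X}
    {A : X → ℂ} {B : X → ℝ} (hA : Integrable A μ) (hB : Measurable B) (z : ℂ) :
    AEStronglyMeasurable (fun ω => A ω * Complex.exp (z * (B ω : ℂ))) μ :=
  hA.aestronglyMeasurable.mul
    (by fun_prop : Measurable fun ω => Complex.exp (z * (B ω : ℂ))).aestronglyMeasurable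

lemma integrable_mul_cexp {X : Type*} [MeasurableSpace X] {μ : Measure X}
    {A : X → ℂ} {B : X → ℝ} {L : ℝ} (hA : Integrable A μ) (hB : Measurable B)
    (hBL : ∀ᵐ ω ∂μ, |B ω| ≤ L) (z : ℂ) :
    Integrable (fun ω => A ω * Complex.exp (z * (B ω : ℂ))) μ := by
  refine (hA.norm.mul_const (Real.exp (|z.re| * L))).mono'
    (aestronglyMeasurable_mul_cexp hA hB z) ?_
  filter_upwards [hBL] with ω hω
  exact norm_mul_cexp_mul_ofReal_le hω le_rfl

/-- Integrals of `A e^{zB}` with bounded `B` are entire functions of `z`. -/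
lemma differentiable_integral_mul_cexp {X : Type*} [MeasurableSpace X] {μ : Measure X}
    {A : X → ℂ} {B : X → ℝ} {L : ℝ} (hA : Integrable A μ) (hB : Measurable B)
    (hBL : ∀ᵐ ω ∂μ, |B ω| ≤ L) :
    Differentiable ℂ fun z : ℂ => ∫ ω, A ω * Complex.exp (z * (B ω : ℂ)) ∂μ := by
  intro z₀
  have h := hasDerivAt_integral_of_dominated_loc_of_deriv_le (μ := μ) (x₀ := z₀)
    (s := Metric.ball z₀ 1) (F := fun z ω => A ω * Complex.exp (z * (B ω : ℂ)))
    (F' := fun z ω => A ω * (Complex.exp (z * (B ω : ℂ)) * (B ω : ℂ)))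
    (bound := fun ω => ‖A ω‖ * Real.exp ((‖z₀‖ + 1) * L) * L)
    (Metric.ball_mem_nhds z₀ one_pos)
    (Filter.Eventually.of_forall fun z => aestronglyMeasurable_mul_cexp hA hB z)
    (integrable_mul_cexp hA hB hBL z₀)
    (hA.aestronglyMeasurable.mul (by fun_prop : Measurable fun ω =>
      Complex.exp (z₀ * (B ω : ℂ)) * (B ω : ℂ)).aestronglyMeasurable)
    ?_ ((hA.norm.mul_const _).mul_const _) ?_
  · exact h.2.differentiableAt
  · filter_upwards [hBL] with ω hω z hz
    rw [← mul_assoc, norm_mul, Complex.norm_real, Real.norm_eq_abs]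
    refine mul_le_mul (norm_mul_cexp_mul_ofReal_le hω ?_) hω (abs_nonneg _) (by positivity)
    have h1 : ‖z - z₀‖ < 1 := by rwa [← dist_eq_norm]
    calc |z.re| ≤ ‖z‖ := Complex.abs_re_le_norm z
      _ = ‖z₀ + (z - z₀)‖ := by rw [add_sub_cancel]
      _ ≤ ‖z₀‖ + ‖z - z₀‖ := norm_add_le _ _
      _ ≤ ‖z₀‖ + 1 := by linarith
  · refine Filter.Eventually.of_forall fun ω z _ => ?_
    have h1 : HasDerivAt (fun z : ℂ => z * (B ω : ℂ)) (B ω : ℂ) z := by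
      simpa using (hasDerivAt_id z).mul_const (B ω : ℂ)
    exact h1.cexp.const_mul (A ω)

/-- Measurable functions supported on a set of finite measure, on which their modulus is bounded
above and away from zero. -/
structure IsTame (f : Plane → ℂ) : Prop where
  measurable : Measurable f
  bounds : ∃ δ M : ℝ, 0 < δ ∧ ∀ x, f x ≠ 0 → δ ≤ ‖f x‖ ∧ ‖f x‖ ≤ M
  support : volume {x | f x ≠ 0} < ∞

/-- The analytic family `sgn(f) |f|^s`. -/
def tamePow (f : Plane → ℂ) (s : ℂ) (x : Plane) : ℂ :=
  f x / (‖f x‖ : ℂ) * Complex.exp (s * ((Real.log ‖f x‖ : ℝ) : ℂ))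

lemma tamePow_of_eq_zero {f : Plane → ℂ} {x : Plane} (s : ℂ) (h : f x = 0) :
    tamePow f s x = 0 := by simp [tamePow, h]

lemma norm_tamePow {f : Plane → ℂ} {s : ℂ} (hs : s.re ≠ 0) (x : Plane) :
    ‖tamePow f s x‖ = ‖f x‖ ^ s.re := by
  by_cases h : f x = 0
  · rw [tamePow_of_eq_zero s h, h, norm_zero, Real.zero_rpow hs]
  · have h0 : 0 < ‖f x‖ := norm_pos_iff.2 h
    rw [tamePow, norm_mul, norm_div, Complex.norm_real, norm_norm, div_self h0.ne', one_mul,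
      Complex.norm_exp, Complex.re_mul_ofReal, Real.rpow_def_of_pos h0, mul_comm]

lemma tamePow_one (f : Plane → ℂ) : tamePow f 1 = f := by
  funext x
  by_cases h : f x = 0
  · rw [tamePow_of_eq_zero 1 h, h]
  · have h0 : 0 < ‖f x‖ := norm_pos_iff.2 h
    have h1 : (‖f x‖ : ℂ) ≠ 0 := by exact_mod_cast h0.ne'
    rw [tamePow, one_mul, ← Complex.ofReal_exp, Real.exp_log h0, div_mul_cancel₀ _ h1]

/-- Along an affine exponent the family is a fixed function times $e^{zB}$ with B real, the shape
required by `differentiable_integral_mul_cexp`. -/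
lemma tamePow_add_mul (f : Plane → ℂ) (a : ℝ) (s z : ℂ) (x : Plane) :
    tamePow f (s + z * a) x
      = tamePow f s x * Complex.exp (z * ((a * Real.log ‖f x‖ : ℝ) : ℂ)) := by
  rw [tamePow, tamePow, mul_assoc, ← Complex.exp_add]
  congr 2
  push_cast
  ring

namespace IsTame

variable {f : Plane → ℂ}

lemma measurable_tamePow (hf : IsTame f) (s : ℂ) : Measurable (tamePow f s) := by
  have h := hf.measurable
  unfold tamePow
  fun_prop

lemma memLp (hf : IsTame f) (p : ℝ≥0∞) : MemLp f p := by
  obtain ⟨δ, M, _, hb⟩ := hf.bounds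
  have hS : MeasurableSet {x | f x ≠ 0} :=
    (hf.measurable (measurableSet_singleton (0 : ℂ))).compl
  have h1 : MemLp (Set.indicator {x | f x ≠ 0} fun _ => (M : ℂ)) p volume :=
    memLp_indicator_const p hS _ (Or.inr hf.support.ne)
  refine h1.of_le hf.measurable.aestronglyMeasurable (Filter.Eventually.of_forall fun x => ?_)
  by_cases hx : f x = 0
  · simp [hx]
  · rw [Set.indicator_of_mem (by exact hx), Complex.norm_real]
    exact (hb x hx).2.trans (le_abs_self M)

lemma integrable (hf : IsTame f) : Integrable f := memLp_one_iff_integrable.1 (hf.memLp 1)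

lemma exists_abs_log_norm_le (hf : IsTame f) : ∃ L : ℝ, ∀ x, |Real.log ‖f x‖| ≤ L := by
  obtain ⟨δ, M, hδ, hb⟩ := hf.bounds
  refine ⟨max |Real.log δ| |Real.log M|, fun x => ?_⟩
  by_cases hx : f x = 0
  · simp [hx]
  · obtain ⟨h1, h2⟩ := hb x hx
    exact abs_le_max_abs_abs (Real.log_le_log hδ h1) (Real.log_le_log (hδ.trans_le h1) h2)

lemma tamePow (hf : IsTame f) (s : ℂ) : IsTame (tamePow f s) := by
  obtain ⟨L, hL⟩ := hf.exists_abs_log_norm_le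
  have hne : ∀ x, FracBO.tamePow f s x ≠ 0 → f x ≠ 0 := fun x hx h =>
    hx (tamePow_of_eq_zero s h)
  refine ⟨hf.measurable_tamePow s, ⟨Real.exp (-(|s.re| * L)), Real.exp (|s.re| * L),
    Real.exp_pos _, fun x hx => ?_⟩, (measure_mono hne).trans_lt hf.support⟩
  have h0 : 0 < ‖f x‖ := norm_pos_iff.2 (hne x hx)
  have h1 : ‖FracBO.tamePow f s x‖ = Real.exp (s.re * Real.log ‖f x‖) := by
    rw [FracBO.tamePow, norm_mul, norm_div, Complex.norm_real, norm_norm, div_self h0.ne', one_mul,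
      Complex.norm_exp, Complex.re_mul_ofReal]
  have h2 : |s.re * Real.log ‖f x‖| ≤ |s.re| * L := by
    rw [abs_mul]; gcongr; exact hL x
  rw [h1, Real.exp_le_exp, Real.exp_le_exp]
  exact abs_le.1 h2

lemma integrable_norm_rpow (hf : IsTame f) {r : ℝ} (hr : r ≠ 0) :
    Integrable fun x => ‖f x‖ ^ r := by
  have h := (hf.tamePow (r : ℂ)).integrable.norm
  refine h.congr (Filter.Eventually.of_forall fun x => ?_)
  simp only [norm_tamePow (f := f) (s := (r : ℂ)) (by simpa using hr), Complex.ofReal_re]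

end IsTame

/-! ### Endpoint bounds for the truncated bilinear form -/

lemma integral_norm_sq_fourier {f : Plane → ℂ} (hf : Integrable f) (hf2 : MemLp f 2) :
    ∫ k, ‖𝓕 f k‖ ^ 2 = ∫ x, ‖f x‖ ^ 2 := by
  have h := congrArg ENNReal.toReal (eLpNorm_fourier_eq hf hf2)
  rw [(memLp_fourier hf hf2).eLpNorm_eq_integral_rpow_norm (by norm_num) (by norm_num),
    hf2.eLpNorm_eq_integral_rpow_norm (by norm_num) (by norm_num),
    ENNReal.toReal_ofReal (by positivity), ENNReal.toReal_ofReal (by positivity)] at h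
  simp only [ENNReal.toReal_ofNat, Real.rpow_two] at h
  exact (Real.rpow_left_inj (by positivity) (by positivity) (by norm_num)).1 h

lemma integral_norm_mul_norm_le_sqrt {X : Type*} [MeasurableSpace X] {μ : Measure X}
    {f g : X → ℂ} (hf : MemLp f 2 μ) (hg : MemLp g 2 μ) :
    ∫ x, ‖f x‖ * ‖g x‖ ∂μ ≤ √((∫ x, ‖f x‖ ^ 2 ∂μ) * ∫ x, ‖g x‖ ^ 2 ∂μ) := by
  have h := integral_mul_norm_le_Lp_mul_Lq (μ := μ) (f := f) (g := g)
    Real.HolderConjugate.two_two (by simpa using hf) (by simpa using hg)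
  simp only [Real.rpow_two] at h
  rwa [← Real.sqrt_eq_rpow, ← Real.sqrt_eq_rpow, ← Real.sqrt_mul (by positivity)] at h

/-- The truncated bilinear form `∫_box |ξ|^{z(α-1)/2} e^{-itω} 𝓕 f 𝓕⁻ g`. -/
def boxForm (α t : ℝ) (n : ℕ) (z : ℂ) (f g : Plane → ℂ) : ℂ :=
  ∫ k in freqBox n, weight α z k * groupSymbol α t k * (𝓕 f k * 𝓕⁻ g k)

/-- Absolute convergence in (k, x, y) jointly serves two ends: integrating in k first exposes the
dispersive kernel, and the form becomes a single integral that can be differentiated in z. -/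
lemma integrable_boxKernel {α t : ℝ} {n : ℕ} {f g : Plane → ℂ} (hf : Integrable f)
    (hg : Integrable g) (z : ℂ) :
    Integrable (fun p : Plane × (Plane × Plane) =>
      weight α z p.1 * groupSymbol α t p.1 *
        (planeWave p.2.1 p.1 * f p.2.1 * (planeWave (-p.2.2) p.1 * g p.2.2)))
      ((volume.restrict (freqBox n)).prod (volume.prod volume)) := by
  obtain ⟨D, hD⟩ := exists_norm_weight_le α z n
  have hw : Integrable (fun k => weight α z k * groupSymbol α t k)
      (volume.restrict (freqBox n)) := by
    refine integrableOn_of_norm_le_const (B := D) (volume_freqBox_lt_top n)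
      (measurableSet_freqBox n) ((measurable_weight α z).mul (measurable_groupSymbol α t))
      fun k hk => ?_
    rw [norm_mul, norm_groupSymbol, mul_one]
    exact hD k hk
  have h := hw.mul_prod (hf.mul_prod hg)
  have hm : Measurable fun p : Plane × (Plane × Plane) =>
      planeWave p.2.1 p.1 * planeWave (-p.2.2) p.1 := by
    unfold planeWave; fun_prop
  refine (h.bdd_mul hm.aestronglyMeasurable (c := 1)
    (Filter.Eventually.of_forall fun p => ?_)).congr (Filter.Eventually.of_forall fun p => ?_)
  · rw [norm_mul, norm_planeWave, norm_planeWave, one_mul]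
  · simp only
    ring

lemma integral_boxKernel_eq_boxForm {α t : ℝ} {n : ℕ} {f g : Plane → ℂ} (hf : Integrable f)
    (hg : Integrable g) (z : ℂ) :
    ∫ p : Plane × (Plane × Plane), weight α z p.1 * groupSymbol α t p.1 *
        (planeWave p.2.1 p.1 * f p.2.1 * (planeWave (-p.2.2) p.1 * g p.2.2))
      ∂((volume.restrict (freqBox n)).prod (volume.prod volume)) = boxForm α t n z f g := by
  rw [integral_prod _ (integrable_boxKernel hf hg z), boxForm]
  refine integral_congr_ae (Filter.Eventually.of_forall fun k => ?_)
  simp only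
  rw [integral_const_mul, integral_prod_mul (fun x => planeWave x k * f x)
    (fun y => planeWave (-y) k * g y), fourier_eq_integral_planeWave,
    fourierInv_eq_integral_planeWave]
  congr 3
  funext y
  rw [planeWave_neg_left, planeWave_neg_left, planeWave_comm]

/-- The $L^1$ endpoint: integrating first in k leaves the kernel at x - y against f(x) g(y). -/
lemma norm_boxForm_le_of_kernel {α t : ℝ} {n : ℕ} {f g : Plane → ℂ} (hf : Integrable f)
    (hg : Integrable g) {z : ℂ} {K : ℝ}
    (hK : ∀ w, ‖∫ k in freqBox n, weight α z k * groupSymbol α t k * planeWave w k‖ ≤ K) :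
    ‖boxForm α t n z f g‖ ≤ K * ((∫ x, ‖f x‖) * ∫ x, ‖g x‖) := by
  rw [← integral_boxKernel_eq_boxForm hf hg z, integral_prod_symm _ (integrable_boxKernel hf hg z)]
  have h : ∀ p : Plane × Plane, ‖∫ k in freqBox n, weight α z k * groupSymbol α t k *
      (planeWave p.1 k * f p.1 * (planeWave (-p.2) k * g p.2))‖ ≤ K * (‖f p.1‖ * ‖g p.2‖) := by
    intro p
    have e : ∀ k, weight α z k * groupSymbol α t k *
        (planeWave p.1 k * f p.1 * (planeWave (-p.2) k * g p.2))
        = weight α z k * groupSymbol α t k * planeWave (p.1 + -p.2) k * (f p.1 * g p.2) := by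
      intro k
      rw [planeWave_add_left]; ring
    simp only [e]
    rw [integral_mul_const, norm_mul, norm_mul]
    exact mul_le_mul_of_nonneg_right (hK _) (by positivity)
  refine (norm_integral_le_of_norm_le ((hf.norm.mul_prod hg.norm).const_mul K)
    (Filter.Eventually.of_forall h)).trans (le_of_eq ?_)
  rw [integral_const_mul, integral_prod_mul (fun x => ‖f x‖) (fun x => ‖g x‖)]

/-- The $L^2$ endpoint: on the imaginary axis the whole multiplier has modulus one, so
Cauchy–Schwarz and Plancherel suffice. -/
lemma norm_boxForm_le_of_re_eq_zero {α t : ℝ} {n : ℕ} {f g : Plane → ℂ} (hf : Integrable f)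
    (hf2 : MemLp f 2) (hg : Integrable g) (hg2 : MemLp g 2) {z : ℂ} (hz : z.re = 0) :
    ‖boxForm α t n z f g‖ ≤ √((∫ x, ‖f x‖ ^ 2) * ∫ x, ‖g x‖ ^ 2) := by
  have hgi : 𝓕⁻ g = fun z => 𝓕 g (-z) := by
    funext z; exact Real.fourierInv_eq_fourier_neg g z
  have hF := memLp_fourier hf hf2
  have hG : MemLp (𝓕⁻ g) 2 := by
    rw [hgi]
    exact (memLp_fourier hg hg2).comp_measurePreserving (Measure.measurePreserving_neg volume)
  have hG2 : ∫ k, ‖𝓕⁻ g k‖ ^ 2 = ∫ x, ‖g x‖ ^ 2 := by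
    rw [← integral_norm_sq_fourier hg hg2, hgi]
    exact integral_neg_eq_self (fun k => ‖𝓕 g k‖ ^ 2) volume
  rw [← integral_norm_sq_fourier hf hf2, ← hG2]
  refine le_trans ?_ (integral_norm_mul_norm_le_sqrt hF hG)
  have hint : Integrable fun k => ‖𝓕 f k‖ * ‖𝓕⁻ g k‖ := hF.norm.integrable_mul hG.norm
  refine (norm_integral_le_integral_norm _).trans (le_trans (le_of_eq ?_)
    (setIntegral_le_integral (s := freqBox n) hint
      (Filter.Eventually.of_forall fun k => by positivity)))
  refine integral_congr_ae (Filter.Eventually.of_forall fun k => ?_)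
  simp only
  rw [norm_mul, norm_mul, norm_mul, norm_groupSymbol, norm_weight, hz, zero_mul, Real.exp_zero,
    one_mul, one_mul]

/-- The interpolated dispersive estimate. -/
lemma exists_norm_boxForm_le {α θ : ℝ} (hα0 : 0 < α) (hα1 : α ≤ 1) (hθ0 : 0 < θ) (hθ1 : θ < 1) :
    ∃ C : ℝ, 0 ≤ C ∧ ∀ (n : ℕ) (t : ℝ) (f g : Plane → ℂ), t ≠ 0 → IsTame f → IsTame g →
      ‖boxForm α t n θ f g‖ ≤ C * |t| ^ (-θ) *
        ((∫ x, ‖f x‖ ^ (2 / (1 + θ))) * ∫ x, ‖g x‖ ^ (2 / (1 + θ))) ^ ((1 + θ) / 2) := by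
  obtain ⟨C, hC, hker⟩ := exists_norm_kernel_le hα0 hα1
  refine ⟨(2 * Real.exp 1 * C) ^ θ, by positivity, fun n t f g ht hf hg => ?_⟩
  set r : ℝ := 2 / (1 + θ) with hr
  have hr0 : 0 < r := by positivity
  set N : ℝ := (∫ x, ‖f x‖ ^ r) * ∫ x, ‖g x‖ ^ r with hN
  have hN0 : 0 ≤ N := by positivity
  -- Re s equals r/2 on Re z = 0 and r on Re z = 1, so the squared $L^2$ norm on the first edge and
  -- the $L^1$ norm on the second both equal $\int|f|^r$. Also s(θ) = 1 because r = 2/(1 + θ), so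
  -- the original functions reappear at θ.
  set s : ℂ → ℂ := fun z => ((r / 2 : ℝ) : ℂ) + z * ((r / 2 : ℝ) : ℂ) with hs
  have hsre : ∀ z, (s z).re = r / 2 * (1 + z.re) := by
    intro z
    simp only [hs, Complex.add_re, Complex.ofReal_re, Complex.re_mul_ofReal]
    ring
  set F : ℂ → ℂ := fun z => boxForm α t n z (tamePow f (s z)) (tamePow g (s z)) with hF
  set μ : Measure (Plane × (Plane × Plane)) :=
    (volume.restrict (freqBox n)).prod (volume.prod volume) with hμ
  set A : Plane × (Plane × Plane) → ℂ := fun p => weight α 0 p.1 * groupSymbol α t p.1 *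
    (planeWave p.2.1 p.1 * tamePow f ((r / 2 : ℝ) : ℂ) p.2.1 *
      (planeWave (-p.2.2) p.1 * tamePow g ((r / 2 : ℝ) : ℂ) p.2.2)) with hA
  set B : Plane × (Plane × Plane) → ℝ := fun p => (α - 1) / 2 * Real.log |freqX p.1|
    + r / 2 * Real.log ‖f p.2.1‖ + r / 2 * Real.log ‖g p.2.2‖ with hB
  have hAint : Integrable A μ :=
    integrable_boxKernel (hf.tamePow _).integrable (hg.tamePow _).integrable 0
  have hBm : Measurable B := by
    have h1 := measurable_freqX
    have h2 := hf.measurable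
    have h3 := hg.measurable
    have h4 : Measurable fun p : Plane × (Plane × Plane) => Real.log |freqX p.1| :=
      Real.measurable_log.comp (continuous_abs.measurable.comp (h1.comp measurable_fst))
    simp only [hB]
    fun_prop
  have hFeq : F = fun z => ∫ p, A p * Complex.exp (z * (B p : ℂ)) ∂μ := by
    funext z
    rw [hF]
    simp only
    rw [← integral_boxKernel_eq_boxForm (hf.tamePow _).integrable (hg.tamePow _).integrable]
    refine integral_congr_ae (Filter.Eventually.of_forall fun p => ?_)
    simp only [hA, hB, hs, tamePow_add_mul, weight, zero_mul, Complex.exp_zero, one_mul,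
      Complex.ofReal_add, mul_add, Complex.exp_add]
    ring
  obtain ⟨L₁, hL₁⟩ := exists_abs_log_freqX_le n
  obtain ⟨L₂, hL₂⟩ := hf.exists_abs_log_norm_le
  obtain ⟨L₃, hL₃⟩ := hg.exists_abs_log_norm_le
  set L : ℝ := |(α - 1) / 2| * L₁ + |r / 2| * L₂ + |r / 2| * L₃ with hL
  have hBL : ∀ᵐ p ∂μ, |B p| ≤ L := by
    have h1 : ∀ᵐ k ∂(volume.restrict (freqBox n)), k ∈ freqBox n :=
      ae_restrict_mem (measurableSet_freqBox n)
    have h2 : ∀ᵐ p ∂μ, p.1 ∈ freqBox n := Measure.quasiMeasurePreserving_fst.ae h1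
    filter_upwards [h2] with p hp
    refine (abs_add_le _ _).trans (add_le_add ((abs_add_le _ _).trans (add_le_add ?_ ?_)) ?_)
    · rw [abs_mul]; exact mul_le_mul_of_nonneg_left (hL₁ _ hp) (abs_nonneg _)
    · rw [abs_mul]; exact mul_le_mul_of_nonneg_left (hL₂ _) (abs_nonneg _)
    · rw [abs_mul]; exact mul_le_mul_of_nonneg_left (hL₃ _) (abs_nonneg _)
  have hdiff : Differentiable ℂ F := by
    rw [hFeq]; exact differentiable_integral_mul_cexp hAint hBm hBL
  -- The factor $e^{z^2}$ decays like a Gaussian on vertical lines and absorbs the growth 1 + |Im z|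
  -- of the kernel bound, at the cost of the constant 2e. At z = θ it is at least 1, so it can be
  -- dropped.
  set G : ℂ → ℂ := fun z => F z * Complex.exp (z ^ 2) with hG
  have hGd : Differentiable ℂ G := hdiff.mul (by fun_prop)
  have hexp : ∀ z : ℂ, ‖Complex.exp (z ^ 2)‖ = Real.exp (z.re ^ 2 - z.im ^ 2) := by
    intro z
    rw [Complex.norm_exp, sq, Complex.mul_re, sq, sq]
  have hintf : ∀ z : ℂ, z.re = 1 → ∫ x, ‖tamePow f (s z) x‖ = ∫ x, ‖f x‖ ^ r := by
    intro z hz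
    have : (s z).re = r := by rw [hsre, hz]; ring
    simp only [norm_tamePow (f := f) (s := s z) (by rw [this]; exact hr0.ne'), this]
  have hintg : ∀ z : ℂ, z.re = 1 → ∫ x, ‖tamePow g (s z) x‖ = ∫ x, ‖g x‖ ^ r := by
    intro z hz
    have : (s z).re = r := by rw [hsre, hz]; ring
    simp only [norm_tamePow (f := g) (s := s z) (by rw [this]; exact hr0.ne'), this]
  have hsq : ∀ (u : Plane → ℂ) (z : ℂ), z.re = 0 →
      ∫ x, ‖tamePow u (s z) x‖ ^ 2 = ∫ x, ‖u x‖ ^ r := by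
    intro u z hz
    have h1 : (s z).re = r / 2 := by rw [hsre, hz]; ring
    refine integral_congr_ae (Filter.Eventually.of_forall fun x => ?_)
    simp only
    rw [norm_tamePow (f := u) (s := s z) (by rw [h1]; positivity), h1, ← Real.rpow_natCast,
      ← Real.rpow_mul (norm_nonneg _)]
    congr 1
    push_cast
    ring
  have hbdd : BddAbove ((norm ∘ G) '' Complex.HadamardThreeLines.verticalClosedStrip 0 1) := by
    refine ⟨(∫ p, ‖A p‖ * Real.exp (1 * L) ∂μ) * Real.exp 1, ?_⟩
    rintro _ ⟨z, hz, rfl⟩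
    have hz' : 0 ≤ z.re ∧ z.re ≤ 1 := hz
    simp only [Function.comp, hG, norm_mul, hexp]
    have h1 : ‖F z‖ ≤ ∫ p, ‖A p‖ * Real.exp (1 * L) ∂μ := by
      rw [hFeq]
      refine norm_integral_le_of_norm_le (hAint.norm.mul_const _) ?_
      filter_upwards [hBL] with p hp
      exact norm_mul_cexp_mul_ofReal_le hp (by rw [abs_of_nonneg hz'.1]; exact hz'.2)
    refine mul_le_mul h1 (Real.exp_le_exp.2 ?_) (Real.exp_pos _).le ((norm_nonneg _).trans h1)
    nlinarith [sq_nonneg z.im]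
  have ha : ∀ z ∈ Complex.re ⁻¹' {(0 : ℝ)}, ‖G z‖ ≤ √N := by
    intro z hz
    have hz' : z.re = 0 := hz
    have h1 := norm_boxForm_le_of_re_eq_zero (α := α) (t := t) (n := n)
      (hf.tamePow (s z)).integrable ((hf.tamePow (s z)).memLp 2)
      (hg.tamePow (s z)).integrable ((hg.tamePow (s z)).memLp 2) hz'
    rw [hsq f z hz', hsq g z hz'] at h1
    rw [hG, norm_mul, hexp, hz']
    refine (mul_le_of_le_one_right (norm_nonneg _) ?_).trans h1
    rw [Real.exp_le_one_iff]
    nlinarith [sq_nonneg z.im]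
  have hb : ∀ z ∈ Complex.re ⁻¹' {(1 : ℝ)}, ‖G z‖ ≤ 2 * Real.exp 1 * C / |t| * N := by
    intro z hz
    have hz' : z.re = 1 := hz
    have hzz : z = 1 + z.im * Complex.I := by
      conv_lhs => rw [← Complex.re_add_im z, hz', Complex.ofReal_one]
    have h1 := norm_boxForm_le_of_kernel (α := α) (t := t) (n := n) (z := z)
      (hf.tamePow (s z)).integrable (hg.tamePow (s z)).integrable
      (K := C * (1 + |z.im|) / |t|) (fun w => by
        have := hker n t z.im w ht
        rwa [← hzz] at this)
    rw [hintf z hz', hintg z hz', ← hN] at h1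
    rw [hG, norm_mul, hexp, hz']
    have h2 : (1 + |z.im|) * Real.exp (1 ^ 2 - z.im ^ 2) ≤ 2 * Real.exp 1 := by
      rw [one_pow, Real.exp_sub, ← mul_div_assoc, div_le_iff₀ (Real.exp_pos _)]
      have h3 := Real.add_one_le_exp (z.im ^ 2)
      have h4 : 1 + |z.im| ≤ 2 * (z.im ^ 2 + 1) := by
        rw [← sq_abs]; nlinarith [sq_nonneg (|z.im| - 1)]
      have h5 : 1 + |z.im| ≤ 2 * Real.exp (z.im ^ 2) := by linarith
      nlinarith [Real.exp_pos 1]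
    calc ‖F z‖ * Real.exp (1 ^ 2 - z.im ^ 2)
        ≤ C * (1 + |z.im|) / |t| * N * Real.exp (1 ^ 2 - z.im ^ 2) := by gcongr
      _ = C / |t| * N * ((1 + |z.im|) * Real.exp (1 ^ 2 - z.im ^ 2)) := by ring
      _ ≤ C / |t| * N * (2 * Real.exp 1) := by gcongr
      _ = 2 * Real.exp 1 * C / |t| * N := by ring
  have hmem : (θ : ℂ) ∈ Complex.HadamardThreeLines.verticalClosedStrip 0 1 := by
    change (θ : ℂ).re ∈ Set.Icc (0 : ℝ) 1
    exact ⟨hθ0.le, hθ1.le⟩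
  have h3 := Complex.HadamardThreeLines.norm_le_interp_of_mem_verticalClosedStrip₀₁' G hmem
    hGd.diffContOnCl hbdd ha hb
  have hsθ : s θ = 1 := by
    simp only [hs, ← Complex.ofReal_mul, ← Complex.ofReal_add]
    rw [show r / 2 + θ * (r / 2) = 1 by rw [hr]; field_simp; try ring, Complex.ofReal_one]
  have h4 : ‖boxForm α t n θ f g‖ ≤ ‖G θ‖ := by
    rw [hG, norm_mul, hexp, hF]
    simp only [hsθ, tamePow_one]
    refine le_mul_of_one_le_right (norm_nonneg _) (Real.one_le_exp ?_)
    simp [sq_nonneg]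
  refine (h4.trans h3).trans (le_of_eq ?_)
  have hta : 0 < |t| := abs_pos.2 ht
  rw [Complex.ofReal_re, Real.sqrt_eq_rpow, ← Real.rpow_mul hN0, Real.mul_rpow (by positivity) hN0,
    Real.div_rpow (by positivity) hta.le, Real.rpow_neg hta.le]
  have h5 : N ^ (1 / 2 * (1 - θ)) * N ^ θ = N ^ ((1 + θ) / 2) := by
    rw [← Real.rpow_add_of_nonneg hN0 (by nlinarith) hθ0.le]
    congr 1
    ring
  rw [← h5]
  ring

/-! ### The one-dimensional Hardy–Littlewood–Sobolev inequality on the diagonal -/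

lemma lintegral_comp_abs (F : ℝ → ℝ≥0∞) :
    ∫⁻ u, F |u| = 2 * ∫⁻ u in Set.Ioi 0, F u := by
  have h1 : ∫⁻ u in Set.Ioi 0, F |u| = ∫⁻ u in Set.Ioi 0, F u :=
    setLIntegral_congr_fun measurableSet_Ioi fun u hu => by rw [abs_of_pos hu]
  have h2 : ∫⁻ u in Set.Iic 0, F |u| = ∫⁻ u in Set.Ioi 0, F u := by
    have e : (Set.Ioi (0 : ℝ)) = (fun u : ℝ => -u) ⁻¹' Set.Iio 0 := by ext u; simp
    rw [setLIntegral_congr Iio_ae_eq_Iic.symm, ← h1, e,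
      ← (Measure.measurePreserving_neg (volume : Measure ℝ)).setLIntegral_comp_preimage_emb
        (MeasurableEquiv.neg ℝ).measurableEmbedding]
    simp only [abs_neg]
  rw [← lintegral_add_compl _ (measurableSet_Ioi (a := (0 : ℝ))), Set.compl_Ioi, h1, h2, two_mul]

lemma lintegral_abs_rpow_near {θ R : ℝ} (hθ : θ < 1) (hR : 0 < R) :
    ∫⁻ u : ℝ, (Set.Iio R).indicator (fun v => ENNReal.ofReal (v ^ (-θ))) |u|
      = ENNReal.ofReal (2 / (1 - θ) * R ^ (1 - θ)) := by
  have hint : IntervalIntegrable (fun u : ℝ => u ^ (-θ)) volume 0 R :=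
    intervalIntegral.intervalIntegrable_rpow' (by linarith)
  rw [lintegral_comp_abs (fun v => (Set.Iio R).indicator (fun v => ENNReal.ofReal (v ^ (-θ))) v),
    setLIntegral_indicator measurableSet_Iio, Set.Iio_inter_Ioi,
    setLIntegral_congr Ioo_ae_eq_Ioc, ← ofReal_integral_eq_lintegral_ofReal
      ((intervalIntegrable_iff_integrableOn_Ioc_of_le hR.le).1 hint)
      ((ae_restrict_iff' measurableSet_Ioc).2
        (Filter.Eventually.of_forall fun u hu => Real.rpow_nonneg hu.1.le _)),
    ← intervalIntegral.integral_of_le hR.le, integral_rpow (Or.inl (by linarith)),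
    show (2 : ℝ≥0∞) = ENNReal.ofReal 2 by simp, ← ENNReal.ofReal_mul zero_le_two]
  congr 1
  rw [Real.zero_rpow (by linarith), show -θ + 1 = 1 - θ by ring]
  ring

lemma lintegral_abs_rpow_far {R : ℝ} (hR : 0 < R) :
    ∫⁻ u : ℝ, (Set.Ioi R).indicator (fun v => ENNReal.ofReal (v ^ (-2 : ℝ))) |u|
      = ENNReal.ofReal (2 / R) := by
  rw [lintegral_comp_abs
      (fun v => (Set.Ioi R).indicator (fun v => ENNReal.ofReal (v ^ (-2 : ℝ))) v),
    setLIntegral_indicator measurableSet_Ioi, Set.inter_eq_left.2 (Set.Ioi_subset_Ioi hR.le),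
    ← ofReal_integral_eq_lintegral_ofReal (integrableOn_Ioi_rpow_of_lt (by norm_num) hR)
      ((ae_restrict_iff' measurableSet_Ioi).2
        (Filter.Eventually.of_forall fun u hu => Real.rpow_nonneg (hR.trans hu).le _)),
    integral_Ioi_rpow_of_lt (by norm_num) hR,
    show (2 : ℝ≥0∞) = ENNReal.ofReal 2 by simp, ← ENNReal.ofReal_mul zero_le_two]
  congr 1
  rw [show (-2 : ℝ) + 1 = -1 by norm_num, Real.rpow_neg_one]
  field_simp

/-- Control of the fractional integral of the part of `f` below height `a`. -/
lemma lintegral_indicator_mul_abs_rpow_le {θ : ℝ} (hθ0 : 0 < θ) (hθ1 : θ < 1) {f : ℝ → ℝ≥0∞}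
    (hf : Measurable f) {S : ℝ} (hS : 0 < S)
    (hfS : ∫⁻ s, f s ^ (2 / (2 - θ)) = ENNReal.ofReal S) {a : ℝ} (ha : 0 < a) (t : ℝ) :
    ∫⁻ s, {s | f s ≤ ENNReal.ofReal a}.indicator f s * ENNReal.ofReal (|t - s| ^ (-θ))
      ≤ ENNReal.ofReal ((2 / (1 - θ) + 2 ^ (θ / 2)) * (a ^ (2 / (2 - θ) - 1) * S ^ (1 - θ))) := by
  have h2θ : 0 < 2 - θ := by linarith
  set r : ℝ := 2 / (2 - θ) with hr
  have hr1 : 1 < r := by rw [hr, lt_div_iff₀ h2θ]; linarith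
  have hrθ : r * (1 - θ) = 2 - r := by rw [hr]; field_simp; ring
  have hrθ' : r * (θ / 2) = r - 1 := by rw [hr]; field_simp; ring
  -- The radius balances two estimates: inside it f is replaced by its height a, outside it Hölder
  -- with exponents r and 2/θ is used. Both then scale as $a^{r-1}S^{1-\theta}$.
  set R : ℝ := S / a ^ r with hR
  have har : 0 < a ^ r := Real.rpow_pos_of_pos ha _
  have hR0 : 0 < R := div_pos hS har
  set near : ℝ → ℝ≥0∞ := fun s =>
    (Set.Iio R).indicator (fun v => ENNReal.ofReal (v ^ (-θ))) |t - s| with hnear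
  set far : ℝ → ℝ≥0∞ := fun s =>
    (Set.Ici R).indicator (fun v => ENNReal.ofReal (v ^ (-θ))) |t - s| with hfar
  have hmk : Measurable fun v : ℝ => ENNReal.ofReal (v ^ (-θ)) := by fun_prop
  have hmsub : Measurable fun s : ℝ => |t - s| := by fun_prop
  have hmnear : Measurable near := (hmk.indicator measurableSet_Iio).comp hmsub
  have hmfar : Measurable far := (hmk.indicator measurableSet_Ici).comp hmsub
  have hpt : ∀ s, {s | f s ≤ ENNReal.ofReal a}.indicator f s * ENNReal.ofReal (|t - s| ^ (-θ))
      ≤ ENNReal.ofReal a * near s + f s * far s := by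
    intro s
    rcases lt_or_ge |t - s| R with h | h
    · refine le_trans ?_ le_self_add
      simp only [hnear]
      rw [Set.indicator_of_mem (show |t - s| ∈ Set.Iio R from h)]
      gcongr
      by_cases hs : s ∈ {s | f s ≤ ENNReal.ofReal a}
      · rw [Set.indicator_of_mem hs]; exact hs
      · rw [Set.indicator_of_notMem hs]; exact zero_le
    · refine le_trans ?_ le_add_self
      simp only [hfar]
      rw [Set.indicator_of_mem (show |t - s| ∈ Set.Ici R from h)]
      gcongr
      exact Set.indicator_le_self _ _ _
  have hI1 : ∫⁻ s, near s = ENNReal.ofReal (2 / (1 - θ) * R ^ (1 - θ)) := by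
    rw [← lintegral_abs_rpow_near hθ1 hR0]
    exact lintegral_sub_left_eq_self
      (fun u => (Set.Iio R).indicator (fun v => ENNReal.ofReal (v ^ (-θ))) |u|) t
  have hI2 : ∫⁻ s, far s ^ (2 / θ) = ENNReal.ofReal (2 / R) := by
    rw [← lintegral_abs_rpow_far hR0]
    rw [← lintegral_sub_left_eq_self
      (fun u => (Set.Ioi R).indicator (fun v => ENNReal.ofReal (v ^ (-2 : ℝ))) |u|) t]
    -- The closed cut-off in `far` and the open one in `lintegral_abs_rpow_far` differ only at the
    -- two points |t - s| = R.
    have hne : ∀ᵐ s : ℝ, s ≠ t - R ∧ s ≠ t + R := by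
      have h1 : ∀ c : ℝ, ∀ᵐ s : ℝ, s ≠ c := fun c => by
        rw [ae_iff]; simp
      filter_upwards [h1 (t - R), h1 (t + R)] with s h3 h4 using ⟨h3, h4⟩
    refine lintegral_congr_ae ?_
    filter_upwards [hne] with s hs
    have hneR : |t - s| ≠ R := by
      intro h
      rcases (abs_eq hR0.le).1 h with h | h
      · exact hs.1 (by linarith)
      · exact hs.2 (by linarith)
    simp only [hfar]
    by_cases h : R ≤ |t - s|
    · have h' : R < |t - s| := lt_of_le_of_ne h hneR.symm
      have hp : 0 < |t - s| := hR0.trans h'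
      rw [Set.indicator_of_mem (show |t - s| ∈ Set.Ici R from h),
        Set.indicator_of_mem (show |t - s| ∈ Set.Ioi R from h'),
        ENNReal.ofReal_rpow_of_nonneg (by positivity) (by positivity), ← Real.rpow_mul hp.le]
      congr 2
      field_simp
    · rw [Set.indicator_of_notMem (show |t - s| ∉ Set.Ici R from h),
        Set.indicator_of_notMem (show |t - s| ∉ Set.Ioi R from fun h' => h h'.le),
        ENNReal.zero_rpow_of_pos (by positivity)]
  have hconj : r.HolderConjugate (2 / θ) := by
    rw [Real.holderConjugate_iff]
    refine ⟨hr1, ?_⟩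
    rw [hr]; field_simp; ring
  have hH := ENNReal.lintegral_mul_le_Lp_mul_Lq volume hconj hf.aemeasurable hmfar.aemeasurable
  simp only [Pi.mul_apply] at hH
  rw [hfS, hI2] at hH
  have e1 : a * (2 / (1 - θ) * R ^ (1 - θ)) = 2 / (1 - θ) * (a ^ (r - 1) * S ^ (1 - θ)) := by
    rw [hR, Real.div_rpow hS.le har.le, ← Real.rpow_mul ha.le, hrθ]
    have : a = a ^ (r - 1) * a ^ (2 - r) := by
      rw [← Real.rpow_add ha, show r - 1 + (2 - r) = 1 by ring, Real.rpow_one]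
    have h0 : a ^ (2 - r) ≠ 0 := (Real.rpow_pos_of_pos ha _).ne'
    nth_rewrite 1 [this]
    field_simp
  have e2 : S ^ (1 / r) * (2 / R) ^ (1 / (2 / θ)) = 2 ^ (θ / 2) * (a ^ (r - 1) * S ^ (1 - θ)) := by
    have h1 : 1 / r = (1 - θ) + θ / 2 := by rw [hr]; field_simp; ring
    rw [show 1 / (2 / θ) = θ / 2 by field_simp, hR, h1, Real.rpow_add hS,
      show 2 / (S / a ^ r) = 2 * a ^ r / S by field_simp, Real.div_rpow (by positivity) hS.le,
      Real.mul_rpow zero_le_two har.le, ← Real.rpow_mul ha.le, hrθ']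
    have : S ^ (θ / 2) ≠ 0 := (Real.rpow_pos_of_pos hS _).ne'
    field_simp
  calc _ ≤ ∫⁻ s, (ENNReal.ofReal a * near s + f s * far s) := lintegral_mono hpt
    _ = ENNReal.ofReal a * (∫⁻ s, near s) + ∫⁻ s, f s * far s := by
      rw [lintegral_add_left (hmnear.const_mul _), lintegral_const_mul _ hmnear]
    _ ≤ ENNReal.ofReal a * ENNReal.ofReal (2 / (1 - θ) * R ^ (1 - θ))
        + ENNReal.ofReal S ^ (1 / r) * ENNReal.ofReal (2 / R) ^ (1 / (2 / θ)) := by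
      rw [hI1]; gcongr
    _ = ENNReal.ofReal ((2 / (1 - θ) + 2 ^ (θ / 2)) * (a ^ (r - 1) * S ^ (1 - θ))) := by
      have h1 : 0 < 1 - θ := by linarith
      rw [ENNReal.ofReal_rpow_of_pos hS, ENNReal.ofReal_rpow_of_pos (by positivity),
        ← ENNReal.ofReal_mul ha.le, ← ENNReal.ofReal_mul (by positivity),
        ← ENNReal.ofReal_add (by positivity) (by positivity), e1, e2, add_mul]

/-- The Hardy–Littlewood–Sobolev inequality on the line, for a function against itself. -/
lemma exists_lintegral_lintegral_mul_abs_rpow_le {θ : ℝ} (hθ0 : 0 < θ) (hθ1 : θ < 1) :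
    ∃ C : ℝ≥0, ∀ f : ℝ → ℝ≥0∞, Measurable f →
      ∫⁻ t, ∫⁻ s, f t * f s * ENNReal.ofReal (|t - s| ^ (-θ))
        ≤ C * (∫⁻ s, f s ^ (2 / (2 - θ))) ^ (2 - θ) := by
  have h2θ : 0 < 2 - θ := by linarith
  have h1θ : 0 < 1 - θ := by linarith
  set r : ℝ := 2 / (2 - θ) with hr
  have hr1 : 1 < r := by rw [hr, lt_div_iff₀ h2θ]; linarith
  set D : ℝ := 2 / (1 - θ) + 2 ^ (θ / 2) with hD
  have hD0 : 0 < D := by positivity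
  refine ⟨(2 * D).toNNReal, fun f hf => ?_⟩
  change _ ≤ ENNReal.ofReal (2 * D) * _
  rcases eq_or_ne (∫⁻ s, f s ^ r) ∞ with htop | htop
  · rw [htop, ENNReal.top_rpow_of_pos h2θ, ENNReal.mul_top (by simpa using hD0)]
    exact le_top
  rcases eq_or_ne (∫⁻ s, f s ^ r) 0 with hzero | hzero
  · have h0 : ∀ᵐ t, f t = 0 := by
      have := (lintegral_eq_zero_iff (hf.pow_const r)).1 hzero
      filter_upwards [this] with t ht
      exact (ENNReal.rpow_eq_zero_iff_of_pos (by linarith)).1 ht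
    have : (∫⁻ t, ∫⁻ s, f t * f s * ENNReal.ofReal (|t - s| ^ (-θ))) = 0 := by
      rw [← lintegral_zero (μ := (volume : Measure ℝ))]
      refine lintegral_congr_ae ?_
      filter_upwards [h0] with t ht
      simp [ht]
    rw [this]
    exact zero_le
  set S : ℝ := (∫⁻ s, f s ^ r).toReal with hS
  have hS0 : 0 < S := ENNReal.toReal_pos hzero htop
  have hfS : ∫⁻ s, f s ^ r = ENNReal.ofReal S := (ENNReal.ofReal_toReal htop).symm
  have hfin : ∀ᵐ t, f t < ∞ := by
    filter_upwards [ae_lt_top (hf.pow_const r) htop] with t ht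
    exact (ENNReal.rpow_lt_top_iff_of_pos (by linarith)).1 ht
  set k : ℝ → ℝ → ℝ≥0∞ := fun t s => ENNReal.ofReal (|t - s| ^ (-θ)) with hk
  have hkm : Measurable (Function.uncurry k) := by
    simp only [hk, Function.uncurry_def]; fun_prop
  -- By symmetry of the kernel it suffices to integrate over f(s) ≤ f(t), at the cost of a factor 2.
  -- The truncated bound at height a = f(t) then gives $f(t)\cdot f(t)^{r-1}=f(t)^r$, which
  -- integrates to S.
  set H : ℝ → ℝ → ℝ≥0∞ := fun t s => {s | f s ≤ f t}.indicator f s * k t s with hH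
  have hHm : Measurable (Function.uncurry fun t s => f t * H t s) := by
    have h1 : Measurable fun p : ℝ × ℝ => {p : ℝ × ℝ | f p.2 ≤ f p.1}.indicator
        (fun p => f p.2) p :=
      (hf.comp measurable_snd).indicator
        (measurableSet_le (hf.comp measurable_snd) (hf.comp measurable_fst))
    exact (hf.comp measurable_fst).mul (h1.mul hkm)
  have hsplit : ∀ t s, f t * f s * k t s ≤ f t * H t s + f s * H s t := by
    intro t s
    have hks : k s t = k t s := by simp only [hk, abs_sub_comm]
    simp only [hH]
    rcases le_total (f s) (f t) with h | h
    · refine le_trans ?_ le_self_add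
      rw [Set.indicator_of_mem (show s ∈ {s | f s ≤ f t} from h), mul_assoc]
    · refine le_trans ?_ le_add_self
      rw [Set.indicator_of_mem (show t ∈ {t | f t ≤ f s} from h), hks]
      exact le_of_eq (by ring)
  have hswap : ∫⁻ t, ∫⁻ s, f s * H s t = ∫⁻ t, ∫⁻ s, f t * H t s :=
    (lintegral_lintegral_swap hHm.aemeasurable).symm
  have hinner : ∀ᵐ t, ∫⁻ s, f t * H t s
      ≤ ENNReal.ofReal (D * S ^ (1 - θ)) * f t ^ r := by
    filter_upwards [hfin] with t ht
    rcases eq_or_ne (f t) 0 with h0 | h0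
    · simp [h0]
    have ha : 0 < (f t).toReal := ENNReal.toReal_pos h0 ht.ne
    have hfa : f t = ENNReal.ofReal (f t).toReal := (ENNReal.ofReal_toReal ht.ne).symm
    have h1 := lintegral_indicator_mul_abs_rpow_le hθ0 hθ1 hf hS0 hfS ha t
    rw [← hfa] at h1
    have hHt : Measurable (H t) :=
      (hf.indicator (measurableSet_le hf measurable_const)).mul (hkm.comp measurable_prodMk_left)
    rw [lintegral_const_mul _ hHt]
    refine (mul_le_mul_right h1 (f t)).trans (le_of_eq ?_)
    rw [hfa, ENNReal.ofReal_rpow_of_pos ha, ← ENNReal.ofReal_mul ENNReal.toReal_nonneg,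
      ← ENNReal.ofReal_mul (by positivity), ENNReal.toReal_ofReal ha.le]
    congr 1
    have : (f t).toReal ^ r = (f t).toReal * (f t).toReal ^ (r - 1) := by
      rw [← Real.rpow_one_add' ha.le (by linarith)]; congr 1; ring
    rw [this]
    ring
  calc ∫⁻ t, ∫⁻ s, f t * f s * k t s
      ≤ ∫⁻ t, ∫⁻ s, (f t * H t s + f s * H s t) :=
        lintegral_mono fun t => lintegral_mono fun s => hsplit t s
    _ = (∫⁻ t, ∫⁻ s, f t * H t s) + ∫⁻ t, ∫⁻ s, f s * H s t := by
        have hm : Measurable fun t => ∫⁻ s, f t * H t s := hHm.lintegral_prod_right'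
        rw [← lintegral_add_left hm]
        refine lintegral_congr fun t => ?_
        have hmt : Measurable fun s => f t * H t s := hHm.comp measurable_prodMk_left
        rw [lintegral_add_left hmt]
    _ = 2 * ∫⁻ t, ∫⁻ s, f t * H t s := by rw [hswap, two_mul]
    _ ≤ 2 * ∫⁻ t, ENNReal.ofReal (D * S ^ (1 - θ)) * f t ^ r := by
        gcongr 2 * ?_
        exact lintegral_mono_ae hinner
    _ = 2 * (ENNReal.ofReal (D * S ^ (1 - θ)) * ENNReal.ofReal S) := by
        rw [lintegral_const_mul _ (hf.pow_const r), hfS]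
    _ = ENNReal.ofReal (2 * D) * ENNReal.ofReal S ^ (2 - θ) := by
        rw [ENNReal.ofReal_rpow_of_pos hS0, ← ENNReal.ofReal_mul (by positivity),
          ← ENNReal.ofReal_mul (by positivity), show (2 : ℝ≥0∞) = ENNReal.ofReal 2 by simp,
          ← ENNReal.ofReal_mul zero_le_two]
        congr 1
        have : S ^ (2 - θ) = S ^ (1 - θ) * S := by
          rw [← Real.rpow_add_one hS0.ne']; congr 1; ring
        rw [this]; ring
    _ = _ := by rw [hfS]

/-! ### The dual Strichartz estimate -/

lemma measurable_dispersion (α : ℝ) :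
    Measurable fun k : Plane => dispersion α (freqX k) (freqY k) := by
  have hX := measurable_freqX
  have hY := measurable_freqY
  have hs : Measurable fun k => Real.sign (freqX k) := measurable_sign.comp hX
  have hp : Measurable fun k => |freqX k| ^ α :=
    (continuous_abs.measurable.comp hX).pow_const α
  unfold dispersion
  fun_prop

lemma measurable_groupSymbol_uncurry (α : ℝ) :
    Measurable fun p : ℝ × Plane => groupSymbol α p.1 p.2 := by
  have h : Measurable fun p : ℝ × Plane => dispersion α (freqX p.2) (freqY p.2) :=
    (measurable_dispersion α).comp measurable_snd
  unfold groupSymbol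
  fun_prop

lemma groupSymbol_mul_conj (α t s : ℝ) (k : Plane) :
    groupSymbol α t k * (starRingEnd ℂ) (groupSymbol α s k) = groupSymbol α (t - s) k := by
  simp only [groupSymbol_eq, ← Complex.exp_conj, map_mul, Complex.conj_I, Complex.conj_ofReal,
    ← Complex.exp_add]
  congr 1
  push_cast
  ring

/-- The frequency-truncated evolution of the frequency profile `h`, weighted by
`|ξ|^{z(α-1)/2}`. -/
def boxEvolution (α : ℝ) (n : ℕ) (z : ℂ) (h : Plane → ℂ) (t : ℝ) (x : Plane) : ℂ :=
  ∫ k in freqBox n, planeWave (-x) k * (weight α z k * groupSymbol α t k * h k)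

lemma integrableOn_weight_mul {α : ℝ} {n : ℕ} {z : ℂ} {h : Plane → ℂ}
    (hh : IntegrableOn h (freqBox n)) : IntegrableOn (fun k => weight α z k * h k) (freqBox n) := by
  obtain ⟨D, hD⟩ := exists_norm_weight_le α z n
  exact hh.bdd_mul (measurable_weight α z).aestronglyMeasurable
    ((ae_restrict_iff' (measurableSet_freqBox n)).2 (Filter.Eventually.of_forall hD))

lemma integrable_boxEvolution_kernel {α : ℝ} {n : ℕ} {z : ℂ} {h : Plane → ℂ}
    (hh : IntegrableOn h (freqBox n)) {G : ℝ × Plane → ℂ} (hG : Integrable G) :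
    Integrable (fun p : (ℝ × Plane) × Plane =>
      planeWave (-p.1.2) p.2 * (weight α z p.2 * groupSymbol α p.1.1 p.2 * h p.2) * G p.1)
      (volume.prod (volume.restrict (freqBox n))) := by
  have h1 := hG.mul_prod (integrableOn_weight_mul (α := α) (z := z) hh)
  have hm : Measurable fun p : (ℝ × Plane) × Plane =>
      planeWave (-p.1.2) p.2 * groupSymbol α p.1.1 p.2 := by
    refine Measurable.mul ?_ ((measurable_groupSymbol_uncurry α).comp
      (by fun_prop : Measurable fun p : (ℝ × Plane) × Plane => (p.1.1, p.2)))
    unfold planeWave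
    fun_prop
  refine (h1.bdd_mul hm.aestronglyMeasurable (c := 1)
    (Filter.Eventually.of_forall fun p => ?_)).congr (Filter.Eventually.of_forall fun p => ?_)
  · rw [norm_mul, norm_planeWave, norm_groupSymbol, one_mul]
  · simp only
    ring

lemma conj_fourierInv (g : Plane → ℂ) (k : Plane) :
    (starRingEnd ℂ) (𝓕⁻ g k) = 𝓕 (fun x => (starRingEnd ℂ) (g x)) k := by
  rw [fourierInv_eq_integral_planeWave, fourier_eq_integral_planeWave, ← integral_conj]
  congr 1
  funext x
  rw [map_mul, planeWave_neg_left, Complex.conj_conj, planeWave_comm]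

lemma IsTame.conj {f : Plane → ℂ} (hf : IsTame f) : IsTame fun x => (starRingEnd ℂ) (f x) := by
  obtain ⟨δ, M, hδ, hb⟩ := hf.bounds
  refine ⟨Complex.continuous_conj.measurable.comp hf.measurable, ⟨δ, M, hδ, fun x hx => ?_⟩, ?_⟩
  · rw [Complex.norm_conj]
    exact hb x (by simpa using hx)
  · simpa using hf.support

/-- Fubini moves the evolution onto G. The pairing is bilinear, so the transpose involves `𝓕⁻` and
the unconjugated symbol. -/
lemma integral_boxEvolution_mul {α : ℝ} {n : ℕ} {z : ℂ} {h : Plane → ℂ}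
    (hh : IntegrableOn h (freqBox n)) {G : ℝ × Plane → ℂ} (hG : Integrable G) :
    ∫ p : ℝ × Plane, boxEvolution α n z h p.1 p.2 * G p
      = ∫ k in freqBox n, h k *
        (weight α z k * ∫ t, groupSymbol α t k * 𝓕⁻ (fun x => G (t, x)) k) := by
  have hint := integrable_boxEvolution_kernel (α := α) (z := z) hh hG
  calc ∫ p : ℝ × Plane, boxEvolution α n z h p.1 p.2 * G p
      = ∫ p : ℝ × Plane, ∫ k in freqBox n,
          planeWave (-p.2) k * (weight α z k * groupSymbol α p.1 k * h k) * G p := by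
        refine integral_congr_ae (Filter.Eventually.of_forall fun p => ?_)
        simp only
        rw [integral_mul_const, boxEvolution]
    _ = ∫ k in freqBox n, ∫ p : ℝ × Plane,
          planeWave (-p.2) k * (weight α z k * groupSymbol α p.1 k * h k) * G p :=
        integral_integral_swap hint
    _ = _ := by
        refine integral_congr_ae (Filter.Eventually.of_forall fun k => ?_)
        simp only
        have hm : Measurable fun p : ℝ × Plane => groupSymbol α p.1 k * planeWave (-p.2) k := by
          refine Measurable.mul ((measurable_groupSymbol_uncurry α).comp
            (by fun_prop : Measurable fun p : ℝ × Plane => (p.1, k))) ?_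
          unfold planeWave
          fun_prop
        have hi : Integrable fun p : ℝ × Plane =>
            groupSymbol α p.1 k * planeWave (-p.2) k * G p := by
          refine hG.bdd_mul hm.aestronglyMeasurable (c := 1)
            (Filter.Eventually.of_forall fun p => ?_)
          rw [norm_mul, norm_planeWave, norm_groupSymbol, one_mul]
        calc ∫ p : ℝ × Plane,
              planeWave (-p.2) k * (weight α z k * groupSymbol α p.1 k * h k) * G p
            = ∫ p : ℝ × Plane, (h k * weight α z k) *
              (groupSymbol α p.1 k * planeWave (-p.2) k * G p) := by
              congr 1; funext p; ring
          _ = (h k * weight α z k) * ∫ t, ∫ x,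
              groupSymbol α t k * planeWave (-x) k * G (t, x) := by
              rw [integral_const_mul]
              congr 1
              exact integral_prod _ hi
          _ = _ := by
              rw [mul_assoc]
              congr 3
              funext t
              rw [fourierInv_eq_integral_planeWave, ← integral_const_mul]
              congr 1
              funext x
              rw [planeWave_neg_left, planeWave_neg_left, planeWave_comm x k]
              ring

lemma stronglyMeasurable_fourierInv_slice {G : ℝ × Plane → ℂ} (hG : Measurable G) :
    StronglyMeasurable fun p : Plane × ℝ => 𝓕⁻ (fun x => G (p.2, x)) p.1 := by
  simp only [fourierInv_eq_integral_planeWave]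
  refine StronglyMeasurable.integral_prod_right'
    (f := fun q : (Plane × ℝ) × Plane => planeWave (-q.1.1) q.2 * G (q.1.2, q.2)) ?_
  refine (Measurable.mul ?_ (hG.comp (by fun_prop))).stronglyMeasurable
  unfold planeWave
  fun_prop

lemma norm_fourierInv_le (f : Plane → ℂ) (k : Plane) : ‖𝓕⁻ f k‖ ≤ ∫ x, ‖f x‖ := by
  rw [Real.fourierInv_eq_fourier_neg]; exact norm_fourier_le f _

/-- The `TT*` identity. -/
lemma integral_norm_sq_eq_integral_boxForm {α s : ℝ} {n : ℕ} {G : ℝ × Plane → ℂ}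
    (hGm : Measurable G) (hG : Integrable G) :
    ((∫ k in freqBox n,
        ‖weight α s k * ∫ t, groupSymbol α t k * 𝓕⁻ (fun x => G (t, x)) k‖ ^ 2 : ℝ) : ℂ)
      = ∫ p : ℝ × ℝ, boxForm α (p.1 - p.2) n ((s + s : ℝ) : ℂ)
          (fun x => (starRingEnd ℂ) (G (p.2, x))) (fun x => G (p.1, x)) := by
  set γ : ℝ → ℝ := fun t => ∫ x, ‖G (t, x)‖ with hγ
  have hγi : Integrable γ := hG.integral_norm_prod_left
  obtain ⟨Φ, hΦ⟩ : ∃ Φ : Plane → ℝ → ℂ,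
      Φ = fun k t => groupSymbol α t k * 𝓕⁻ (fun x => G (t, x)) k := ⟨_, rfl⟩
  have hΦm : Measurable fun p : Plane × ℝ => Φ p.1 p.2 := by
    rw [hΦ]
    exact ((measurable_groupSymbol_uncurry α).comp measurable_swap).mul
      (stronglyMeasurable_fourierInv_slice hGm).measurable
  have hΦn : ∀ k t, ‖Φ k t‖ ≤ γ t := by
    intro k t
    rw [hΦ, norm_mul, norm_groupSymbol, one_mul]
    exact norm_fourierInv_le _ _
  -- For real s the weight is real, so expanding the square doubles the exponent: each factor of
  -- $TT^*$ carries half of the smoothing.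
  have hw2 : ∀ k, weight α s k * (starRingEnd ℂ) (weight α s k) = weight α ((s + s : ℝ) : ℂ) k := by
    intro k
    simp only [weight, ← Complex.exp_conj, map_mul, Complex.conj_ofReal, ← Complex.exp_add]
    congr 1
    push_cast
    ring
  obtain ⟨D, hD⟩ := exists_norm_weight_le α ((s + s : ℝ) : ℂ) n
  have hint : Integrable (fun q : Plane × (ℝ × ℝ) => weight α ((s + s : ℝ) : ℂ) q.1 *
      (Φ q.1 q.2.1 * (starRingEnd ℂ) (Φ q.1 q.2.2)))
      ((volume.restrict (freqBox n)).prod (volume.prod volume)) := by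
    have hc : Integrable (fun _ : Plane => D) (volume.restrict (freqBox n)) :=
      integrable_const_iff.2 (Or.inr ⟨by
        rw [Measure.restrict_apply_univ]; exact volume_freqBox_lt_top n⟩)
    refine (hc.mul_prod (hγi.mul_prod hγi)).mono' ?_ ?_
    · have m1 : Measurable fun q : Plane × (ℝ × ℝ) => Φ q.1 q.2.1 :=
        hΦm.comp (by fun_prop : Measurable fun q : Plane × (ℝ × ℝ) => (q.1, q.2.1))
      have m2 : Measurable fun q : Plane × (ℝ × ℝ) => Φ q.1 q.2.2 :=
        hΦm.comp (by fun_prop : Measurable fun q : Plane × (ℝ × ℝ) => (q.1, q.2.2))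
      have m3 : Measurable fun q : Plane × (ℝ × ℝ) => (starRingEnd ℂ) (Φ q.1 q.2.2) :=
        Complex.continuous_conj.measurable.comp m2
      have m4 : Measurable fun q : Plane × (ℝ × ℝ) => weight α ((s + s : ℝ) : ℂ) q.1 :=
        (measurable_weight _ _).comp measurable_fst
      exact (m4.mul (m1.mul m3)).aestronglyMeasurable
    · have h1 : ∀ᵐ k ∂(volume.restrict (freqBox n)), k ∈ freqBox n :=
        ae_restrict_mem (measurableSet_freqBox n)
      have h2 := (Measure.quasiMeasurePreserving_fst (μ := (volume : Measure Plane).restrict (freqBox n))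
        (ν := (volume : Measure ℝ).prod (volume : Measure ℝ))).ae h1
      filter_upwards [h2] with q hq
      rw [norm_mul, norm_mul, Complex.norm_conj]
      have h3 := hD _ hq
      exact mul_le_mul h3 (mul_le_mul (hΦn _ _) (hΦn _ _) (norm_nonneg _)
        ((norm_nonneg _).trans (hΦn q.1 _))) (by positivity) ((norm_nonneg _).trans h3)
  calc _ = ((∫ k in freqBox n, ‖weight α s k * ∫ t, Φ k t‖ ^ 2 : ℝ) : ℂ) := by rw [hΦ]
    _ = ∫ k in freqBox n, ∫ p : ℝ × ℝ, weight α ((s + s : ℝ) : ℂ) k *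
          (Φ k p.1 * (starRingEnd ℂ) (Φ k p.2)) := by
        rw [← integral_complex_ofReal]
        refine integral_congr_ae (Filter.Eventually.of_forall fun k => ?_)
        simp only
        rw [integral_const_mul, Measure.volume_eq_prod,
          integral_prod_mul (fun t => Φ k t) (fun t => (starRingEnd ℂ) (Φ k t)),
          integral_conj, Complex.ofReal_pow, ← Complex.mul_conj', map_mul, ← hw2]
        ring
    _ = ∫ p : ℝ × ℝ, ∫ k in freqBox n, weight α ((s + s : ℝ) : ℂ) k *
          (Φ k p.1 * (starRingEnd ℂ) (Φ k p.2)) := integral_integral_swap hint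
    _ = _ := by
        refine integral_congr_ae (Filter.Eventually.of_forall fun p => ?_)
        simp only [boxForm, hΦ, map_mul]
        congr 1
        funext k
        rw [← groupSymbol_mul_conj, ← conj_fourierInv]
        ring

lemma ae_fst_ne_snd : ∀ᵐ p : ℝ × ℝ, p.1 ≠ p.2 := by
  rw [Measure.volume_eq_prod, ae_iff]
  have hs : MeasurableSet {p : ℝ × ℝ | ¬p.1 ≠ p.2} := by
    simp only [not_not]
    exact measurableSet_eq_fun measurable_fst measurable_snd
  rw [Measure.measure_prod_null hs]
  refine Filter.Eventually.of_forall fun x => ?_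
  simp

/-- The mixed norm `L^r_x` of a slice of `G`. -/
def sliceNorm (r : ℝ) (G : ℝ × Plane → ℂ) (t : ℝ) : ℝ≥0∞ :=
  ENNReal.ofReal ((∫ x, ‖G (t, x)‖ ^ r) ^ (1 / r))

lemma measurable_sliceNorm {r : ℝ} {G : ℝ × Plane → ℂ} (hG : Measurable G) :
    Measurable (sliceNorm r G) := by
  have h1 : StronglyMeasurable fun t => ∫ x, ‖G (t, x)‖ ^ r :=
    StronglyMeasurable.integral_prod_right' (f := fun p : ℝ × Plane => ‖G p‖ ^ r)
      (hG.norm.pow_const r).stronglyMeasurable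
  exact (h1.measurable.pow_const _).ennreal_ofReal

/-- By the $TT^*$ identity the square is a double time integral of the bilinear form at time t - s.
Off the null diagonal the interpolated bound replaces it by $|t-s|^{-\theta}$ times two slice norms,
and Hardy–Littlewood–Sobolev concludes. The exponent 2/(1 + θ) will be p' and 2/(2 - θ) will be q'.
-/
lemma exists_ofReal_integral_norm_sq_le {α θ : ℝ} (hα0 : 0 < α) (hα1 : α ≤ 1) (hθ0 : 0 < θ)
    (hθ1 : θ < 1) :
    ∃ C : ℝ≥0, ∀ (n : ℕ) (G : ℝ × Plane → ℂ), Measurable G → Integrable G →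
      (∀ t, IsTame fun x => G (t, x)) →
      ENNReal.ofReal (∫ k in freqBox n, ‖weight α ((θ / 2 : ℝ) : ℂ) k *
          ∫ t, groupSymbol α t k * 𝓕⁻ (fun x => G (t, x)) k‖ ^ 2)
        ≤ C * (∫⁻ t, sliceNorm (2 / (1 + θ)) G t ^ (2 / (2 - θ))) ^ (2 - θ) := by
  obtain ⟨C₁, hC₁, hform⟩ := exists_norm_boxForm_le hα0 hα1 hθ0 hθ1
  obtain ⟨C₂, hHLS⟩ := exists_lintegral_lintegral_mul_abs_rpow_le hθ0 hθ1
  refine ⟨C₁.toNNReal * C₂, fun n G hGm hG htame => ?_⟩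
  have hTT := integral_norm_sq_eq_integral_boxForm (α := α) (s := θ / 2) (n := n) hGm hG
  rw [add_halves] at hTT
  set g := sliceNorm (2 / (1 + θ)) G with hg
  have hgm : Measurable g := measurable_sliceNorm hGm
  set I : ℝ := ∫ k in freqBox n, ‖weight α ((θ / 2 : ℝ) : ℂ) k *
    ∫ t, groupSymbol α t k * 𝓕⁻ (fun x => G (t, x)) k‖ ^ 2 with hI
  have hI0 : 0 ≤ I := by positivity
  have hpt : ∀ᵐ p : ℝ × ℝ, ‖boxForm α (p.1 - p.2) n (θ : ℂ)
      (fun x => (starRingEnd ℂ) (G (p.2, x))) (fun x => G (p.1, x))‖ₑ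
      ≤ ENNReal.ofReal C₁ * (g p.1 * g p.2 * ENNReal.ofReal (|p.1 - p.2| ^ (-θ))) := by
    filter_upwards [ae_fst_ne_snd] with p hp
    have h := hform n (p.1 - p.2) _ _ (sub_ne_zero.2 hp) (htame p.2).conj (htame p.1)
    simp only [Complex.norm_conj] at h
    rw [← ofReal_norm]
    refine (ENNReal.ofReal_le_ofReal h).trans (le_of_eq ?_)
    simp only [hg, sliceNorm]
    rw [← ENNReal.ofReal_mul (by positivity), ← ENNReal.ofReal_mul (by positivity),
      ← ENNReal.ofReal_mul hC₁, Real.mul_rpow (by positivity) (by positivity), one_div_div]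
    congr 1
    ring
  calc ENNReal.ofReal I = ‖(I : ℂ)‖ₑ := by
        rw [← ofReal_norm, Complex.norm_real, Real.norm_eq_abs, abs_of_nonneg hI0]
    _ ≤ ∫⁻ p : ℝ × ℝ, ENNReal.ofReal C₁ *
          (g p.1 * g p.2 * ENNReal.ofReal (|p.1 - p.2| ^ (-θ))) := by
        rw [hTT]
        exact (enorm_integral_le_lintegral_enorm _).trans (lintegral_mono_ae hpt)
    _ = ENNReal.ofReal C₁ * ∫⁻ t, ∫⁻ s, g t * g s * ENNReal.ofReal (|t - s| ^ (-θ)) := by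
        have hm : Measurable fun p : ℝ × ℝ =>
            g p.1 * g p.2 * ENNReal.ofReal (|p.1 - p.2| ^ (-θ)) := by fun_prop
        rw [lintegral_const_mul _ hm, Measure.volume_eq_prod, lintegral_prod _ hm.aemeasurable]
    _ ≤ ENNReal.ofReal C₁ * (C₂ * (∫⁻ t, g t ^ (2 / (2 - θ))) ^ (2 - θ)) := by
        gcongr
        exact hHLS g hgm
    _ = _ := by
        rw [← mul_assoc]
        push_cast
        rfl

/-- The dual form of the truncated Strichartz estimate. -/
lemma exists_enorm_integral_boxEvolution_mul_le {α θ : ℝ} (hα0 : 0 < α) (hα1 : α ≤ 1)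
    (hθ0 : 0 < θ) (hθ1 : θ < 1) :
    ∃ C : ℝ≥0, ∀ (n : ℕ) (h : Plane → ℂ) (G : ℝ × Plane → ℂ), MemLp h 2 → Measurable G →
      Integrable G → (∀ t, IsTame fun x => G (t, x)) →
      ‖∫ p : ℝ × Plane, boxEvolution α n ((θ / 2 : ℝ) : ℂ) h p.1 p.2 * G p‖ₑ
        ≤ C * eLpNorm h 2 volume *
          (∫⁻ t, sliceNorm (2 / (1 + θ)) G t ^ (2 / (2 - θ))) ^ ((2 - θ) / 2) := by
  obtain ⟨C, hC⟩ := exists_ofReal_integral_norm_sq_le hα0 hα1 hθ0 hθ1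
  refine ⟨C ^ (1 / 2 : ℝ), fun n h G hh hGm hG htame => ?_⟩
  have hfin : IsFiniteMeasure (volume.restrict (freqBox n)) :=
    ⟨by rw [Measure.restrict_apply_univ]; exact volume_freqBox_lt_top n⟩
  have hhr : MemLp h 2 (volume.restrict (freqBox n)) := hh.restrict _
  set W : Plane → ℂ := fun k => weight α ((θ / 2 : ℝ) : ℂ) k *
    ∫ t, groupSymbol α t k * 𝓕⁻ (fun x => G (t, x)) k with hW
  have hWm : AEStronglyMeasurable W (volume.restrict (freqBox n)) := by
    have h1 : StronglyMeasurable fun k : Plane =>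
        ∫ t, groupSymbol α t k * 𝓕⁻ (fun x => G (t, x)) k :=
      StronglyMeasurable.integral_prod_right'
        (f := fun p : Plane × ℝ => groupSymbol α p.2 p.1 * 𝓕⁻ (fun x => G (p.2, x)) p.1)
        ((((measurable_groupSymbol_uncurry α).comp measurable_swap).mul
          (stronglyMeasurable_fourierInv_slice hGm).measurable).stronglyMeasurable)
    exact ((measurable_weight α _).mul h1.measurable).aestronglyMeasurable
  obtain ⟨D, hD⟩ := exists_norm_weight_le α ((θ / 2 : ℝ) : ℂ) n
  have hWb : ∀ k ∈ freqBox n, ‖W k‖ ≤ D * ∫ t, ∫ x, ‖G (t, x)‖ := by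
    intro k hk
    rw [hW, norm_mul]
    refine mul_le_mul (hD k hk) ?_ (norm_nonneg _) ((norm_nonneg _).trans (hD k hk))
    refine norm_integral_le_of_norm_le hG.integral_norm_prod_left
      (Filter.Eventually.of_forall fun t => ?_)
    rw [norm_mul, norm_groupSymbol, one_mul]
    exact norm_fourierInv_le _ _
  have hWL : MemLp W 2 (volume.restrict (freqBox n)) :=
    MemLp.of_bound hWm _ ((ae_restrict_iff' (measurableSet_freqBox n)).2
      (Filter.Eventually.of_forall hWb))
  set A : ℝ := ∫ k in freqBox n, ‖h k‖ ^ 2 with hA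
  set B : ℝ := ∫ k in freqBox n, ‖W k‖ ^ 2 with hB
  have hA0 : 0 ≤ A := by positivity
  have hB0 : 0 ≤ B := by positivity
  have hAle : ENNReal.ofReal (√A) ≤ eLpNorm h 2 volume := by
    refine le_trans (le_of_eq ?_) (eLpNorm_mono_measure h
      (Measure.restrict_le_self (s := freqBox n)))
    rw [hhr.eLpNorm_eq_integral_rpow_norm (by norm_num) (by norm_num), Real.sqrt_eq_rpow]
    simp only [ENNReal.toReal_ofNat, Real.rpow_two, one_div, hA]
  have hBle : ENNReal.ofReal (√B) ≤ (C : ℝ≥0∞) ^ (1 / 2 : ℝ) *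
      (∫⁻ t, sliceNorm (2 / (1 + θ)) G t ^ (2 / (2 - θ))) ^ ((2 - θ) / 2) := by
    rw [Real.sqrt_eq_rpow, ← ENNReal.ofReal_rpow_of_nonneg hB0 (by norm_num)]
    refine (ENNReal.rpow_le_rpow (hC n G hGm hG htame) (by norm_num)).trans (le_of_eq ?_)
    rw [ENNReal.mul_rpow_of_nonneg _ _ (by norm_num), ← ENNReal.rpow_mul]
    congr 2
    ring
  rw [integral_boxEvolution_mul (hhr.integrable (by norm_num)) hG]
  calc ‖∫ k in freqBox n, h k * W k‖ₑ
      ≤ ENNReal.ofReal (√(A * B)) := by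
        rw [← ofReal_norm]
        refine ENNReal.ofReal_le_ofReal ((norm_integral_le_integral_norm _).trans ?_)
        simp only [norm_mul]
        exact integral_norm_mul_norm_le_sqrt hhr hWL
    _ = ENNReal.ofReal (√A) * ENNReal.ofReal (√B) := by
        rw [Real.sqrt_mul hA0, ENNReal.ofReal_mul (Real.sqrt_nonneg _)]
    _ ≤ eLpNorm h 2 volume * ((C : ℝ≥0∞) ^ (1 / 2 : ℝ) *
      (∫⁻ t, sliceNorm (2 / (1 + θ)) G t ^ (2 / (2 - θ))) ^ ((2 - θ) / 2)) := by gcongr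
    _ = _ := by
        rw [ENNReal.coe_rpow_of_nonneg _ (by norm_num)]
        ring

/-! ### From the dual estimate to the mixed norm -/

lemma IsTame.const_mul {f : Plane → ℂ} (hf : IsTame f) (c : ℂ) : IsTame fun x => c * f x := by
  obtain ⟨δ, M, hδ, hb⟩ := hf.bounds
  rcases eq_or_ne c 0 with rfl | hc
  · exact ⟨by simp, ⟨1, 1, one_pos, fun x hx => absurd (zero_mul _) hx⟩, by simp⟩
  · have hc0 : 0 < ‖c‖ := norm_pos_iff.2 hc
    refine ⟨hf.measurable.const_mul c, ⟨‖c‖ * δ, ‖c‖ * M, by positivity, fun x hx => ?_⟩,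
      (measure_mono fun x hx => right_ne_zero_of_mul hx).trans_lt hf.support⟩
    obtain ⟨h1, h2⟩ := hb x (right_ne_zero_of_mul hx)
    rw [norm_mul]
    exact ⟨by gcongr, by gcongr⟩

/-- The part of `v` where its modulus is at least `δ`. -/
def largePart (δ : ℝ) (v : ℝ × Plane → ℂ) : ℝ × Plane → ℂ := {p | δ ≤ ‖v p‖}.indicator v

lemma measurable_largePart {δ : ℝ} {v : ℝ × Plane → ℂ} (hv : Measurable v) :
    Measurable (largePart δ v) :=
  hv.indicator (measurableSet_le measurable_const hv.norm)

lemma norm_largePart_le (δ : ℝ) (v : ℝ × Plane → ℂ) (p : ℝ × Plane) :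
    ‖largePart δ v p‖ ≤ ‖v p‖ := norm_indicator_le_norm_self _ _

lemma largePart_of_ne_zero {δ : ℝ} {v : ℝ × Plane → ℂ} {a : ℝ × Plane}
    (ha : largePart δ v a ≠ 0) : δ ≤ ‖v a‖ ∧ largePart δ v a = v a := by
  have h : a ∈ {a | δ ≤ ‖v a‖} := Set.mem_of_indicator_ne_zero ha
  exact ⟨h, Set.indicator_of_mem h v⟩

/-- The cut-off at δ supplies the lower bound on the modulus, and Chebyshev in $L^2$ the finite
measure of the support. -/
lemma isTame_largePart {δ M : ℝ} (hδ : 0 < δ) {v : ℝ × Plane → ℂ} (hv : Measurable v)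
    (hM : ∀ p, ‖v p‖ ≤ M) (t : ℝ) (hL2 : MemLp (fun x => v (t, x)) 2) :
    IsTame fun x => largePart δ v (t, x) := by
  refine ⟨(measurable_largePart hv).comp measurable_prodMk_left, ⟨δ, M, hδ, fun x hx => ?_⟩, ?_⟩
  · obtain ⟨h, e⟩ := largePart_of_ne_zero hx
    rw [e]
    exact ⟨h, hM _⟩
  · refine (measure_mono (t := {x | ENNReal.ofReal δ ≤ ‖v (t, x)‖ₑ}) fun x hx => ?_).trans_lt
      (hL2.meas_ge_lt_top' (by norm_num) (by norm_num) (by simpa using hδ))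
    have h := (largePart_of_ne_zero hx).1
    change ENNReal.ofReal δ ≤ ‖v (t, x)‖ₑ
    rw [← ofReal_norm]
    exact ENNReal.ofReal_le_ofReal h

/-- The pairing of f with its extremiser for $L^p$ duality. -/
lemma mul_conj_tamePow {f : Plane → ℂ} {p : ℝ} (hp : p ≠ 0) (x : Plane) :
    f x * (starRingEnd ℂ) (tamePow f ((p - 1 : ℝ) : ℂ) x) = ((‖f x‖ ^ p : ℝ) : ℂ) := by
  by_cases h : f x = 0
  · rw [h, zero_mul, norm_zero, Real.zero_rpow hp, Complex.ofReal_zero]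
  · have h0 : 0 < ‖f x‖ := norm_pos_iff.2 h
    have h1 : (‖f x‖ : ℂ) ≠ 0 := by exact_mod_cast h0.ne'
    rw [tamePow, map_mul, map_div₀, Complex.conj_ofReal, ← Complex.exp_conj, map_mul,
      Complex.conj_ofReal, Complex.conj_ofReal, ← mul_assoc, ← mul_div_assoc, Complex.mul_conj',
      ← Complex.ofReal_mul, ← Complex.ofReal_exp, mul_comm (p - 1), ← Real.rpow_def_of_pos h0,
      Real.rpow_sub_one h0.ne']
    push_cast
    field_simp

lemma enorm_rpow_eq_ofReal {r : ℝ} (hr : 0 ≤ r) (z : ℂ) :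
    ‖z‖ₑ ^ r = ENNReal.ofReal (‖z‖ ^ r) := by
  rw [← ofReal_norm, ENNReal.ofReal_rpow_of_nonneg (norm_nonneg _) hr]

/-- From $|f|^p\le M^{p-2}|f|^2$. It provides the a priori finiteness without which the duality
argument could not divide. -/
lemma lintegral_enorm_rpow_le_of_norm_le {f : Plane → ℂ} {M p : ℝ} (hp : 2 ≤ p)
    (hM : ∀ x, ‖f x‖ ≤ M) :
    ∫⁻ x, ‖f x‖ₑ ^ p ≤ ENNReal.ofReal (M ^ (p - 2)) * eLpNorm f 2 volume ^ (2 : ℝ) := by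
  have hM0 : 0 ≤ M := (norm_nonneg _).trans (hM 0)
  have h1 : ∫⁻ x, ‖f x‖ₑ ^ (2 : ℝ) = eLpNorm f 2 volume ^ (2 : ℝ) := by
    rw [eLpNorm_eq_lintegral_rpow_enorm_toReal (by norm_num) (by norm_num), ← ENNReal.rpow_mul]
    simp
  calc ∫⁻ x, ‖f x‖ₑ ^ p ≤ ∫⁻ x, ENNReal.ofReal (M ^ (p - 2)) * ‖f x‖ₑ ^ (2 : ℝ) := by
        refine lintegral_mono fun x => ?_
        rw [enorm_rpow_eq_ofReal (by linarith), enorm_rpow_eq_ofReal zero_le_two,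
          ← ENNReal.ofReal_mul (by positivity)]
        refine ENNReal.ofReal_le_ofReal ?_
        have e : ‖f x‖ ^ p = ‖f x‖ ^ (p - 2) * ‖f x‖ ^ (2 : ℝ) := by
          rw [← Real.rpow_add_of_nonneg (norm_nonneg _) (by linarith) zero_le_two, sub_add_cancel]
        rw [e]
        have := Real.rpow_le_rpow (norm_nonneg _) (hM x) (by linarith : 0 ≤ p - 2)
        gcongr
    _ = ENNReal.ofReal (M ^ (p - 2)) * ∫⁻ x, ‖f x‖ₑ ^ (2 : ℝ) :=
        lintegral_const_mul' _ _ ENNReal.ofReal_ne_top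
    _ = _ := by rw [h1]

/-- The dual bound tested against the truncated extremiser. -/
lemma lintegral_largePart_le_of_dual {p q M : ℝ} (hp : 2 < p) (hq : 2 < q) {v : ℝ × Plane → ℂ}
    (hv : Measurable v) (hM : ∀ a, ‖v a‖ ≤ M) {S : ℝ≥0∞} (hS : S ≠ ∞)
    (hL2 : ∀ t, eLpNorm (fun x => v (t, x)) 2 volume ≤ S) {K : ℝ≥0∞}
    (hdual : ∀ G : ℝ × Plane → ℂ, Measurable G → Integrable G → (∀ t, IsTame fun x => G (t, x)) →
      ‖∫ a, v a * G a‖ₑ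
        ≤ K * (∫⁻ t, sliceNorm (p / (p - 1)) G t ^ (q / (q - 1))) ^ ((q - 1) / q))
    {δ : ℝ} (hδ : 0 < δ) (T : ℝ) :
    ∫⁻ t in Set.Icc (-T) T, (∫⁻ x, ‖largePart δ v (t, x)‖ₑ ^ p) ^ (q / p) ≤ K ^ q := by
  have hp0 : 0 < p := by linarith
  have hq0 : 0 < q := by linarith
  have hp1 : 0 < p - 1 := by linarith
  have hq1 : 0 < q - 1 := by linarith
  have hM0 : 0 ≤ M := (norm_nonneg _).trans (hM (0, 0))
  have hvt : ∀ t, Measurable fun x => v (t, x) := fun t => hv.comp measurable_prodMk_left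
  have hmem : ∀ t, MemLp (fun x => v (t, x)) 2 := fun t =>
    ⟨(hvt t).aestronglyMeasurable, (hL2 t).trans_lt hS.lt_top⟩
  set w := largePart δ v with hw
  have hwm : Measurable w := measurable_largePart hv
  have hwt : ∀ t, IsTame fun x => w (t, x) := fun t => isTame_largePart hδ hv hM t (hmem t)
  have hwM : ∀ a, ‖w a‖ ≤ M := fun a => (norm_largePart_le δ v a).trans (hM a)
  have hwL2 : ∀ t, eLpNorm (fun x => w (t, x)) 2 volume ≤ S := fun t =>
    (eLpNorm_mono fun x => norm_largePart_le δ v (t, x)).trans (hL2 t)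
  set V : ℝ → ℝ := fun t => ∫ x, ‖w (t, x)‖ ^ p with hV
  have hV0 : ∀ t, 0 ≤ V t := fun t => integral_nonneg fun x => by positivity
  have hVm : Measurable V :=
    (StronglyMeasurable.integral_prod_right' (f := fun a : ℝ × Plane => ‖w a‖ ^ p)
      (hwm.norm.pow_const p).stronglyMeasurable).measurable
  have hVof : ∀ t, ∫⁻ x, ‖w (t, x)‖ₑ ^ p = ENNReal.ofReal (V t) := by
    intro t
    rw [hV, ofReal_integral_eq_lintegral_ofReal ((hwt t).integrable_norm_rpow hp0.ne')
      (Filter.Eventually.of_forall fun x => by positivity)]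
    simp only [enorm_rpow_eq_ofReal hp0.le]
  obtain ⟨V₁, hV₁⟩ : ∃ V₁ : ℝ, ∀ t, V t ≤ V₁ := by
    refine ⟨(ENNReal.ofReal (M ^ (p - 2)) * S ^ (2 : ℝ)).toReal, fun t => ?_⟩
    rw [← ENNReal.ofReal_le_iff_le_toReal (ENNReal.mul_ne_top ENNReal.ofReal_ne_top
      (ENNReal.rpow_ne_top_of_nonneg (by norm_num) hS)), ← hVof]
    refine (lintegral_enorm_rpow_le_of_norm_le hp.le fun x => hwM (t, x)).trans ?_
    gcongr
    exact hwL2 t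
  have hV₁0 : 0 ≤ V₁ := (hV0 0).trans (hV₁ 0)
  -- With $V(t)=\|w(t)\|_p^p$, the function $V^{(q-p)/p}\,\overline{\mathrm{sgn}(w)}\,|w|^{p-1}$ is
  -- extremal for w in $L^q_tL^p_x$, since its product with w integrates in x to $V^{q/p}$. The
  -- exponent e may be negative; the identities used also hold where V = 0.
  set e : ℝ := (q - p) / p with he
  have he1 : 1 + e = q / p := by rw [he]; field_simp; ring
  set I : Set ℝ := Set.Icc (-T) T with hI
  set c : ℝ → ℝ := I.indicator fun t => V t ^ e with hc
  have hcm : Measurable c := (hVm.pow_const e).indicator measurableSet_Icc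
  have hc0 : ∀ t, 0 ≤ c t := fun t =>
    Set.indicator_nonneg (fun t _ => Real.rpow_nonneg (hV0 t) _) t
  have hcV : ∀ t, c t * V t = I.indicator (fun t => V t ^ (q / p)) t := by
    intro t
    by_cases ht : t ∈ I
    · simp only [hc]
      rw [Set.indicator_of_mem ht, Set.indicator_of_mem ht, ← he1, mul_comm,
        Real.rpow_one_add' (hV0 t) (by rw [he1]; positivity)]
    · simp only [hc]
      rw [Set.indicator_of_notMem ht, Set.indicator_of_notMem ht, zero_mul]
  set G : ℝ × Plane → ℂ := fun a => (c a.1 : ℂ) *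
    (starRingEnd ℂ) (tamePow (fun x => w (a.1, x)) ((p - 1 : ℝ) : ℂ) a.2) with hG
  have hGt : ∀ t, IsTame fun x => G (t, x) := fun t =>
    (((hwt t).tamePow ((p - 1 : ℝ) : ℂ)).conj).const_mul (c t : ℂ)
  have hGm : Measurable G := by
    have h1 : Measurable fun a : ℝ × Plane =>
        tamePow (fun x => w (a.1, x)) ((p - 1 : ℝ) : ℂ) a.2 := by
      simp only [tamePow]
      fun_prop
    exact (Complex.measurable_ofReal.comp (hcm.comp measurable_fst)).mul
      (Complex.continuous_conj.measurable.comp h1)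
  have hGn : ∀ t x, ‖G (t, x)‖ = c t * ‖w (t, x)‖ ^ (p - 1) := by
    intro t x
    rw [hG, norm_mul, Complex.norm_real, Real.norm_eq_abs, abs_of_nonneg (hc0 t),
      Complex.norm_conj, norm_tamePow (by simpa using hp1.ne'), Complex.ofReal_re]
  -- Since |w| ≥ δ wherever w ≠ 0, one has $|w|^{p-1}\le|w|^p/\delta$: this makes the test function
  -- integrable.
  have hG1 : ∀ t, ∫ x, ‖G (t, x)‖ ≤ I.indicator (fun _ => V₁ ^ (q / p) / δ) t := by
    intro t
    have h1 : ∀ x, ‖G (t, x)‖ ≤ c t * (‖w (t, x)‖ ^ p / δ) := by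
      intro x
      rw [hGn]
      refine mul_le_mul_of_nonneg_left ?_ (hc0 t)
      by_cases hx : w (t, x) = 0
      · rw [hx, norm_zero, Real.zero_rpow hp1.ne', Real.zero_rpow hp0.ne', zero_div]
      · obtain ⟨h2, h3⟩ := largePart_of_ne_zero hx
        rw [← hw] at h3
        have h4 : 0 < ‖w (t, x)‖ := norm_pos_iff.2 hx
        rw [le_div_iff₀ hδ]
        calc ‖w (t, x)‖ ^ (p - 1) * δ ≤ ‖w (t, x)‖ ^ (p - 1) * ‖w (t, x)‖ := by
              rw [h3]; gcongr
          _ = ‖w (t, x)‖ ^ p := by rw [← Real.rpow_add_one h4.ne', sub_add_cancel]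
    calc ∫ x, ‖G (t, x)‖ ≤ ∫ x, c t * (‖w (t, x)‖ ^ p / δ) :=
          integral_mono (hGt t).integrable.norm
            ((((hwt t).integrable_norm_rpow hp0.ne').div_const δ).const_mul _) h1
      _ = c t * V t / δ := by rw [integral_const_mul, integral_div, mul_div_assoc]
      _ ≤ _ := by
          rw [hcV]
          by_cases ht : t ∈ I
          · rw [Set.indicator_of_mem ht, Set.indicator_of_mem ht]
            have := Real.rpow_le_rpow (hV0 t) (hV₁ t) (by positivity : 0 ≤ q / p)
            gcongr
          · rw [Set.indicator_of_notMem ht, Set.indicator_of_notMem ht, zero_div]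
  have hGi : Integrable G := by
    rw [Measure.volume_eq_prod, integrable_prod_iff hGm.aestronglyMeasurable]
    refine ⟨Filter.Eventually.of_forall fun t => (hGt t).integrable, ?_⟩
    have hdom : Integrable (I.indicator fun _ => V₁ ^ (q / p) / δ) :=
      (integrable_indicator_iff measurableSet_Icc).2
        (integrableOn_const (by rw [Real.volume_Icc]; exact ENNReal.ofReal_ne_top))
    refine hdom.mono' ?_ (Filter.Eventually.of_forall fun t => ?_)
    · exact (StronglyMeasurable.integral_prod_right' (f := fun a : ℝ × Plane => ‖G a‖)
        hGm.norm.stronglyMeasurable).aestronglyMeasurable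
    · rw [Real.norm_eq_abs, abs_of_nonneg (integral_nonneg fun x => norm_nonneg _)]
      exact hG1 t
  have hvG : ∀ t x, v (t, x) * G (t, x) = ((c t * ‖w (t, x)‖ ^ p : ℝ) : ℂ) := by
    intro t x
    have h1 := mul_conj_tamePow (f := fun x => w (t, x)) hp0.ne' x
    have h2 : v (t, x) * (starRingEnd ℂ) (tamePow (fun x => w (t, x)) ((p - 1 : ℝ) : ℂ) x)
        = w (t, x) * (starRingEnd ℂ) (tamePow (fun x => w (t, x)) ((p - 1 : ℝ) : ℂ) x) := by
      by_cases hx : w (t, x) = 0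
      · rw [tamePow_of_eq_zero _ hx, map_zero, mul_zero, mul_zero]
      · rw [hw, (largePart_of_ne_zero hx).2]
    rw [hG]
    simp only
    rw [mul_left_comm, h2, h1, Complex.ofReal_mul]
  set J : ℝ := ∫ t, I.indicator (fun t => V t ^ (q / p)) t with hJ
  have hJ0 : 0 ≤ J := integral_nonneg fun t =>
    Set.indicator_nonneg (fun t _ => Real.rpow_nonneg (hV0 t) _) t
  have hJi : Integrable (I.indicator fun t => V t ^ (q / p)) := by
    rw [integrable_indicator_iff measurableSet_Icc]
    refine Measure.integrableOn_of_bounded (M := V₁ ^ (q / p))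
      (by rw [Real.volume_Icc]; exact ENNReal.ofReal_ne_top)
      (hVm.pow_const _).aestronglyMeasurable (Filter.Eventually.of_forall fun t => ?_)
    rw [Real.norm_eq_abs, abs_of_nonneg (Real.rpow_nonneg (hV0 t) _)]
    exact Real.rpow_le_rpow (hV0 t) (hV₁ t) (by positivity)
  have hpair : ∫ a, v a * G a = (J : ℂ) := by
    have hvGi : Integrable fun a => v a * G a :=
      hGi.bdd_mul hv.aestronglyMeasurable (Filter.Eventually.of_forall hM)
    rw [Measure.volume_eq_prod] at hvGi ⊢
    rw [integral_prod _ hvGi, hJ, ← integral_complex_ofReal]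
    refine integral_congr_ae (Filter.Eventually.of_forall fun t => ?_)
    simp only [hvG]
    rw [integral_complex_ofReal, integral_const_mul, ← hcV]
  have hJof : ∫⁻ t in I, (∫⁻ x, ‖w (t, x)‖ₑ ^ p) ^ (q / p) = ENNReal.ofReal J := by
    rw [hJ, ofReal_integral_eq_lintegral_ofReal hJi (Filter.Eventually.of_forall fun t =>
      Set.indicator_nonneg (fun t _ => Real.rpow_nonneg (hV0 t) _) t),
      ← lintegral_indicator measurableSet_Icc]
    refine lintegral_congr fun t => ?_
    by_cases ht : t ∈ I
    · rw [Set.indicator_of_mem ht, Set.indicator_of_mem ht, hVof,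
        ENNReal.ofReal_rpow_of_nonneg (hV0 t) (by positivity)]
    · rw [Set.indicator_of_notMem ht, Set.indicator_of_notMem ht, ENNReal.ofReal_zero]
  -- Extremality in the dual norm: $\|G(t)\|_{p'}^{q'}=V(t)^{q/p}$ on the time window, so both sides
  -- of the dual bound are expressed through J.
  have hslice : ∀ t, sliceNorm (p / (p - 1)) G t ^ (q / (q - 1))
      = ENNReal.ofReal (I.indicator (fun t => V t ^ (q / p)) t) := by
    intro t
    have h1 : ∫ x, ‖G (t, x)‖ ^ (p / (p - 1)) = c t ^ (p / (p - 1)) * V t := by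
      rw [hV, ← integral_const_mul]
      refine integral_congr_ae (Filter.Eventually.of_forall fun x => ?_)
      simp only
      rw [hGn, Real.mul_rpow (hc0 t) (by positivity), ← Real.rpow_mul (norm_nonneg _),
        mul_div_cancel₀ _ hp1.ne']
    have h2 : (c t ^ (p / (p - 1)) * V t) ^ (1 / (p / (p - 1)))
        = I.indicator (fun t => V t ^ ((q - 1) / p)) t := by
      by_cases ht : t ∈ I
      · simp only [hc]
        rw [Set.indicator_of_mem ht, Set.indicator_of_mem ht]
        have hexp : e * (p / (p - 1)) + 1 = (q - 1) / (p - 1) := by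
          rw [he]; field_simp; ring
        have h3 : (V t ^ e) ^ (p / (p - 1)) * V t = V t ^ ((q - 1) / (p - 1)) := by
          rw [← Real.rpow_mul (hV0 t), ← Real.rpow_add_one' (hV0 t)
            (by rw [hexp]; positivity), hexp]
        rw [h3, ← Real.rpow_mul (hV0 t)]
        congr 1
        field_simp
      · simp only [hc]
        rw [Set.indicator_of_notMem ht, Set.indicator_of_notMem ht,
          Real.zero_rpow (by positivity), zero_mul, Real.zero_rpow (by positivity)]
    rw [sliceNorm, h1, h2, ENNReal.ofReal_rpow_of_nonneg
      (Set.indicator_nonneg (fun t _ => Real.rpow_nonneg (hV0 t) _) t) (by positivity)]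
    congr 1
    by_cases ht : t ∈ I
    · rw [Set.indicator_of_mem ht, Set.indicator_of_mem ht, ← Real.rpow_mul (hV0 t)]
      congr 1
      field_simp
    · rw [Set.indicator_of_notMem ht, Set.indicator_of_notMem ht, Real.zero_rpow (by positivity)]
  have hmain := hdual G hGm hGi hGt
  rw [hpair] at hmain
  simp only [hslice] at hmain
  rw [← ofReal_integral_eq_lintegral_ofReal hJi (Filter.Eventually.of_forall fun t =>
      Set.indicator_nonneg (fun t _ => Real.rpow_nonneg (hV0 t) _) t), ← hJ,
    ← ofReal_norm, Complex.norm_real, Real.norm_eq_abs, abs_of_nonneg hJ0] at hmain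
  rw [hJof]
  rcases hJ0.eq_or_lt with h | h
  · rw [← h, ENNReal.ofReal_zero]; exact zero_le
  set j := ENNReal.ofReal J with hj
  have hj0 : j ≠ 0 := by simpa [hj] using h
  have hjt : j ≠ ∞ := ENNReal.ofReal_ne_top
  -- The dual bound reads $J\le KJ^{1-1/q}$; as J is finite and nonzero, the power can be cancelled.
  have hsplit : j ^ (1 / q) * j ^ ((q - 1) / q) = j := by
    rw [← ENNReal.rpow_add _ _ hj0 hjt, show 1 / q + (q - 1) / q = 1 by field_simp; ring,
      ENNReal.rpow_one]
  have h1 : j ^ (1 / q) ≤ K := by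
    have h2 : j ^ ((q - 1) / q) ≠ 0 := (ENNReal.rpow_pos (pos_iff_ne_zero.2 hj0) hjt).ne'
    have h3 : j ^ ((q - 1) / q) ≠ ∞ := ENNReal.rpow_ne_top_of_nonneg (by positivity) hjt
    have h4 : j ^ (1 / q) * j ^ ((q - 1) / q) ≤ K * j ^ ((q - 1) / q) := by rwa [hsplit]
    exact (ENNReal.mul_le_mul_iff_left h2 h3).1 h4
  calc j = (j ^ (1 / q)) ^ q := by
        rw [← ENNReal.rpow_mul, one_div_mul_cancel hq0.ne', ENNReal.rpow_one]
    _ ≤ K ^ q := ENNReal.rpow_le_rpow h1 hq0.le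

lemma largePart_apply_of_le {δ : ℝ} {v : ℝ × Plane → ℂ} {a : ℝ × Plane} (h : δ ≤ ‖v a‖) :
    largePart δ v a = v a :=
  Set.indicator_of_mem (s := {a | δ ≤ ‖v a‖}) (show a ∈ {a | δ ≤ ‖v a‖} from h) v

/-- The mixed-norm bound obtained from the dual bound by duality. -/
lemma lintegral_rpow_le_of_dual {p q M : ℝ} (hp : 2 < p) (hq : 2 < q) {v : ℝ × Plane → ℂ}
    (hv : Measurable v) (hM : ∀ a, ‖v a‖ ≤ M) {S : ℝ≥0∞} (hS : S ≠ ∞)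
    (hL2 : ∀ t, eLpNorm (fun x => v (t, x)) 2 volume ≤ S) {K : ℝ≥0∞}
    (hdual : ∀ G : ℝ × Plane → ℂ, Measurable G → Integrable G → (∀ t, IsTame fun x => G (t, x)) →
      ‖∫ a, v a * G a‖ₑ
        ≤ K * (∫⁻ t, sliceNorm (p / (p - 1)) G t ^ (q / (q - 1))) ^ ((q - 1) / q)) :
    ∫⁻ t, (∫⁻ x, ‖v (t, x)‖ₑ ^ p) ^ (q / p) ≤ K ^ q := by
  have hp0 : 0 < p := by linarith
  have hqp : 0 < q / p := div_pos (by linarith) hp0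
  -- The threshold 1/(m + 1) decreases to 0 while the window [-m, m] grows. Monotone convergence
  -- handles x and Fatou's lemma handles t, the bound being the same for all m.
  set w : ℕ → ℝ × Plane → ℂ := fun m => largePart (1 / ((m : ℝ) + 1)) v with hw
  have hwm : ∀ m, Measurable (w m) := fun m => measurable_largePart hv
  have hinner : ∀ t, Filter.Tendsto (fun m => ∫⁻ x, ‖w m (t, x)‖ₑ ^ p) Filter.atTop
      (nhds (∫⁻ x, ‖v (t, x)‖ₑ ^ p)) := by
    intro t
    refine lintegral_tendsto_of_tendsto_of_monotone
      (fun m => (((hwm m).comp measurable_prodMk_left).enorm.pow_const p).aemeasurable)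
      (Filter.Eventually.of_forall fun x => ?_) (Filter.Eventually.of_forall fun x => ?_)
    · intro m m' hmm
      simp only
      by_cases h : w m (t, x) = 0
      · rw [h, enorm_zero, ENNReal.zero_rpow_of_pos hp0]; exact zero_le
      · obtain ⟨h1, h2⟩ := largePart_of_ne_zero h
        have h3 : w m' (t, x) = v (t, x) :=
          largePart_apply_of_le ((Nat.one_div_le_one_div hmm).trans h1)
        rw [h3, ← h2]
    · by_cases h : v (t, x) = 0
      · have : ∀ m, w m (t, x) = v (t, x) := by
          intro m
          by_contra h1
          have h2 : w m (t, x) = 0 := by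
            by_contra h3; exact h1 (largePart_of_ne_zero h3).2
          exact h1 (h2.trans h.symm)
        simp only [this]
        exact tendsto_const_nhds
      · obtain ⟨N, hN⟩ := exists_nat_one_div_lt (norm_pos_iff.2 h)
        refine tendsto_const_nhds.congr' ?_
        filter_upwards [Filter.eventually_ge_atTop N] with m hm
        rw [show w m (t, x) = v (t, x) from
          largePart_apply_of_le ((Nat.one_div_le_one_div hm).trans hN.le)]
  set F : ℕ → ℝ → ℝ≥0∞ := fun m => (Set.Icc (-(m : ℝ)) m).indicator
    fun t => (∫⁻ x, ‖w m (t, x)‖ₑ ^ p) ^ (q / p) with hF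
  have hFm : ∀ m, Measurable (F m) := fun m =>
    Measurable.indicator (((((hwm m).enorm.pow_const p)).lintegral_prod_right').pow_const _)
      measurableSet_Icc
  have hlim : ∀ t, Filter.Tendsto (fun m => F m t) Filter.atTop
      (nhds ((∫⁻ x, ‖v (t, x)‖ₑ ^ p) ^ (q / p))) := by
    intro t
    refine ((ENNReal.continuous_rpow_const.tendsto _).comp (hinner t)).congr' ?_
    obtain ⟨N, hN⟩ := exists_nat_ge |t|
    filter_upwards [Filter.eventually_ge_atTop N] with m hm
    have : t ∈ Set.Icc (-(m : ℝ)) m := by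
      have h1 : |t| ≤ m := hN.trans (by exact_mod_cast hm)
      exact abs_le.1 h1
    simp only [hF, Function.comp]
    rw [Set.indicator_of_mem this]
  calc ∫⁻ t, (∫⁻ x, ‖v (t, x)‖ₑ ^ p) ^ (q / p)
      = ∫⁻ t, Filter.liminf (fun m => F m t) Filter.atTop := by
        refine lintegral_congr fun t => ((hlim t).liminf_eq).symm
    _ ≤ Filter.liminf (fun m => ∫⁻ t, F m t) Filter.atTop := lintegral_liminf_le hFm
    _ ≤ K ^ q := by
        refine Filter.liminf_le_of_frequently_le' (Filter.Frequently.of_forall fun m => ?_)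
        simp only [hF]
        rw [lintegral_indicator measurableSet_Icc]
        exact lintegral_largePart_le_of_dual hp hq hv hM hS hL2 hdual Nat.one_div_pos_of_nat m

/-! ### The truncated evolution -/

lemma measurable_boxEvolution {α : ℝ} {n : ℕ} {z : ℂ} {h : Plane → ℂ} (hh : Measurable h) :
    Measurable fun a : ℝ × Plane => boxEvolution α n z h a.1 a.2 := by
  refine (StronglyMeasurable.integral_prod_right' (ν := volume.restrict (freqBox n))
    (f := fun b : (ℝ × Plane) × Plane =>
      planeWave (-b.1.2) b.2 * (weight α z b.2 * groupSymbol α b.1.1 b.2 * h b.2)) ?_).measurable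
  have h1 : Measurable fun b : (ℝ × Plane) × Plane => planeWave (-b.1.2) b.2 := by
    unfold planeWave; fun_prop
  have h2 : Measurable fun b : (ℝ × Plane) × Plane => groupSymbol α b.1.1 b.2 :=
    (measurable_groupSymbol_uncurry α).comp
      (by fun_prop : Measurable fun b : (ℝ × Plane) × Plane => (b.1.1, b.2))
  have h3 : Measurable fun b : (ℝ × Plane) × Plane => weight α z b.2 :=
    (measurable_weight α z).comp measurable_snd
  exact (h1.mul ((h3.mul h2).mul (hh.comp measurable_snd))).stronglyMeasurable

/-- The frequency profile of the truncated evolution. -/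
def boxProfile (α : ℝ) (n : ℕ) (z : ℂ) (h : Plane → ℂ) (t : ℝ) : Plane → ℂ :=
  (freqBox n).indicator fun k => weight α z k * groupSymbol α t k * h k

lemma boxEvolution_eq_fourierInv (α : ℝ) (n : ℕ) (z : ℂ) (h : Plane → ℂ) (t : ℝ) :
    boxEvolution α n z h t = 𝓕⁻ (boxProfile α n z h t) := by
  funext x
  rw [fourierInv_eq_integral_planeWave, boxEvolution, ← integral_indicator (measurableSet_freqBox n)]
  congr 1
  funext k
  rw [boxProfile, ← Set.indicator_mul_right]

lemma norm_boxProfile_le {α : ℝ} {n : ℕ} {z : ℂ} {D : ℝ} (hD : ∀ k ∈ freqBox n, ‖weight α z k‖ ≤ D)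
    (hD0 : 0 ≤ D) (h : Plane → ℂ) (t : ℝ) (k : Plane) :
    ‖boxProfile α n z h t k‖ ≤ D * ‖h k‖ := by
  rw [boxProfile]
  by_cases hk : k ∈ freqBox n
  · rw [Set.indicator_of_mem hk, norm_mul, norm_mul, norm_groupSymbol, mul_one]
    exact mul_le_mul_of_nonneg_right (hD k hk) (norm_nonneg _)
  · rw [Set.indicator_of_notMem hk, norm_zero]
    positivity

lemma exists_nonneg_norm_weight_le (α : ℝ) (z : ℂ) (n : ℕ) :
    ∃ D : ℝ, 0 ≤ D ∧ ∀ k ∈ freqBox n, ‖weight α z k‖ ≤ D := by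
  obtain ⟨D, hD⟩ := exists_norm_weight_le α z n
  exact ⟨max D 0, le_max_right _ _, fun k hk => (hD k hk).trans (le_max_left _ _)⟩

section

variable {α : ℝ} {n : ℕ} {z : ℂ} {h : Plane → ℂ}

lemma measurable_boxProfile (hh : Measurable h) (t : ℝ) : Measurable (boxProfile α n z h t) :=
  (((measurable_weight α z).mul (measurable_groupSymbol α t)).mul hh).indicator
    (measurableSet_freqBox n)

lemma memLp_boxProfile (hh : Measurable h) (hh2 : MemLp h 2) (t : ℝ) :
    MemLp (boxProfile α n z h t) 2 := by
  obtain ⟨D, hD0, hD⟩ := exists_nonneg_norm_weight_le α z n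
  exact hh2.of_le_mul (measurable_boxProfile hh t).aestronglyMeasurable
    (Filter.Eventually.of_forall fun k => norm_boxProfile_le hD hD0 h t k)

lemma integrable_boxProfile (hh : Measurable h) (hh2 : MemLp h 2) (t : ℝ) :
    Integrable (boxProfile α n z h t) := by
  have hfin : IsFiniteMeasure (volume.restrict (freqBox n)) :=
    ⟨by rw [Measure.restrict_apply_univ]; exact volume_freqBox_lt_top n⟩
  have h1 : IntegrableOn (boxProfile α n z h t) (freqBox n) :=
    ((memLp_boxProfile hh hh2 t).restrict (freqBox n)).integrable (by norm_num)
  rw [← integrable_indicator_iff (measurableSet_freqBox n)] at h1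
  rwa [boxProfile, Set.indicator_indicator, Set.inter_self] at h1

lemma eLpNorm_boxEvolution_two (hh : Measurable h) (hh2 : MemLp h 2) (t : ℝ) :
    eLpNorm (boxEvolution α n z h t) 2 volume = eLpNorm (boxProfile α n z h t) 2 volume := by
  rw [boxEvolution_eq_fourierInv]
  exact eLpNorm_fourierInv_eq (integrable_boxProfile hh hh2 t) (memLp_boxProfile hh hh2 t)

lemma exists_eLpNorm_boxEvolution_two_le (hh : Measurable h) (hh2 : MemLp h 2) :
    ∃ S : ℝ≥0∞, S ≠ ∞ ∧ ∀ t, eLpNorm (boxEvolution α n z h t) 2 volume ≤ S := by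
  obtain ⟨D, hD0, hD⟩ := exists_nonneg_norm_weight_le α z n
  refine ⟨ENNReal.ofReal D * eLpNorm h 2 volume,
    ENNReal.mul_ne_top ENNReal.ofReal_ne_top hh2.2.ne, fun t => ?_⟩
  rw [eLpNorm_boxEvolution_two hh hh2]
  exact eLpNorm_le_mul_eLpNorm_of_ae_le_mul
    (Filter.Eventually.of_forall fun k => norm_boxProfile_le hD hD0 h t k) 2

lemma exists_norm_boxEvolution_le :
    ∃ M : ℝ, ∀ t x, ‖boxEvolution α n z h t x‖ ≤ M := by
  refine ⟨∫ k in freqBox n, ‖weight α z k * h k‖, fun t x => ?_⟩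
  refine (norm_integral_le_integral_norm _).trans (le_of_eq ?_)
  congr 1
  funext k
  rw [norm_mul, norm_planeWave, one_mul, norm_mul, norm_mul, norm_groupSymbol, mul_one, norm_mul]

lemma memLp_boxEvolution (hh : Measurable h) (hh2 : MemLp h 2) (t : ℝ) {p : ℝ≥0∞} (hp : 2 ≤ p)
    (hpt : p ≠ ∞) : MemLp (boxEvolution α n z h t) p := by
  obtain ⟨M, hM⟩ := exists_norm_boxEvolution_le (α := α) (n := n) (z := z) (h := h)
  obtain ⟨S, hS, hS2⟩ := exists_eLpNorm_boxEvolution_two_le (α := α) (n := n) (z := z) hh hh2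
  have hp0 : p ≠ 0 := (lt_of_lt_of_le (by norm_num) hp).ne'
  have h2 : (2 : ℝ) ≤ p.toReal := by
    simpa using ENNReal.toReal_mono hpt hp
  refine ⟨((measurable_boxEvolution hh).comp measurable_prodMk_left).aestronglyMeasurable, ?_⟩
  rw [eLpNorm_lt_top_iff_lintegral_rpow_enorm_lt_top hp0 hpt]
  refine (lintegral_enorm_rpow_le_of_norm_le h2 (hM t)).trans_lt ?_
  exact ENNReal.mul_lt_top ENNReal.ofReal_lt_top
    (ENNReal.rpow_lt_top_of_nonneg (by norm_num) ((hS2 t).trans_lt hS.lt_top).ne)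

end

/-- The Strichartz estimate for the truncated evolution, uniformly in the truncation. -/
lemma exists_eLpNorm_boxEvolution_le {α : ℝ} (hα0 : 0 < α) (hα1 : α ≤ 1) {q p : ℝ≥0∞}
    (hqp : IsAdmissible q p) :
    ∃ C : ℝ≥0, ∀ (n : ℕ) (h : Plane → ℂ), Measurable h → MemLp h 2 →
      eLpNorm (fun t => eLpNorm (boxEvolution α n ((q⁻¹).toReal : ℂ) h t) p volume) q volume
        ≤ C * eLpNorm h 2 volume := by
  rcases eq_or_ne q ∞ with rfl | hq
  · have hp2 : p = 2 := by
      have := hqp.add_eq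
      rw [ENNReal.inv_top, zero_add] at this
      exact inv_injective this
    subst hp2
    refine ⟨1, fun n h hh hh2 => ?_⟩
    rw [ENNReal.coe_one, one_mul, eLpNorm_exponent_top]
    refine eLpNormEssSup_le_of_ae_enorm_bound (Filter.Eventually.of_forall fun t => ?_)
    rw [enorm_eq_self, eLpNorm_boxEvolution_two hh hh2]
    refine eLpNorm_mono fun k => ?_
    refine (norm_boxProfile_le (D := 1) (fun k _ => ?_) zero_le_one h t k).trans
      (one_mul _).le
    rw [norm_weight]
    simp
  · have hq0 : q ≠ 0 := (lt_trans (by norm_num) hqp.two_lt).ne'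
    have hp0 : p ≠ 0 := (lt_of_lt_of_le (by norm_num) hqp.two_le).ne'
    have hqr : 2 < q.toReal := by
      simpa using (ENNReal.toReal_lt_toReal (by norm_num) hq).2 hqp.two_lt
    have hqr0 : 0 < q.toReal := by linarith
    have hpt : p ≠ ∞ := by
      rintro rfl
      have := hqp.add_eq
      rw [ENNReal.inv_top, add_zero] at this
      exact hqp.two_lt.ne' (inv_injective this)
    have hadd : q.toReal⁻¹ + p.toReal⁻¹ = 2⁻¹ := by
      have := congrArg ENNReal.toReal hqp.add_eq
      rwa [ENNReal.toReal_add (ENNReal.inv_ne_top.2 hq0) (ENNReal.inv_ne_top.2 hp0),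
        ENNReal.toReal_inv, ENNReal.toReal_inv, ENNReal.toReal_inv] at this
    set Q := q.toReal with hQ
    set P := p.toReal with hP
    have hP0 : 0 < P := ENNReal.toReal_pos hp0 hpt
    have hQinv : Q⁻¹ < 2⁻¹ := inv_strictAnti₀ two_pos hqr
    have hQinv0 : 0 < Q⁻¹ := inv_pos.2 hqr0
    have hPr : 2 < P := by
      have : P⁻¹ < 2⁻¹ := by linarith
      exact (inv_lt_inv₀ hP0 two_pos).1 this
    -- This choice makes 2/(1 + θ) = p', 2/(2 - θ) = q' and θ/2 = 1/q, so the dual estimate is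
    -- exactly the one required. The condition q > 2 gives θ < 1.
    set θ : ℝ := 2 / Q with hθ
    have hθ0 : 0 < θ := by positivity
    have hθ1 : θ < 1 := by rw [hθ, div_lt_one hqr0]; exact hqr
    have hθ2 : θ / 2 = (q⁻¹).toReal := by
      rw [ENNReal.toReal_inv, hθ, ← hQ]; field_simp
    have hPθ : 2 / (1 + θ) = P / (P - 1) := by
      have h1 : P⁻¹ = 2⁻¹ - Q⁻¹ := by linarith
      have h2 : θ = 1 - 2 * P⁻¹ := by rw [h1, hθ, div_eq_mul_inv]; ring
      have h3 : P - 1 ≠ 0 := by linarith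
      rw [h2]
      have h4 : 1 + (1 - 2 * P⁻¹) = 2 * (P - 1) / P := by field_simp; ring
      rw [h4]
      field_simp
    have hQθ : 2 / (2 - θ) = Q / (Q - 1) := by
      have h3 : Q - 1 ≠ 0 := by linarith
      have h4 : 2 - θ = 2 * (Q - 1) / Q := by rw [hθ]; field_simp
      rw [h4]; field_simp
    have hQθ' : (2 - θ) / 2 = (Q - 1) / Q := by rw [hθ]; field_simp
    obtain ⟨C, hC⟩ := exists_enorm_integral_boxEvolution_mul_le hα0 hα1 hθ0 hθ1
    refine ⟨C, fun n h hh hh2 => ?_⟩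
    rw [← hθ2]
    obtain ⟨M, hM⟩ := exists_norm_boxEvolution_le (α := α) (n := n)
      (z := ((θ / 2 : ℝ) : ℂ)) (h := h)
    obtain ⟨S, hS, hS2⟩ :=
      exists_eLpNorm_boxEvolution_two_le (α := α) (n := n) (z := ((θ / 2 : ℝ) : ℂ)) hh hh2
    have hmain := lintegral_rpow_le_of_dual hPr hqr
      (v := fun a : ℝ × Plane => boxEvolution α n ((θ / 2 : ℝ) : ℂ) h a.1 a.2)
      (measurable_boxEvolution hh) (fun a => hM a.1 a.2) hS hS2
      (K := C * eLpNorm h 2 volume) (fun G hGm hGi hGt => by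
        have := hC n h G hh2 hGm hGi hGt
        rwa [hPθ, hQθ, hQθ'] at this)
    rw [eLpNorm_eq_lintegral_rpow_enorm_toReal hq0 hq]
    have e : ∀ t, ‖eLpNorm (boxEvolution α n ((θ / 2 : ℝ) : ℂ) h t) p volume‖ₑ ^ Q
        = (∫⁻ x, ‖boxEvolution α n ((θ / 2 : ℝ) : ℂ) h t x‖ₑ ^ P) ^ (Q / P) := by
      intro t
      rw [enorm_eq_self, eLpNorm_eq_lintegral_rpow_enorm_toReal hp0 hpt, ← ENNReal.rpow_mul]
      congr 1
      rw [one_div_mul_eq_div]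
    simp only [← hQ, e]
    calc _ ≤ ((C * eLpNorm h 2 volume) ^ Q) ^ (1 / Q) :=
          ENNReal.rpow_le_rpow hmain (by positivity)
      _ = _ := by rw [← ENNReal.rpow_mul, mul_one_div_cancel hqr0.ne', ENNReal.rpow_one]

/-! ### Limits in the mixed norm -/

lemma tsum_half_pow_add (N : ℕ) : ∑' i : ℕ, (2⁻¹ : ℝ≥0∞) ^ (N + i) = 2⁻¹ ^ N * 2 := by
  simp only [pow_add]
  rw [ENNReal.tsum_mul_left, ENNReal.tsum_geometric, ENNReal.one_sub_inv_two, inv_inv]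

section

variable {X : Type*} [MeasurableSpace X] {μ : Measure X} {p : ℝ≥0∞} {f : ℕ → X → ℂ} {N : ℕ}

lemma eLpNorm_sub_le_of_dyadic (hf : ∀ n, AEStronglyMeasurable (f n) μ) (hp : 1 ≤ p)
    (hd : ∀ k, N ≤ k → eLpNorm (f (k + 1) - f k) p μ ≤ 2⁻¹ ^ k) {n m : ℕ} (hn : N ≤ n)
    (hnm : n ≤ m) : eLpNorm (f m - f n) p μ ≤ 2⁻¹ ^ n * 2 := by
  obtain ⟨j, rfl⟩ := Nat.exists_eq_add_of_le hnm
  have h : eLpNorm (f (n + j) - f n) p μ ≤ ∑ i ∈ Finset.range j, (2⁻¹ : ℝ≥0∞) ^ (n + i) := by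
    clear hnm
    induction j with
    | zero => simp
    | succ j ih =>
      rw [Finset.sum_range_succ,
        show f (n + (j + 1)) - f n = (f (n + j) - f n) + (f (n + j + 1) - f (n + j)) by
          rw [← add_assoc]; abel]
      exact (eLpNorm_add_le ((hf _).sub (hf _)) ((hf _).sub (hf _)) hp).trans
        (add_le_add ih (hd _ (by omega)))
  exact (h.trans (ENNReal.sum_le_tsum _)).trans (tsum_half_pow_add n).le

/-- The shift by N is there because the increments are dyadically small only from N on. The
geometric series sums to 2; the 3 leaves room for the strict inequality. -/
lemma eLpNorm_sub_lt_of_dyadic (hf : ∀ n, AEStronglyMeasurable (f n) μ) (hp : 1 ≤ p)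
    (hd : ∀ k, N ≤ k → eLpNorm (f (k + 1) - f k) p μ ≤ 2⁻¹ ^ k) {i n m : ℕ}
    (hn : i ≤ n) (hm : i ≤ m) :
    eLpNorm (f (n + N) - f (m + N)) p μ < 2⁻¹ ^ i * 3 := by
  have h0 : (2⁻¹ : ℝ≥0∞) ^ i ≠ 0 := pow_ne_zero _ (by simp)
  have ht : (2⁻¹ : ℝ≥0∞) ^ i ≠ ∞ := ENNReal.pow_ne_top (by simp)
  have hlt : (2⁻¹ : ℝ≥0∞) ^ i * 2 < 2⁻¹ ^ i * 3 :=
    (ENNReal.mul_lt_mul_iff_right h0 ht).2 (by norm_num)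
  have key : ∀ a b : ℕ, i ≤ a → a ≤ b →
      eLpNorm (f (b + N) - f (a + N)) p μ < 2⁻¹ ^ i * 3 := by
    intro a b ha hab
    refine (eLpNorm_sub_le_of_dyadic hf hp hd (n := a + N) (m := b + N) (by omega)
      (by omega)).trans_lt (lt_of_le_of_lt ?_ hlt)
    gcongr ?_ * _
    exact pow_le_pow_right_of_le_one' (by simp) (by omega)
  rcases le_total n m with h | h
  · rw [eLpNorm_sub_comm]; exact key n m hn h
  · exact key m n hm h

lemma tsum_half_pow_mul_three_ne_top : ∑' i : ℕ, (2⁻¹ : ℝ≥0∞) ^ i * 3 ≠ ∞ := by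
  rw [ENNReal.tsum_mul_right, ENNReal.tsum_geometric, ENNReal.one_sub_inv_two, inv_inv]
  norm_num

lemma ae_exists_tendsto_of_dyadic (hf : ∀ n, AEStronglyMeasurable (f n) μ) (hp : 1 ≤ p)
    (hd : ∀ k, N ≤ k → eLpNorm (f (k + 1) - f k) p μ ≤ 2⁻¹ ^ k) :
    ∀ᵐ x ∂μ, ∃ l, Filter.Tendsto (fun n => f n x) Filter.atTop (nhds l) := by
  filter_upwards [Lp.ae_tendsto_of_cauchy_eLpNorm (f := fun n => f (n + N)) (fun n => hf _) hp
    tsum_half_pow_mul_three_ne_top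
    fun i n m hn hm => eLpNorm_sub_lt_of_dyadic hf hp hd hn hm] with x hx
  obtain ⟨l, hl⟩ := hx
  exact ⟨l, (Filter.tendsto_add_atTop_iff_nat N).1 hl⟩

lemma tendsto_eLpNorm_sub_of_dyadic (hf : ∀ n, AEStronglyMeasurable (f n) μ) (hp : 1 ≤ p)
    (hd : ∀ k, N ≤ k → eLpNorm (f (k + 1) - f k) p μ ≤ 2⁻¹ ^ k) {g : X → ℂ}
    (hg : ∀ᵐ x ∂μ, Filter.Tendsto (fun n => f n x) Filter.atTop (nhds (g x))) :
    Filter.Tendsto (fun n => eLpNorm (f n - g) p μ) Filter.atTop (nhds 0) := by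
  refine (Filter.tendsto_add_atTop_iff_nat N).1 ?_
  refine Lp.cauchy_tendsto_of_tendsto (f := fun n => f (n + N)) (fun n => hf _) g
    tsum_half_pow_mul_three_ne_top
    (fun i n m hn hm => eLpNorm_sub_lt_of_dyadic hf hp hd hn hm) ?_
  filter_upwards [hg] with x hx
  exact (Filter.tendsto_add_atTop_iff_nat N).2 hx

/-- Borel–Cantelli for a sequence with summable `L^q` norms. -/
lemma ae_eventually_le_of_eLpNorm_le {q : ℝ≥0∞} (hq : 1 ≤ q) {d : ℕ → X → ℝ≥0∞}
    (hd : ∀ k, Measurable (d k)) (hN : ∀ k, eLpNorm (d k) q μ ≤ 2⁻¹ ^ k * 2⁻¹ ^ k) :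
    ∀ᵐ x ∂μ, ∀ᶠ k in Filter.atTop, d k x ≤ 2⁻¹ ^ k := by
  have hle : ∀ k : ℕ, (2⁻¹ : ℝ≥0∞) ^ k ≤ 1 := fun k => pow_le_one₀ zero_le (by simp)
  rcases eq_or_ne q ∞ with rfl | hqt
  · have h : ∀ k, ∀ᵐ x ∂μ, d k x ≤ 2⁻¹ ^ k := by
      intro k
      filter_upwards [enorm_ae_le_eLpNormEssSup (d k) μ] with x hx
      rw [enorm_eq_self, ← eLpNorm_exponent_top] at hx
      exact (hx.trans (hN k)).trans (mul_le_of_le_one_left' (hle k))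
    filter_upwards [ae_all_iff.2 h] with x hx
    exact Filter.Eventually.of_forall hx
  · have hq0 : q ≠ 0 := (lt_of_lt_of_le zero_lt_one hq).ne'
    have hqr : 1 ≤ q.toReal := by simpa using ENNReal.toReal_mono hqt hq
    -- Chebyshev spends the two factors of the hypothesis: one $2^{-k}$ is the threshold, the other
    -- makes the measures summable.
    have hmeas : ∀ k, μ {x | (2⁻¹ : ℝ≥0∞) ^ k ≤ ‖d k x‖ₑ} ≤ 2⁻¹ ^ k := by
      intro k
      have h0 : (2⁻¹ : ℝ≥0∞) ^ k ≠ 0 := pow_ne_zero _ (by simp)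
      have ht : (2⁻¹ : ℝ≥0∞) ^ k ≠ ∞ := ENNReal.pow_ne_top (by simp)
      refine (meas_ge_le_mul_pow_eLpNorm_enorm μ hq0 hqt (hd k).aestronglyMeasurable h0
        (fun h => absurd h ht)).trans ?_
      rw [← ENNReal.mul_rpow_of_nonneg _ _ (by linarith)]
      calc (((2⁻¹ : ℝ≥0∞) ^ k)⁻¹ * eLpNorm (d k) q μ) ^ q.toReal
          ≤ (((2⁻¹ : ℝ≥0∞) ^ k)⁻¹ * (2⁻¹ ^ k * 2⁻¹ ^ k)) ^ q.toReal := by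
            gcongr
            exact hN k
        _ = ((2⁻¹ : ℝ≥0∞) ^ k) ^ q.toReal := by
            rw [← mul_assoc, ENNReal.inv_mul_cancel h0 ht, one_mul]
        _ ≤ ((2⁻¹ : ℝ≥0∞) ^ k) ^ (1 : ℝ) :=
            ENNReal.rpow_le_rpow_of_exponent_ge (hle k) hqr
        _ = _ := ENNReal.rpow_one _
    have hsum : ∑' k, μ {x | (2⁻¹ : ℝ≥0∞) ^ k ≤ ‖d k x‖ₑ} ≠ ∞ := by
      refine ne_top_of_le_ne_top ?_ (ENNReal.tsum_le_tsum hmeas)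
      rw [ENNReal.tsum_geometric, ENNReal.one_sub_inv_two, inv_inv]
      norm_num
    filter_upwards [ae_eventually_notMem hsum] with x hx
    filter_upwards [hx] with k hk
    have := not_le.1 hk
    rw [enorm_eq_self] at this
    exact this.le

end

lemma measurable_eLpNorm_slice {p : ℝ≥0∞} (hp0 : p ≠ 0) (hpt : p ≠ ∞) {w : ℝ × Plane → ℂ}
    (hw : Measurable w) : Measurable fun t => eLpNorm (fun x => w (t, x)) p volume := by
  simp only [eLpNorm_eq_lintegral_rpow_enorm_toReal hp0 hpt]
  exact ((hw.enorm.pow_const _).lintegral_prod_right').pow_const _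

/-- A measurable choice of pointwise limit. -/
lemma exists_measurable_limit {X : Type*} [MeasurableSpace X] {w : ℕ → X → ℂ}
    (hw : ∀ k, Measurable (w k)) :
    ∃ u : X → ℂ, Measurable u ∧ ∀ a, (∃ l, Filter.Tendsto (fun k => w k a) Filter.atTop (nhds l)) →
      Filter.Tendsto (fun k => w k a) Filter.atTop (nhds (u a)) := by
  classical
  set S : Set X := {a | ∃ l, Filter.Tendsto (fun k => w k a) Filter.atTop (nhds l)} with hS
  have hSm : MeasurableSet S := measurableSet_exists_tendsto hw
  refine ⟨fun a => if h : a ∈ S then h.choose else 0, ?_, fun a ha => ?_⟩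
  · refine measurable_of_tendsto_metrizable (f := fun k => S.indicator (w k))
      (fun k => (hw k).indicator hSm) (tendsto_pi_nhds.2 fun a => ?_)
    by_cases ha : a ∈ S
    · simp only [Set.indicator_of_mem ha, dif_pos ha]
      exact ha.choose_spec
    · simp only [Set.indicator_of_notMem ha, dif_neg ha]
      exact tendsto_const_nhds
  · have : a ∈ S := ha
    simp only [dif_pos this]
    exact this.choose_spec

/-- A sequence that converges fast in the mixed norm has a jointly measurable limit. -/
lemma exists_limit_of_eLpNorm_sub_le {q p : ℝ≥0∞} (hq : 1 ≤ q) (hp : 1 ≤ p) (hpt : p ≠ ∞)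
    {w : ℕ → ℝ → Plane → ℂ} (hw : ∀ k, Measurable fun a : ℝ × Plane => w k a.1 a.2)
    (hd : ∀ k, eLpNorm (fun t => eLpNorm (w (k + 1) t - w k t) p volume) q volume
      ≤ 2⁻¹ ^ k * 2⁻¹ ^ k)
    {K : ℝ≥0∞} (hK : ∀ k, eLpNorm (fun t => eLpNorm (w k t) p volume) q volume ≤ K) :
    ∃ u : ℝ → Plane → ℂ, Measurable (Function.uncurry u) ∧
      (∀ᵐ t : ℝ, Filter.Tendsto (fun k => eLpNorm (w k t - u t) p volume)
        Filter.atTop (nhds 0)) ∧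
      eLpNorm (fun t => eLpNorm (u t) p volume) q volume ≤ K := by
  have hp0 : p ≠ 0 := (lt_of_lt_of_le zero_lt_one hp).ne'
  have hws : ∀ k t, AEStronglyMeasurable (w k t) volume := fun k t =>
    ((hw k).comp measurable_prodMk_left).aestronglyMeasurable
  obtain ⟨u, hu, hlim⟩ := exists_measurable_limit hw
  have hev := ae_eventually_le_of_eLpNorm_le (μ := (volume : Measure ℝ)) hq
    (fun k => measurable_eLpNorm_slice hp0 hpt ((hw (k + 1)).sub (hw k))) hd
  -- The index N depends on t: smallness in the mixed norm gives dyadic $L^p$ increments only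
  -- eventually, for almost every t.
  have hpt2 : ∀ᵐ t : ℝ, ∃ N : ℕ, (∀ k, N ≤ k → eLpNorm (w (k + 1) t - w k t) p volume ≤ 2⁻¹ ^ k)
      ∧ ∀ᵐ x, Filter.Tendsto (fun k => w k t x) Filter.atTop (nhds (u (t, x))) := by
    filter_upwards [hev] with t ht
    obtain ⟨N, hN⟩ := Filter.eventually_atTop.1 ht
    refine ⟨N, hN, ?_⟩
    filter_upwards [ae_exists_tendsto_of_dyadic (fun k => hws k t) hp hN] with x hx
    exact hlim (t, x) hx
  refine ⟨fun t x => u (t, x), hu, ?_, ?_⟩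
  · filter_upwards [hpt2] with t ht
    obtain ⟨N, hN, hx⟩ := ht
    exact tendsto_eLpNorm_sub_of_dyadic (fun k => hws k t) hp hN hx
  · have hle : ∀ᵐ t : ℝ, eLpNorm (fun x => u (t, x)) p volume
        ≤ Filter.liminf (fun k => eLpNorm (w k t) p volume) Filter.atTop := by
      filter_upwards [hpt2] with t ht
      obtain ⟨N, hN, hx⟩ := ht
      exact Lp.eLpNorm_lim_le_liminf_eLpNorm (fun k => hws k t) _ hx
    rcases eq_or_ne q ∞ with rfl | hqt
    · rw [eLpNorm_exponent_top]
      refine eLpNormEssSup_le_of_ae_enorm_bound ?_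
      have hb : ∀ k, ∀ᵐ t : ℝ, eLpNorm (w k t) p volume ≤ K := by
        intro k
        filter_upwards [enorm_ae_le_eLpNormEssSup (fun t => eLpNorm (w k t) p volume) volume]
          with t ht
        rw [enorm_eq_self, ← eLpNorm_exponent_top] at ht
        exact ht.trans (hK k)
      filter_upwards [hle, ae_all_iff.2 hb] with t ht hbt
      rw [enorm_eq_self]
      refine ht.trans (Filter.liminf_le_of_le (by isBoundedDefault) fun b hb => ?_)
      obtain ⟨k, hk⟩ := hb.exists
      exact hk.trans (hbt k)
    · have hq0 : q ≠ 0 := (lt_of_lt_of_le zero_lt_one hq).ne'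
      have hqr : 0 < q.toReal := ENNReal.toReal_pos hq0 hqt
      have hKk : ∀ k, ∫⁻ t, eLpNorm (w k t) p volume ^ q.toReal ≤ K ^ q.toReal := by
        intro k
        have := hK k
        rw [eLpNorm_eq_lintegral_rpow_enorm_toReal hq0 hqt, one_div,
          ENNReal.rpow_inv_le_iff hqr] at this
        simpa only [enorm_eq_self] using this
      rw [eLpNorm_eq_lintegral_rpow_enorm_toReal hq0 hqt, one_div, ENNReal.rpow_inv_le_iff hqr]
      simp only [enorm_eq_self]
      calc ∫⁻ t, eLpNorm (fun x => u (t, x)) p volume ^ q.toReal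
          ≤ ∫⁻ t, Filter.liminf (fun k => eLpNorm (w k t) p volume ^ q.toReal) Filter.atTop := by
            refine lintegral_mono_ae ?_
            filter_upwards [hle] with t ht
            refine (ENNReal.rpow_le_rpow ht hqr.le).trans (le_of_eq ?_)
            exact (ENNReal.orderIsoRpow q.toReal hqr).liminf_apply
        _ ≤ Filter.liminf (fun k => ∫⁻ t, eLpNorm (w k t) p volume ^ q.toReal) Filter.atTop :=
            lintegral_liminf_le fun k =>
              (measurable_eLpNorm_slice hp0 hpt (hw k)).pow_const _
        _ ≤ K ^ q.toReal := by
            refine Filter.liminf_le_of_le (by isBoundedDefault) fun b hb => ?_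
            obtain ⟨k, hk⟩ := hb.exists
            exact hk.trans (hKk k)

/-! ### Exhaustion of the frequency plane by the boxes -/

lemma freqBox_mono {n m : ℕ} (h : n ≤ m) : freqBox n ⊆ freqBox m := by
  have h1 : (n : ℝ) + 1 ≤ m + 1 := by exact_mod_cast Nat.succ_le_succ h
  have h2 : ((m : ℝ) + 1)⁻¹ ≤ ((n : ℝ) + 1)⁻¹ := inv_anti₀ (by positivity) h1
  exact fun k hk => ⟨⟨h2.trans hk.1.1, hk.1.2.trans h1⟩, ⟨h2.trans hk.2.1, hk.2.2.trans h1⟩⟩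

lemma eventually_mem_freqBand {x : ℝ} (hx : x ≠ 0) :
    ∀ᶠ n : ℕ in Filter.atTop, x ∈ freqBand n := by
  have h0 : 0 < |x| := abs_pos.2 hx
  have h1 : Filter.Tendsto (fun n : ℕ => (n : ℝ) + 1) Filter.atTop Filter.atTop :=
    Filter.tendsto_atTop_add_const_right _ _ tendsto_natCast_atTop_atTop
  filter_upwards [h1.eventually_ge_atTop |x|, h1.eventually_ge_atTop |x|⁻¹] with n hn hn2
  exact ⟨inv_le_of_inv_le₀ h0 hn2, hn⟩

lemma ae_coordinates_ne_zero : ∀ᵐ k : Plane, k 0 ≠ 0 ∧ k 1 ≠ 0 := by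
  have h : ∀ᵐ a : ℝ × ℝ, a.1 ≠ 0 ∧ a.2 ≠ 0 := by
    have h0 : ∀ᵐ x : ℝ, x ≠ 0 := Measure.ae_ne volume 0
    have h1 : ∀ᵐ a : ℝ × ℝ ∂(volume.prod volume), a.1 ≠ 0 :=
      Measure.quasiMeasurePreserving_fst.ae h0
    have h2 : ∀ᵐ a : ℝ × ℝ ∂(volume.prod volume), a.2 ≠ 0 :=
      Measure.quasiMeasurePreserving_snd.ae h0
    exact h1.and h2
  exact measurePreserving_planeEquiv.quasiMeasurePreserving.ae h

lemma ae_eventually_mem_freqBox :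
    ∀ᵐ k : Plane, ∀ᶠ n : ℕ in Filter.atTop, k ∈ freqBox n := by
  filter_upwards [ae_coordinates_ne_zero] with k hk
  exact (eventually_mem_freqBand hk.1).and (eventually_mem_freqBand hk.2)

lemma ae_freqX_ne_zero : ∀ᵐ k : Plane, freqX k ≠ 0 := by
  filter_upwards [ae_coordinates_ne_zero] with k hk
  exact mul_ne_zero Real.two_pi_pos.ne' hk.1

/-- Dominated convergence: every frequency off the coordinate axes lies in all large boxes. -/
lemma tendsto_eLpNorm_compl_freqBox {h : Plane → ℂ} (hh : Measurable h) (hh2 : MemLp h 2) :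
    Filter.Tendsto (fun n => eLpNorm ((freqBox n)ᶜ.indicator h) 2 volume) Filter.atTop
      (nhds 0) := by
  have h2 : ∫⁻ k, ‖h k‖ₑ ^ (2 : ℝ) ≠ ∞ := by
    have := (eLpNorm_lt_top_iff_lintegral_rpow_enorm_lt_top (by norm_num) (by norm_num)).1 hh2.2
    simpa using this.ne
  have key : Filter.Tendsto (fun n => ∫⁻ k, ‖(freqBox n)ᶜ.indicator h k‖ₑ ^ (2 : ℝ))
      Filter.atTop (nhds (∫⁻ _ : Plane, 0)) := by
    refine tendsto_lintegral_of_dominated_convergence (fun k => ‖h k‖ₑ ^ (2 : ℝ))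
      (fun n => ((hh.indicator (measurableSet_freqBox n).compl).enorm.pow_const _))
      (fun n => Filter.Eventually.of_forall fun k => ?_) h2 ?_
    · exact ENNReal.rpow_le_rpow (enorm_indicator_le_enorm_self h k) (by norm_num)
    · filter_upwards [ae_eventually_mem_freqBox] with k hk
      refine tendsto_const_nhds.congr' ?_
      filter_upwards [hk] with n hn
      rw [Set.indicator_of_notMem (by simpa using hn), enorm_zero,
        ENNReal.zero_rpow_of_pos (by norm_num)]
  rw [lintegral_zero] at key
  have := ((ENNReal.continuous_rpow_const (y := 1 / 2)).tendsto 0).comp key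
  rw [ENNReal.zero_rpow_of_pos (by norm_num)] at this
  refine this.congr fun n => ?_
  rw [eLpNorm_eq_lintegral_rpow_enorm_toReal (by norm_num) (by norm_num)]
  simp

lemma boxProfile_sub (α : ℝ) {n m : ℕ} (hnm : n ≤ m) (z : ℂ) (h : Plane → ℂ) (t : ℝ) (k : Plane) :
    boxProfile α m z h t k - boxProfile α n z h t k
      = boxProfile α m z ((freqBox n)ᶜ.indicator h) t k := by
  simp only [boxProfile]
  by_cases hn : k ∈ freqBox n
  · have hm : k ∈ freqBox m := freqBox_mono hnm hn
    simp [hn, hm]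
  · by_cases hm : k ∈ freqBox m
    · simp [hn, hm]
    · simp [hn, hm]

lemma integrable_planeWave_mul {f : Plane → ℂ} (hf : Integrable f) (z : Plane) :
    Integrable fun k => planeWave z k * f k := by
  have hm : Measurable (planeWave z) := by unfold planeWave; fun_prop
  exact hf.bdd_mul hm.aestronglyMeasurable
    (Filter.Eventually.of_forall fun k => (norm_planeWave z k).le)

/-- The boxes are nested, so an increment is itself a truncated evolution, of data supported off the
smaller box. The uniform estimate therefore makes the truncations Cauchy. -/
lemma boxEvolution_sub {α : ℝ} {n m : ℕ} (hnm : n ≤ m) {z : ℂ} {h : Plane → ℂ}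
    (hh : Measurable h) (hh2 : MemLp h 2) (t : ℝ) :
    boxEvolution α m z h t - boxEvolution α n z h t
      = boxEvolution α m z ((freqBox n)ᶜ.indicator h) t := by
  funext x
  simp only [Pi.sub_apply, boxEvolution_eq_fourierInv, fourierInv_eq_integral_planeWave]
  rw [← integral_sub (integrable_planeWave_mul (integrable_boxProfile hh hh2 t) _)
    (integrable_planeWave_mul (integrable_boxProfile hh hh2 t) _)]
  simp only [← mul_sub, boxProfile_sub α hnm]

lemma weight_ofReal (α s : ℝ) {k : Plane} (hk : freqX k ≠ 0) :
    weight α (s : ℂ) k = ((|freqX k| ^ (s / 2 * (α - 1)) : ℝ) : ℂ) := by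
  rw [weight, ← Complex.ofReal_mul, ← Complex.ofReal_exp, Real.rpow_def_of_pos (abs_pos.2 hk)]
  congr 2
  ring

/-! ### Test functions -/

/-- The multiplication formula after the reflection z ↦ -z, which exchanges `𝓕` and `𝓕⁻`. -/
lemma integral_fourierInv_mul_fourier {H : Plane → ℂ} (hH : Integrable H) (ψ : 𝓢(Plane, ℂ)) :
    ∫ z, 𝓕⁻ H z * (𝓕 ψ) z = ∫ k, H k * ψ k := by
  have h1 : ∀ z, 𝓕⁻ H z * (𝓕 ψ) z = (fun z => 𝓕 H z * (𝓕⁻ ψ) z) (-z) := by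
    intro z
    simp only [SchwartzMap.fourier_coe, SchwartzMap.fourierInv_coe,
      Real.fourierInv_eq_fourier_neg, neg_neg]
  simp only [h1]
  refine (integral_neg_eq_self (fun z => 𝓕 H z * (𝓕⁻ ψ) z) volume).trans ?_
  rw [integral_fourier_mul hH
    (𝓕⁻ ψ).integrable, ← SchwartzMap.fourier_coe, FourierTransform.fourier_fourierInv_eq]

lemma integrable_indicator_abs_rpow {r : ℝ} (hr : -1 < r) :
    Integrable ((Set.Ioo (-1 : ℝ) 1).indicator fun x => |x| ^ r) := by
  rw [integrable_indicator_iff measurableSet_Ioo]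
  have h1 : IntegrableOn (fun x : ℝ => |x| ^ r) (Set.Ioc 0 1) := by
    have := (intervalIntegrable_iff_integrableOn_Ioc_of_le zero_le_one).1
      (intervalIntegral.intervalIntegrable_rpow' (a := 0) (b := 1) hr)
    refine this.congr_fun (fun x hx => ?_) measurableSet_Ioc
    simp only [abs_of_pos hx.1]
  have h2 : IntegrableOn (fun x : ℝ => |x| ^ r) (Set.Ico (-1) 0) := by
    have := (Measure.measurePreserving_neg (volume : Measure ℝ)).integrableOn_comp_preimage
      (Homeomorph.neg ℝ).measurableEmbedding (f := fun x : ℝ => |x| ^ r) (s := Set.Ioc 0 1)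
    rw [← this] at h1
    refine (h1.congr_fun (fun x _ => by simp) (measurable_neg measurableSet_Ioc)).mono_set ?_
    intro x hx
    exact ⟨by simpa using hx.2, by simpa using neg_le.1 hx.1⟩
  have h3 : IntegrableOn (fun x : ℝ => |x| ^ r) ({0} : Set ℝ) := by
    rw [IntegrableOn, Measure.restrict_eq_zero.2 (by simp)]
    exact integrable_zero_measure
  refine ((h2.union h3).union h1).mono_set fun x hx => ?_
  rcases lt_trichotomy x 0 with h | h | h
  · exact Or.inl (Or.inl ⟨hx.1.le, h⟩)
  · exact Or.inl (Or.inr h)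
  · exact Or.inr ⟨h, hx.2.le⟩

lemma exists_norm_le_inv_one_add_sq (ψ : 𝓢(Plane, ℂ)) :
    ∃ C : ℝ, 0 ≤ C ∧ ∀ k, ‖ψ k‖ ^ 2 ≤ C * (1 + k 1 ^ 2)⁻¹ := by
  obtain ⟨A, hA0, hA⟩ := ψ.decay 0 0
  obtain ⟨B, hB0, hB⟩ := ψ.decay 1 0
  refine ⟨A ^ 2 + B ^ 2, by positivity, fun k => ?_⟩
  have h0 := hA k
  have h1 := hB k
  simp only [norm_iteratedFDeriv_zero, pow_zero, one_mul, pow_one] at h0 h1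
  have h2 : |k 1| ≤ ‖k‖ := by simpa using PiLp.norm_apply_le k 1
  have h3 : |k 1| * ‖ψ k‖ ≤ B := (mul_le_mul_of_nonneg_right h2 (norm_nonneg _)).trans h1
  have h4 : (|k 1| * ‖ψ k‖) ^ 2 ≤ B ^ 2 := pow_le_pow_left₀ (by positivity) h3 2
  have h5 : ‖ψ k‖ ^ 2 ≤ A ^ 2 := pow_le_pow_left₀ (norm_nonneg _) h0 2
  rw [mul_pow, sq_abs] at h4
  rw [← div_eq_mul_inv, le_div_iff₀ (by positivity)]
  nlinarith

lemma measurable_abs_freqX_rpow (s : ℝ) : Measurable fun k => |freqX k| ^ s :=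
  (continuous_abs.measurable.comp measurable_freqX).pow_const s

/-- For |ξ| < 1 the square is dominated by $|\xi|^{2s}$ times an integrable function of `k 1`; here
s > -1/2 makes the singularity integrable. For |ξ| ≥ 1 the weight is at most 1, as s ≤ 0. -/
lemma memLp_abs_freqX_rpow_mul {s : ℝ} (hs : -(1 / 2) < s) (hs0 : s ≤ 0) (ψ : 𝓢(Plane, ℂ)) :
    MemLp (fun k => ((|freqX k| ^ s : ℝ) : ℂ) * ψ k) 2 := by
  have hm : Measurable fun k => ((|freqX k| ^ s : ℝ) : ℂ) * ψ k :=
    (Complex.measurable_ofReal.comp (measurable_abs_freqX_rpow s)).mul ψ.continuous.measurable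
  rw [memLp_two_iff_integrable_sq_norm hm.aestronglyMeasurable]
  obtain ⟨C, hC0, hC⟩ := exists_norm_le_inv_one_add_sq ψ
  have hψ : Integrable fun k => ‖ψ k‖ ^ 2 :=
    (memLp_two_iff_integrable_sq_norm ψ.continuous.measurable.aestronglyMeasurable).1 (ψ.memLp 2)
  have hA : Integrable fun x : ℝ =>
      (Set.Ioo (-1 : ℝ) 1).indicator (fun x => |x| ^ (2 * s)) (2 * Real.pi * x) :=
    (integrable_indicator_abs_rpow (r := 2 * s) (by linarith)).comp_mul_left'
      Real.two_pi_pos.ne'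
  have hAB := measurePreserving_planeEquiv.integrable_comp_of_integrable
    (hA.mul_prod (integrable_inv_one_add_sq.const_mul C))
  refine (hAB.add hψ).mono' (hm.norm.pow_const 2).aestronglyMeasurable
    (Filter.Eventually.of_forall fun k => ?_)
  have hr0 : 0 ≤ |freqX k| ^ s := Real.rpow_nonneg (abs_nonneg _) _
  have hsq : (|freqX k| ^ s) ^ 2 = |freqX k| ^ (2 * s) := by
    rw [← Real.rpow_natCast, ← Real.rpow_mul (abs_nonneg _)]
    congr 1
    push_cast
    ring
  have hB0 : 0 ≤ C * (1 + k 1 ^ 2)⁻¹ := mul_nonneg hC0 (by positivity)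
  rw [Real.norm_of_nonneg (by positivity), norm_mul, Complex.norm_real, Real.norm_of_nonneg hr0,
    mul_pow, hsq]
  simp only [Pi.add_apply, Function.comp_apply, planeEquiv_apply]
  by_cases hk : freqX k ∈ Set.Ioo (-1 : ℝ) 1
  · rw [show 2 * Real.pi * k 0 = freqX k from rfl, Set.indicator_of_mem hk]
    have := mul_le_mul_of_nonneg_left (hC k) (Real.rpow_nonneg (abs_nonneg (freqX k)) (2 * s))
    linarith [sq_nonneg ‖ψ k‖]
  · rw [show 2 * Real.pi * k 0 = freqX k from rfl, Set.indicator_of_notMem hk, zero_mul, zero_add]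
    have h1 : 1 ≤ |freqX k| := by
      by_contra hlt
      exact hk (abs_lt.1 (not_le.1 hlt))
    have h2 : |freqX k| ^ (2 * s) ≤ 1 := Real.rpow_le_one_of_one_le_of_nonpos h1 (by linarith)
    exact mul_le_of_le_one_left (sq_nonneg _) h2

/-! ### Identification of the limit -/

lemma fourier_U_ae_eq (α t : ℝ) (φ : L2) :
    (𝓕 (U α t φ) : L2) =ᵐ[volume] fun k => groupSymbol α t k * (𝓕 φ : L2) k := by
  rw [U, FourierTransform.fourier_fourierInv_eq]
  exact MemLp.coeFn_toLp _

lemma tendsto_integral_mul_of_tendsto_eLpNorm {p p' : ℝ≥0∞} [p.HolderTriple p' 1]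
    {v : ℕ → Plane → ℂ} {u g : Plane → ℂ} (hv : ∀ k, MemLp (v k) p) (hu : MemLp u p)
    (hg : MemLp g p')
    (h : Filter.Tendsto (fun k => eLpNorm (v k - u) p volume) Filter.atTop (nhds 0)) :
    Filter.Tendsto (fun k => ∫ z, v k z * g z) Filter.atTop (nhds (∫ z, u z * g z)) := by
  refine tendsto_integral_of_L1' (fun z => u z * g z)
    (hu.integrable_mul hg).aestronglyMeasurable
    (Filter.Eventually.of_forall fun k => (hv k).integrable_mul hg) ?_
  have h1 : Filter.Tendsto (fun k => eLpNorm (v k - u) p volume * eLpNorm g p' volume)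
      Filter.atTop (nhds 0) := by
    have := ENNReal.Tendsto.mul_const h (Or.inr hg.2.ne)
    rwa [zero_mul] at this
  refine tendsto_of_tendsto_of_tendsto_of_le_of_le tendsto_const_nhds h1 (fun _ => zero_le)
    fun k => ?_
  have h2 : ((fun z => v k z * g z) - fun z => u z * g z) = (v k - u) • g := by
    funext z
    simp [sub_mul]
  simp only [h2]
  exact eLpNorm_smul_le_mul_eLpNorm hg.1 ((hv k).1.sub hu.1)

/-- Each truncated integrand is the limit integrand restricted to a box, so the limit dominates. -/
lemma tendsto_integral_boxProfile_mul {α s t : ℝ} {h g ψ : Plane → ℂ} (hh : Measurable h)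
    (hψ : Measurable ψ)
    (hg : g =ᵐ[volume] fun k => groupSymbol α t k * h k)
    (hi : Integrable fun k => ((|freqX k| ^ (s / 2 * (α - 1)) : ℝ) : ℂ) * g k * ψ k)
    {ns : ℕ → ℕ} (hns : StrictMono ns) :
    Filter.Tendsto (fun j => ∫ k, boxProfile α (ns j) (s : ℂ) h t k * ψ k) Filter.atTop
      (nhds (∫ k, ((|freqX k| ^ (s / 2 * (α - 1)) : ℝ) : ℂ) * g k * ψ k)) := by
  have hae : ∀ᵐ k : Plane, weight α (s : ℂ) k * groupSymbol α t k * h k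
      = ((|freqX k| ^ (s / 2 * (α - 1)) : ℝ) : ℂ) * g k := by
    filter_upwards [ae_freqX_ne_zero, hg] with k hk hgk
    rw [weight_ofReal α s hk, hgk, mul_assoc]
  refine tendsto_integral_of_dominated_convergence _
    (fun j => ((measurable_boxProfile hh t).mul hψ).aestronglyMeasurable) hi.norm (fun j => ?_) ?_
  · filter_upwards [hae] with k hk
    rw [norm_mul, norm_mul _ (ψ k), ← hk]
    exact mul_le_mul_of_nonneg_right (norm_indicator_le_norm_self _ k) (norm_nonneg _)
  · filter_upwards [hae, ae_eventually_mem_freqBox] with k hk hev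
    refine tendsto_const_nhds.congr' ?_
    filter_upwards [hns.tendsto_atTop.eventually hev] with j hj
    rw [boxProfile, Set.indicator_of_mem hj, hk]

/-- A limit in `L^p` of the truncated evolutions is the fractional derivative of the
evolution. -/
lemma isDx_of_tendsto {α s t : ℝ} (hs : -(1 / 2) < s / 2 * (α - 1)) (hs0 : s / 2 * (α - 1) ≤ 0)
    (φ : L2) {p : ℝ≥0∞} (hp : 2 ≤ p) (hpt : p ≠ ∞) {u : Plane → ℂ} (hu : Measurable u)
    {ns : ℕ → ℕ} (hns : StrictMono ns)
    (hlim : Filter.Tendsto (fun j =>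
      eLpNorm (boxEvolution α (ns j) (s : ℂ) (𝓕 φ : L2) t - u) p volume) Filter.atTop (nhds 0)) :
    IsDx (s / 2 * (α - 1)) (U α t φ) u := by
  intro ψ
  have hp1 : 1 ≤ p := le_trans (by norm_num) hp
  have : p.HolderConjugate p.conjExponent := ENNReal.HolderConjugate.conjExponent hp1
  have hh : Measurable (𝓕 φ : L2) := (Lp.stronglyMeasurable (𝓕 φ : L2)).measurable
  have hh2 : MemLp (𝓕 φ : L2) 2 := Lp.memLp _
  have hv : ∀ j, MemLp (boxEvolution α (ns j) (s : ℂ) (𝓕 φ : L2) t) p := fun j =>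
    memLp_boxEvolution hh hh2 t hp hpt
  have hup : MemLp u p := by
    obtain ⟨j, hj⟩ := (hlim.eventually (gt_mem_nhds ENNReal.zero_lt_top)).exists
    have hd : MemLp (boxEvolution α (ns j) (s : ℂ) (𝓕 φ : L2) t - u) p :=
      ⟨(hv j).1.sub hu.aestronglyMeasurable, hj⟩
    simpa using (hv j).sub hd
  have hψ : MemLp (𝓕 ψ : 𝓢(Plane, ℂ)) p.conjExponent := (𝓕 ψ).memLp _
  have hgm : Integrable fun k : Plane =>
      ((|freqX k| ^ (s / 2 * (α - 1)) : ℝ) : ℂ) * (𝓕 (U α t φ) : L2) k * ψ k := by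
    refine ((Lp.memLp (𝓕 (U α t φ) : L2)).integrable_mul
      (memLp_abs_freqX_rpow_mul hs hs0 ψ)).congr (Filter.Eventually.of_forall fun k => ?_)
    simp only [Pi.mul_apply]
    ring
  refine ⟨hup.integrable_mul hψ, hgm, ?_⟩
  refine tendsto_nhds_unique (tendsto_integral_mul_of_tendsto_eLpNorm hv hup hψ hlim) ?_
  refine (tendsto_integral_boxProfile_mul hh ψ.continuous.measurable (fourier_U_ae_eq α t φ) hgm
    hns).congr fun j => ?_
  rw [boxEvolution_eq_fourierInv, integral_fourierInv_mul_fourier (integrable_boxProfile hh hh2 t)]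

end FracBO

end

/-! ### Assembly of the estimate -/

theorem proposition3p2 (α : ℝ) (hα0 : 0 < α) (hα1 : α ≤ 1)
    (q p : ℝ≥0∞) (hqp : FracBO.IsAdmissible q p) :
    ∃ C : ℝ≥0, ∀ φ : FracBO.L2,
      ∃ u : ℝ → FracBO.Plane → ℂ,
        Measurable (Function.uncurry u) ∧
        (∀ᵐ t : ℝ, FracBO.IsDx ((q⁻¹).toReal / 2 * (α - 1)) (FracBO.U α t φ) (u t)) ∧
        ∀ T : ℝ, 0 < T → FracBO.mixedNorm T q p u ≤ C * ‖φ‖ₑ := by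
  open FracBO in
  obtain ⟨C, hC⟩ := exists_eLpNorm_boxEvolution_le hα0 hα1 hqp
  refine ⟨C, fun φ => ?_⟩
  have hq1 : 1 ≤ q := le_trans (by norm_num) hqp.two_lt.le
  have hp1 : 1 ≤ p := le_trans (by norm_num) hqp.two_le
  have hq0 : 0 ≤ (q⁻¹).toReal := ENNReal.toReal_nonneg
  have hq2 : (q⁻¹).toReal ≤ 1 := by
    simpa using ENNReal.toReal_mono ENNReal.one_ne_top (ENNReal.inv_le_one.2 hq1)
  have hpt : p ≠ ∞ := by
    rintro rfl
    have := hqp.add_eq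
    rw [ENNReal.inv_top, add_zero] at this
    exact hqp.two_lt.ne' (inv_injective this)
  -- Uses α > 0 and 1/q ≤ 1; this is what makes the pairing with Schwartz functions absolutely
  -- convergent.
  have hs : -(1 / 2) < (q⁻¹).toReal / 2 * (α - 1) := by nlinarith
  have hs0 : (q⁻¹).toReal / 2 * (α - 1) ≤ 0 := by nlinarith
  set s := (q⁻¹).toReal with hs_def
  have hh : Measurable (𝓕 φ : L2) := (Lp.stronglyMeasurable (𝓕 φ : L2)).measurable
  have hh2 : MemLp (𝓕 φ : L2) 2 (volume : Measure Plane) := Lp.memLp _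
  have hnorm : eLpNorm (𝓕 φ : L2) 2 (volume : Measure Plane) = ‖φ‖ₑ := by
    rw [← Lp.enorm_def, ← ofReal_norm, ← ofReal_norm, Lp.norm_fourier_eq]
  -- The rate $4^{-j}$, written as a product, is the one the limit lemma requires; a subsequence of
  -- boxes attains it.
  have hsmall : ∀ j : ℕ, ∀ᶠ n in Filter.atTop,
      C * eLpNorm ((freqBox n)ᶜ.indicator (𝓕 φ : L2)) 2 volume ≤ 2⁻¹ ^ j * 2⁻¹ ^ j := by
    intro j
    have h1 := ENNReal.Tendsto.const_mul (tendsto_eLpNorm_compl_freqBox hh hh2)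
      (Or.inr (ENNReal.coe_ne_top (r := C)))
    rw [mul_zero] at h1
    have h2 : (0 : ℝ≥0∞) < 2⁻¹ ^ j := ENNReal.pow_pos (by simp) j
    exact h1.eventually (ge_mem_nhds (ENNReal.mul_pos h2.ne' h2.ne'))
  obtain ⟨ns, hns, hle⟩ := Filter.extraction_forall_of_eventually hsmall
  obtain ⟨u, hu, hlim, hbound⟩ := exists_limit_of_eLpNorm_sub_le hq1 hp1 hpt
    (w := fun j => boxEvolution α (ns j) (s : ℂ) (𝓕 φ : L2))
    (fun j => measurable_boxEvolution hh)
    (fun j => by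
      simp only [boxEvolution_sub (hns.monotone j.le_succ) hh hh2]
      exact (hC _ _ (hh.indicator (measurableSet_freqBox _).compl)
        (hh2.indicator (measurableSet_freqBox _).compl)).trans (hle j))
    (fun j => hC (ns j) _ hh hh2)
  refine ⟨u, hu, ?_, fun T _ => ?_⟩
  · filter_upwards [hlim] with t ht
    exact isDx_of_tendsto hs hs0 φ hqp.two_le hpt (hu.comp measurable_prodMk_left) hns ht
  -- The bound holds over all of ℝ in time, so restricting to [0, T] gives a constant independent of
  -- T.
  · rw [hnorm] at hbound
    exact (eLpNorm_mono_measure _ Measure.restrict_le_self).trans hbound
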